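/- **Setting.** Graphs are finite and simple. A *cycle* of a graph $G$ is a subgraph in which every vertex has even degree, identified with its edge set; cycles are added by symmetric difference $\oplus$ and so form a vector space over $\mathbb{Z}/2\mathbb{Z}$. The weight of a cycle is its number of edges. A *cycle basis* of $G$ is a linearly independent set of cycles that spans all cycles of $G$; a *minimum cycle basis* is a cycle basis whose total weight is minimum. An instance consists of $k\ge 1$ graphs $G_1,\dots,G_k$ on the same vertex set $\{0,\dots,n-1\}$. A *feasible solution* is a set $B$ of cycles of $\bigcap_i G_i$ such that for every $i$ there is a minimum cycle basis $B_i$ of $G_i$ with $B\subseteq B_i$. *max-MCBI* asks for a feasible solution $B$ with $|B|$ maximum; *MCBI* asks, given also $K\in\mathbb{N}$, whether there is a feasible solution with $|B|\ge K$. Let $\Delta$ be the maximum degree in the graphs $G_i$ and $\gamma$ the maximum weight of a cycle in a minimum cycle basis of any $G_i$. Let $L$ be a list of candidate cycles of $G=\bigcap_i G_i$, obtained by fixing one shortest path of $G$ between any two vertices of the same component and taking all elementary cycles that consist either of an edge $vw$ and the shortest paths from a vertex $u$ to $v$ and to $w$, or of two edges $uv$, $wx$ and the shortest paths from $u$ to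 $w$ and from $v$ to $x$. Let $T(G_i)$ be the set of triangles of $G_i$. **Theorem.** Restricted to the instances with $\gamma\le 4$ and $\Delta\le 3$, both MCBI and max-MCBI are solvable in polynomial time (for max-MCBI the algorithm outputs an optimal solution), where the graphs are given by their adjacency matrices and $K$ by a number in binary. Moreover, for every such instance, for every choice of the shortest paths, and for every ordering of the squares (cycles of weight $4$) of $L$ that are not spanned by $T(G_i)$ for any $i$, the following greedy algorithm is optimal: start with $S=\emptyset$, go through these squares in the given order, and add $c$ to $S$ unless $c\in \mathrm{span}(S\cup T(G_i))$ for some $i$. That is, the final $S$ has maximum size among the feasible solutions consisting of squares; and for every feasible solution $D$ consisting of triangles that has maximum size among those, $D\cup S$ is an optimal solution of max-MCBI. -/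

import Mathlib

namespace MCBI

/-! ## Cycles, cycle bases, minimum cycle bases -/

section Graphs

variable {V : Type*}

/-- A cycle of `G` is a subgraph of `G` in which every vertex has even degree; it is identified
with its edge set, i.e. it is given as a graph `c ≤ G` on the same vertex set. -/
def IsCycleOf (G c : SimpleGraph V) : Prop :=
  c ≤ G ∧ ∀ v, Even (c.neighborSet v).ncard

/-- The weight of a cycle: its number of edges. -/
noncomputable def weight (c : SimpleGraph V) : ℕ := c.edgeSet.ncard

/-- The edge set of `c` as a vector over `ℤ/2ℤ`: the sum of two such vectors is the vector of the
symmetric difference of the edge sets. -/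
noncomputable def edgeVec (c : SimpleGraph V) : Sym2 V → ZMod 2 := c.edgeSet.indicator 1

/-- `B` spans `d`. -/
def Spans (B : Set (SimpleGraph V)) (d : SimpleGraph V) : Prop :=
  edgeVec d ∈ Submodule.span (ZMod 2) (edgeVec '' B)

/-- `B` is a cycle basis of `G`: a linearly independent set of cycles spanning all cycles. -/
def IsCycleBasis (G : SimpleGraph V) (B : Finset (SimpleGraph V)) : Prop :=
  (∀ c ∈ B, IsCycleOf G c) ∧ LinearIndepOn (ZMod 2) edgeVec (B : Set (SimpleGraph V)) ∧
    ∀ d, IsCycleOf G d → Spans (B : Set (SimpleGraph V)) d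

/-- `B` is a minimum cycle basis of `G`. -/
def IsMinCycleBasis (G : SimpleGraph V) (B : Finset (SimpleGraph V)) : Prop :=
  IsCycleBasis G B ∧ ∀ B', IsCycleBasis G B' → ∑ c ∈ B, weight c ≤ ∑ c ∈ B', weight c

/-- The graph `G₁ ∩ ⋯ ∩ Gₖ`. -/
def common (Gs : List (SimpleGraph V)) : SimpleGraph V := ⨅ G ∈ Gs, G

/-- Feasible solutions of max-MCBI: a set of cycles of `G₁ ∩ ⋯ ∩ Gₖ` that extends, for every `i`,
to a minimum cycle basis of `Gᵢ`. -/
def IsFeasible (Gs : List (SimpleGraph V)) (B : Finset (SimpleGraph V)) : Prop :=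
  (∀ c ∈ B, IsCycleOf (common Gs) c) ∧ ∀ G ∈ Gs, ∃ B', IsMinCycleBasis G B' ∧ B ⊆ B'

/-- Optimal solutions of max-MCBI. -/
def IsOptimal (Gs : List (SimpleGraph V)) (B : Finset (SimpleGraph V)) : Prop :=
  IsFeasible Gs B ∧ ∀ B', IsFeasible Gs B' → B'.card ≤ B.card

/-- `Δ ≤ d`: every vertex has degree at most `d` in each of the graphs. -/
def DeltaLE (Gs : List (SimpleGraph V)) (d : ℕ) : Prop :=
  ∀ G ∈ Gs, ∀ v, (G.neighborSet v).ncard ≤ d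

/-- `γ ≤ g`: in each of the graphs, the cycles of the minimum cycle bases have at most `g`
edges. -/
def GammaLE (Gs : List (SimpleGraph V)) (g : ℕ) : Prop :=
  ∀ G ∈ Gs, ∀ B, IsMinCycleBasis G B → ∀ c ∈ B, weight c ≤ g

/-! ## Candidate cycles and the greedy algorithm on squares -/

/-- A choice of one shortest path between any two vertices of the same component. -/
structure ShortestPaths (G : SimpleGraph V) where
  path : ∀ u v, G.Reachable u v → G.Walk u v
  length_path : ∀ u v h, (path u v h).length = G.dist u v

/-- The cycles in the list of candidates: elementary cycles made of an edge `vw` and the chosen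
shortest paths from `u` to `v` and from `u` to `w`, or made of two edges `uv`, `wx` and the
chosen shortest paths from `u` to `w` and from `v` to `x` (swapping `w` and `x` gives the other
pairing). -/
def IsCandidate (G : SimpleGraph V) (P : ShortestPaths G) (c : SimpleGraph V) : Prop :=
  (∃ (u v w : V) (huv : G.Reachable u v) (hvw : G.Adj v w),
    let W : G.Walk u u := (P.path u v huv).append
      (.cons hvw (P.path u w (huv.trans hvw.reachable)).reverse)
    W.IsCycle ∧ c.edgeSet = {e | e ∈ W.edges}) ∨
  (∃ (u v w x : V) (huv : G.Adj u v) (hwx : G.Adj w x) (huw : G.Reachable u w),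
    let W : G.Walk u u := .cons huv
      ((P.path v x (huv.symm.reachable.trans (huw.trans hwx.reachable))).append
        (.cons hwx.symm (P.path u w huw).reverse))
    W.IsCycle ∧ c.edgeSet = {e | e ∈ W.edges})

/-- `T(G)`, the triangles of `G`. -/
def triangles (G : SimpleGraph V) : Set (SimpleGraph V) := {c | IsCycleOf G c ∧ weight c = 3}

/-- The squares among the candidates, without those spanned by the triangles of some `Gᵢ`. -/
def candidateSquares (Gs : List (SimpleGraph V)) (P : ShortestPaths (common Gs)) :
    Set (SimpleGraph V) :=
  {c | IsCandidate (common Gs) P c ∧ weight c = 4 ∧ ∀ G ∈ Gs, ¬ Spans (triangles G) c}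

open Classical in
/-- The greedy algorithm: go through the list `l` and add the cycle `c` to the current set `B`
unless `c` is spanned by `B ∪ T(Gᵢ)` for some `i`. -/
noncomputable def greedy (Gs : List (SimpleGraph V)) (l : List (SimpleGraph V)) :
    Finset (SimpleGraph V) :=
  l.foldl (fun B c =>
    if ∃ G ∈ Gs, Spans ((B : Set (SimpleGraph V)) ∪ triangles G) c then B else insert c B) ∅

/-- `B` has maximum size among the feasible solutions all of whose cycles have `l` edges. -/
def IsOptimalOfWeight (Gs : List (SimpleGraph V)) (l : ℕ) (B : Finset (SimpleGraph V)) : Prop :=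
  (IsFeasible Gs B ∧ ∀ c ∈ B, weight c = l) ∧
    ∀ B', IsFeasible Gs B' → (∀ c ∈ B', weight c = l) → B'.card ≤ B.card

end Graphs

/-! ## Random access machines with a step count

Unit-cost random access machine, programmed with structured control. Memory cells hold natural
numbers; the arithmetic operations are addition and truncated subtraction only (no
multiplication), so that `t` steps produce numbers of `O(t)` more bits than the input, and
polynomial time is the same notion as for Turing machines. -/

/-- Memory: registers, and arrays (a given program can access finitely many registers and
finitely many arrays, since their names are constants in the program). -/
structure Mem where
  reg : ℕ → ℕ
  arr : ℕ → ℕ → ℕ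

/-- Expressions. `get a e` reads the cell of array `a` whose index is the value of `e`. -/
inductive Expr where
  | lit (n : ℕ)
  | reg (x : ℕ)
  | add (e₁ e₂ : Expr)
  | sub (e₁ e₂ : Expr)
  | get (a : ℕ) (e : Expr)

/-- Value of an expression. -/
def Expr.eval (s : Mem) : Expr → ℕ
  | lit n => n
  | reg x => s.reg x
  | add e₁ e₂ => e₁.eval s + e₂.eval s
  | sub e₁ e₂ => e₁.eval s - e₂.eval s
  | get a e => s.arr a (e.eval s)

/-- Number of steps for evaluating an expression: one for each operation in it. -/
def Expr.cost : Expr → ℕ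
  | lit _ => 1
  | reg _ => 1
  | add e₁ e₂ => e₁.cost + e₂.cost + 1
  | sub e₁ e₂ => e₁.cost + e₂.cost + 1
  | get _ e => e.cost + 1

/-- Programs. A condition `e` holds if the value of `e` is not zero. -/
inductive Prog where
  | skip
  | assign (x : ℕ) (e : Expr)
  | store (a : ℕ) (i e : Expr)
  | seq (p q : Prog)
  | ite (e : Expr) (p q : Prog)
  | loop (e : Expr) (p : Prog)

/-- `Exec p s s' t`: the program `p`, started in memory `s`, halts in memory `s'` after `t`
steps. `loop e p` is `while e ≠ 0 do p`. -/
inductive Exec : Prog → Mem → Mem → ℕ → Prop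
  | skip (s : Mem) : Exec .skip s s 1
  | assign (s : Mem) (x : ℕ) (e : Expr) :
      Exec (.assign x e) s ⟨Function.update s.reg x (e.eval s), s.arr⟩ (e.cost + 1)
  | store (s : Mem) (a : ℕ) (i e : Expr) :
      Exec (.store a i e) s
        ⟨s.reg, Function.update s.arr a (Function.update (s.arr a) (i.eval s) (e.eval s))⟩
        (i.cost + e.cost + 1)
  | seq {p q : Prog} {s s' s'' : Mem} {t t' : ℕ} (hp : Exec p s s' t) (hq : Exec q s' s'' t') :
      Exec (.seq p q) s s'' (t + t')
  | ite_pos {e : Expr} {p q : Prog} {s s' : Mem} {t : ℕ} (he : e.eval s ≠ 0)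
      (hp : Exec p s s' t) : Exec (.ite e p q) s s' (e.cost + 1 + t)
  | ite_neg {e : Expr} {p q : Prog} {s s' : Mem} {t : ℕ} (he : e.eval s = 0)
      (hq : Exec q s s' t) : Exec (.ite e p q) s s' (e.cost + 1 + t)
  | loop_done {e : Expr} {p : Prog} {s : Mem} (he : e.eval s = 0) :
      Exec (.loop e p) s s (e.cost + 1)
  | loop_step {e : Expr} {p : Prog} {s s' s'' : Mem} {t t' : ℕ} (he : e.eval s ≠ 0)
      (hp : Exec p s s' t) (hl : Exec (.loop e p) s' s'' t') :
      Exec (.loop e p) s s'' (e.cost + 1 + t + t')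

/-- Initial memory: the input word is in array `0`, its length in register `0`, and everything
else is zero. -/
def initMem (input : List ℕ) : Mem where
  reg x := if x = 0 then input.length else 0
  arr a i := if a = 0 then input.getD i 0 else 0

/-- The output word: its length is in register `0`, its letters are in array `1`. -/
def output (s : Mem) : List ℕ := (List.range (s.reg 0)).map (s.arr 1)

/-- On this input the program `p` halts after exactly `t` steps with this output. -/
def RunsTo (p : Prog) (input out : List ℕ) (t : ℕ) : Prop :=
  ∃ s, Exec p (initMem input) s t ∧ output s = out

/-- The size of a word of natural numbers: the number of binary digits, with a separator after
each letter. -/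
def wordSize (w : List ℕ) : ℕ := (w.map fun a => Nat.size a + 1).sum

/-- The problem whose instances are the `x : ι` with `valid x`, encoded by `enc`, and where
`sol x w` says that the word `w` is a correct answer for `x`, is solvable in polynomial time:
one program answers all instances correctly in time polynomial in the size of the input. -/
def SolvableInPolyTime {ι : Type} (enc : ι → List ℕ) (valid : ι → Prop)
    (sol : ι → List ℕ → Prop) : Prop :=
  ∃ (p : Prog) (q : Polynomial ℕ), ∀ x, valid x →
    ∃ (w : List ℕ) (t : ℕ), RunsTo p (enc x) w t ∧ t ≤ q.eval (wordSize (enc x)) ∧ sol x w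

/-! ## The two problems -/

/-- A nonempty list of graphs `G₁, …, Gₖ` with the same vertex set `{0, …, n - 1}`. -/
structure Instance where
  n : ℕ
  graphs : List (SimpleGraph (Fin n))
  graphs_ne_nil : graphs ≠ []

open Classical in
/-- A graph as a word: the number of vertices, then the adjacency matrix row by row. -/
noncomputable def encodeGraph {n : ℕ} (G : SimpleGraph (Fin n)) : List ℕ :=
  n :: (List.finRange n).flatMap fun i =>
    (List.finRange n).map fun j => if G.Adj i j then 1 else 0

/-- A list of graphs as a word: the length of the list, then the graphs. -/
noncomputable def encodeGraphs {n : ℕ} (Gs : List (SimpleGraph (Fin n))) : List ℕ :=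
  Gs.length :: Gs.flatMap encodeGraph

open Classical in
/-- max-MCBI is solvable in polynomial time on the instances in `cls`: the output is an optimal
solution, as a list of its cycles without repetition. -/
def MaxMCBIPoly (cls : Instance → Prop) : Prop :=
  SolvableInPolyTime (fun I : Instance => encodeGraphs I.graphs) cls fun I w =>
    ∃ B : List (SimpleGraph (Fin I.n)), B.Nodup ∧ IsOptimal I.graphs B.toFinset ∧
      w = encodeGraphs B

open Classical in
/-- MCBI is solvable in polynomial time on the instances in `cls`: given `K` and the graphs, the
output is `1` if there is a feasible solution with at least `K` cycles, and `0` otherwise. -/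
def MCBIPoly (cls : Instance → Prop) : Prop :=
  SolvableInPolyTime (fun x : Instance × ℕ => x.2 :: encodeGraphs x.1.graphs)
    (fun x => cls x.1) fun x w =>
      w = [if ∃ B, IsFeasible x.1.graphs B ∧ x.2 ≤ B.card then 1 else 0]

end MCBI

namespace MCBI

/-! ## Linear independence modulo a subspace -/

section LinearAlgebra

variable {K M ι : Type*} [Field K] [AddCommGroup M] [Module K M] {v : ι → M} {W : Submodule K M}

/-! Local structure of one graph. A nonzero cycle has at least three edges, so with γ ≤ 4 a minimum
cycle basis consists of triangles and squares. All cycle bases of `H` have the same number of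
elements, so the weight of a basis of triangles and squares is four times this number minus the
number of its triangles; it is minimum exactly when the triangles span `triSpan H`. Hence a set of
triangles and squares extends to a minimum cycle basis if and only if its triangles are independent
and its squares are independent modulo `triSpan H` (`extends_isMinCycleBasis_iff`). The condition on
triangles does not depend on the graph. The condition on squares does, so a priori they form an
intersection of k linear matroids.

The degree bound collapses this intersection to one linear matroid. In a subcubic graph, every
element of `triSpan H` is a sum of triangles and chorded squares that lie inside its support
(`exists_le_of_mem_triSpan`, `mem_of_mem_triSpan`). In particular a square is spanned by triangles
if and only if it has a chord, so the squares that matter, the free ones, are those of the common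
graph without a chord in any graph. If a sum of free squares lies in `triSpan H`, the pieces have
only common edges. A triangle among them is a common triangle. A square whose chord is not common
is, since all degrees are at most three, the sum of two free squares with a common path of length
two, that is, one of the `chordSquares`. So the sum lies in `commonSpan`, which is independent of
`H` (`sum_mem_commonSpan`).

Conversely, no edge of a chord square lies in a common triangle, and each lies in just one free
square. If a sum of free squares lies in `commonSpan` and chord squares contribute to it, then both
free squares of some chord pair occur in the sum, and these two are already dependent modulo the
triangles of one graph (`linearIndepOn_commonSpan`). Therefore independence modulo every `triSpan H`
is independence modulo `commonSpan`, the greedy test is a test in a single quotient space, and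
Steinitz exchange gives optimality. Triangles and squares are optimized separately.

The program is Gaussian elimination with this subspace: insert the common triangles and output those
that are new, insert the chord squares without output, insert the free squares and output those that
are new. Every loop runs over vertices, matrix entries or graphs, so a polynomial in the input size
bounds the number of steps. -/

theorem mkQ_mem_span_image {s : Set ι} {x : M} :
    W.mkQ x ∈ Submodule.span K ((W.mkQ ∘ v) '' s) ↔ x ∈ W ⊔ Submodule.span K (v '' s) := by
  rw [Set.image_comp, Submodule.span_image, ← Submodule.mem_comap, Submodule.comap_map_mkQ]

theorem finrank_span_image_eq_card {D : Finset ι} (hD : LinearIndepOn K v (D : Set ι)) :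
    Module.finrank K (Submodule.span K (v '' (D : Set ι))) = D.card := by
  have := finrank_span_eq_card (R := K) hD
  rw [Set.image_eq_range]
  simpa using! this

theorem card_le_finrank {N : Submodule K M} [FiniteDimensional K N] {D : Finset ι}
    (hD : LinearIndepOn K v (D : Set ι)) (h : ∀ d ∈ D, v d ∈ N) : D.card ≤ Module.finrank K N := by
  rw [← finrank_span_image_eq_card hD]
  refine Submodule.finrank_mono (Submodule.span_le.2 ?_)
  rintro _ ⟨d, hd, rfl⟩
  exact h d hd

/-- Steinitz exchange in the quotient by `W`. This is the optimality argument for triangles (`W =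
⊥`) and for squares (`W = commonSpan Gs`). -/
theorem card_le_card_of_linearIndepOn_mkQ {D S : Finset ι}
    (hD : LinearIndepOn K (W.mkQ ∘ v) (D : Set ι))
    (h : ∀ d ∈ D, v d ∈ W ⊔ Submodule.span K (v '' (S : Set ι))) : D.card ≤ S.card := by
  classical
  have hfin : ((W.mkQ ∘ v) '' (S : Set ι)) = ((S.image (W.mkQ ∘ v) : Finset _) : Set (M ⧸ W)) := by
    simp
  have : FiniteDimensional K (Submodule.span K ((W.mkQ ∘ v) '' (S : Set ι))) := by
    rw [hfin]; infer_instance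
  refine (card_le_finrank hD fun d hd => mkQ_mem_span_image.2 (h d hd)).trans ?_
  rw [hfin]
  exact (finrank_span_finset_le_card _).trans Finset.card_image_le

theorem linearIndepOn_mkQ_bot {s : Set ι} :
    LinearIndepOn K ((⊥ : Submodule K M).mkQ ∘ v) s ↔ LinearIndepOn K v s := by
  refine ⟨fun h => h.of_comp _, fun h => ?_⟩
  exact LinearIndependent.map' h _ (Submodule.ker_mkQ _)

theorem linearIndepOn_mkQ_insert {s : Set ι} {a : ι} (hs : LinearIndepOn K (W.mkQ ∘ v) s)
    (ha : v a ∉ W ⊔ Submodule.span K (v '' s)) :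
    LinearIndepOn K (W.mkQ ∘ v) (insert a s) :=
  hs.insert (fun h => ha (mkQ_mem_span_image.1 h))

theorem notMem_of_linearIndepOn_mkQ_insert {s : Set ι} {a : ι} (has : a ∉ s)
    (h : LinearIndepOn K (W.mkQ ∘ v) (insert a s)) : v a ∉ W ⊔ Submodule.span K (v '' s) :=
  fun h' => ((linearIndepOn_insert has).1 h).2 (mkQ_mem_span_image.2 h')

/-- Over the field with two elements a linear combination is the sum over a subset. In this form
dependencies are sums of cycles, whose supports can be inspected edge by edge. -/
theorem linearIndepOn_mkQ_zmod_two {M : Type*} [AddCommGroup M] [Module (ZMod 2) M] {v : ι → M}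
    {W : Submodule (ZMod 2) M} {X : Finset ι} :
    LinearIndepOn (ZMod 2) (W.mkQ ∘ v) (X : Set ι) ↔
      ∀ Y ⊆ X, ∑ c ∈ Y, v c ∈ W → Y = ∅ := by
  classical
  rw [linearIndepOn_finset_iff]
  constructor
  · intro h Y hY hs
    rw [Finset.eq_empty_iff_forall_notMem]
    intro c hc
    have := h (fun c => if c ∈ Y then 1 else 0) (by
      simp only [ite_smul, one_smul, zero_smul, Function.comp_apply]
      rw [← Finset.sum_filter, Finset.filter_mem_eq_inter, Finset.inter_eq_right.2 hY, ← map_sum]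
      exact (Submodule.Quotient.mk_eq_zero W).2 hs) c (hY hc)
    simp [hc] at this
  · intro h g hg
    have h0 := h (X.filter fun c => g c ≠ 0) (Finset.filter_subset _ _) (by
      rw [← Submodule.Quotient.mk_eq_zero W, ← Submodule.mkQ_apply, map_sum, ← hg,
        Finset.sum_filter]
      refine Finset.sum_congr rfl fun c _ => ?_
      have : ∀ a : ZMod 2, a = 0 ∨ a = 1 := by decide
      rcases this (g c) with h | h <;> simp [h])
    intro c hc
    by_contra hne
    exact Finset.notMem_empty c (h0 ▸ Finset.mem_filter.2 ⟨hc, hne⟩)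

theorem sum_mem_of_mem_sup_span {M : Type*} [AddCommGroup M] [Module (ZMod 2) M] {v : ι → M}
    {W : Submodule (ZMod 2) M} {X : Finset ι} {x : M}
    (hx : x ∈ W ⊔ Submodule.span (ZMod 2) (v '' (X : Set ι))) :
    ∃ Y ⊆ X, x - ∑ c ∈ Y, v c ∈ W := by
  classical
  obtain ⟨w, hw, y, hy, rfl⟩ := Submodule.mem_sup.1 hx
  obtain ⟨f, hf, rfl⟩ := (Finsupp.mem_span_image_iff_linearCombination _).1 hy
  refine ⟨f.support, fun c hc => (Finsupp.mem_supported _ _).1 hf hc, ?_⟩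
  have : Finsupp.linearCombination (ZMod 2) v f = ∑ c ∈ f.support, v c := by
    rw [Finsupp.linearCombination_apply, Finsupp.sum]
    refine Finset.sum_congr rfl fun c hc => ?_
    have h2 : ∀ a : ZMod 2, a ≠ 0 → a = 1 := by decide
    rw [h2 _ (Finsupp.mem_support_iff.1 hc), one_smul]
  rw [this, add_sub_cancel_right]
  exact hw

end LinearAlgebra

/-! ## Minimum cycle bases made of triangles and squares -/

section MinCycleBasis

variable {V : Type*}

open Classical in
theorem edgeVec_apply (c : SimpleGraph V) (e : Sym2 V) :
    edgeVec c e = if e ∈ c.edgeSet then 1 else 0 := by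
  simp [edgeVec, Set.indicator_apply]

theorem edgeVec_ne_zero_iff {c : SimpleGraph V} {u v : V} :
    edgeVec c s(u, v) ≠ 0 ↔ c.Adj u v := by
  classical
  simp [edgeVec_apply]

theorem edgeVec_injective : Function.Injective (edgeVec (V := V)) := by
  intro c d h
  ext u v
  rw [← edgeVec_ne_zero_iff, h, edgeVec_ne_zero_iff]

/-- The span of the triangles of `H`. -/
def triSpan (H : SimpleGraph V) : Submodule (ZMod 2) (Sym2 V → ZMod 2) :=
  Submodule.span (ZMod 2) (edgeVec '' triangles H)

/-- The squares of `H`. -/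
def squares (H : SimpleGraph V) : Set (SimpleGraph V) := {c | IsCycleOf H c ∧ weight c = 4}

theorem IsCycleOf.mono {G H c : SimpleGraph V} (hc : IsCycleOf G c) (h : G ≤ H) : IsCycleOf H c :=
  ⟨hc.1.trans h, hc.2⟩

theorem triSpan_mono {G H : SimpleGraph V} (h : G ≤ H) : triSpan G ≤ triSpan H :=
  Submodule.span_mono (Set.image_mono fun _ hc => ⟨hc.1.mono h, hc.2⟩)

theorem IsCycleOf.exists_adj_ne [Finite V] {H c : SimpleGraph V} (hc : IsCycleOf H c) {u v : V}
    (h : c.Adj u v) : ∃ w, w ≠ v ∧ c.Adj u w := by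
  by_contra! hn
  have : c.neighborSet u = {v} := by
    ext w
    simp only [SimpleGraph.mem_neighborSet, Set.mem_singleton_iff]
    exact ⟨fun hw => by_contra fun hne => hn w hne hw, fun hw => hw ▸ h⟩
  have h2 := hc.2 u
  rw [this] at h2
  simp at h2

/-- By evenness, both ends of an edge `u v` have another edge `u w`, `v x`; these two may share the
vertex `w = x` but are distinct. -/
theorem IsCycleOf.three_le_weight [Finite V] {H c : SimpleGraph V} (hc : IsCycleOf H c)
    (h0 : edgeVec c ≠ 0) : 3 ≤ weight c := by
  classical
  obtain ⟨e, he⟩ := Function.ne_iff.1 h0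
  induction e using Sym2.ind with
  | _ u v =>
  have huv : c.Adj u v := edgeVec_ne_zero_iff.1 he
  obtain ⟨w, hwv, huw⟩ := hc.exists_adj_ne huv
  obtain ⟨x, hxu, hvx⟩ := hc.exists_adj_ne huv.symm
  have hsub : (({s(u, v), s(u, w), s(v, x)} : Finset (Sym2 V)) : Set (Sym2 V)) ⊆ c.edgeSet := by
    intro e he
    simp only [Finset.coe_insert, Finset.coe_singleton, Set.mem_insert_iff,
      Set.mem_singleton_iff] at he
    rcases he with rfl | rfl | rfl <;> simpa
  have hcard : ({s(u, v), s(u, w), s(v, x)} : Finset (Sym2 V)).card = 3 := by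
    have := huv.ne
    rw [Finset.card_eq_three]
    refine ⟨_, _, _, ?_, ?_, ?_, rfl⟩ <;> simp only [ne_eq, Sym2.eq_iff] <;> grind
  have := Set.ncard_le_ncard hsub (Set.toFinite _)
  rwa [Set.ncard_coe_finset, hcard] at this

theorem IsCycleBasis.three_le_weight [Finite V] {H : SimpleGraph V} {B : Finset (SimpleGraph V)}
    (hB : IsCycleBasis H B) {c : SimpleGraph V} (hc : c ∈ B) : 3 ≤ weight c :=
  (hB.1 c hc).three_le_weight (hB.2.1.ne_zero hc)

theorem IsCycleBasis.span_eq {H : SimpleGraph V} {B : Finset (SimpleGraph V)}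
    (hB : IsCycleBasis H B) : Submodule.span (ZMod 2) (edgeVec '' (B : Set (SimpleGraph V))) =
      Submodule.span (ZMod 2) (edgeVec '' {c | IsCycleOf H c}) := by
  refine le_antisymm (Submodule.span_mono (Set.image_mono fun c hc => hB.1 c hc))
    (Submodule.span_le.2 ?_)
  rintro _ ⟨c, hc, rfl⟩
  exact hB.2.2 c hc

/-- Both numbers are the dimension of the cycle space. With the size fixed, minimizing the weight
amounts to maximizing the number of triangles. -/
theorem IsCycleBasis.card_eq {H : SimpleGraph V} {B B' : Finset (SimpleGraph V)}
    (hB : IsCycleBasis H B) (hB' : IsCycleBasis H B') : B.card = B'.card := by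
  rw [← finrank_span_image_eq_card hB.2.1, ← finrank_span_image_eq_card hB'.2.1, hB.span_eq,
    hB'.span_eq]

theorem exists_isMinCycleBasis [Finite V] (H : SimpleGraph V) : ∃ B, IsMinCycleBasis H B := by
  classical
  have hne : ∃ B, IsCycleBasis H B := by
    obtain ⟨b, hb, -, hs, hi⟩ := exists_linearIndepOn_extension (K := ZMod 2) (v := edgeVec)
      (linearIndepOn_empty _ _) (Set.empty_subset {c | IsCycleOf H c})
    have hf : (b.toFinite.toFinset : Set (SimpleGraph V)) = b := by simp
    refine ⟨b.toFinite.toFinset, fun c hc => hb (by simpa using hc), by rwa [hf], fun d hd => ?_⟩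
    rw [Spans, hf]
    exact hs ⟨d, hd, rfl⟩
  obtain ⟨B, hB, hmin⟩ := (measure fun B : Finset (SimpleGraph V) => ∑ c ∈ B, weight c).wf.has_min
    {B | IsCycleBasis H B} hne
  exact ⟨B, hB, fun B' hB' => not_lt.1 (hmin B' hB')⟩

/-- A cycle of weight 3 is one short of 4, and no cycle of the set falls shorter. `sum_weight_add`
is the case of equality. -/
theorem four_mul_card_le (B : Finset (SimpleGraph V)) (hB : ∀ c ∈ B, 3 ≤ weight c) :
    4 * B.card ≤ ∑ c ∈ B, weight c + (B.filter fun c => weight c = 3).card := by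
  classical
  rw [Finset.card_filter, ← Finset.sum_add_distrib, mul_comm, ← smul_eq_mul, ← Finset.sum_const]
  refine Finset.sum_le_sum fun c hc => ?_
  have := hB c hc
  split_ifs <;> omega

theorem sum_weight_add (B : Finset (SimpleGraph V))
    (hB : ∀ c ∈ B, weight c = 3 ∨ weight c = 4) :
    ∑ c ∈ B, weight c + (B.filter fun c => weight c = 3).card = 4 * B.card := by
  classical
  rw [Finset.card_filter, ← Finset.sum_add_distrib, mul_comm, ← smul_eq_mul, ← Finset.sum_const]
  refine Finset.sum_congr rfl fun c hc => ?_
  have := hB c hc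
  split_ifs <;> omega

variable [Finite V] {H : SimpleGraph V}

theorem triSpan_sup_span_squares
    (hγ : ∀ B, IsMinCycleBasis H B → ∀ c ∈ B, weight c ≤ 4) {d : SimpleGraph V}
    (hd : IsCycleOf H d) :
    edgeVec d ∈ triSpan H ⊔ Submodule.span (ZMod 2) (edgeVec '' squares H) := by
  obtain ⟨B, hB⟩ := exists_isMinCycleBasis H
  rw [triSpan, ← Submodule.span_union, ← Set.image_union]
  refine Submodule.span_mono (Set.image_mono fun c hc => ?_) (hB.1.2.2 d hd)
  have h3 := hB.1.three_le_weight hc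
  have h4 := hγ B hB c hc
  have hw : weight c = 3 ∨ weight c = 4 := by omega
  exact hw.imp (fun h => ⟨hB.1.1 c hc, h⟩) (fun h => ⟨hB.1.1 c hc, h⟩)

open Classical in
/-- Independent triangles, and squares that are independent modulo all triangles, extend to a
cycle basis of triangles and squares whose triangles span all triangles. -/
theorem exists_isCycleBasis_extension
    (hγ : ∀ B, IsMinCycleBasis H B → ∀ c ∈ B, weight c ≤ 4) {B₃ B₄ : Set (SimpleGraph V)}
    (h₃ : B₃ ⊆ triangles H) (hi₃ : LinearIndepOn (ZMod 2) edgeVec B₃)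
    (h₄ : B₄ ⊆ squares H) (hi₄ : LinearIndepOn (ZMod 2) ((triSpan H).mkQ ∘ edgeVec) B₄) :
    ∃ B : Finset (SimpleGraph V), IsCycleBasis H B ∧ B₃ ⊆ B ∧ B₄ ⊆ B ∧
      (∀ c ∈ B, weight c = 3 ∨ weight c = 4) ∧
      (B.filter fun c => weight c = 3).card = Module.finrank (ZMod 2) (triSpan H) := by
  obtain ⟨b, hb, h3b, hs, hi⟩ := exists_linearIndepOn_extension hi₃ h₃
  obtain ⟨b', hb', h4b, hs', hi'⟩ := exists_linearIndepOn_extension hi₄ h₄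
  have hspan : Submodule.span (ZMod 2) (edgeVec '' b) = triSpan H :=
    le_antisymm (Submodule.span_mono (Set.image_mono hb)) (Submodule.span_le.2 hs)
  have hf : ((b ∪ b').toFinite.toFinset : Set (SimpleGraph V)) = b ∪ b' := by simp
  have hsq : edgeVec '' squares H ⊆ (triSpan H ⊔ Submodule.span (ZMod 2) (edgeVec '' b') :
      Submodule _ _) := by
    rintro _ ⟨c, hc, rfl⟩
    exact mkQ_mem_span_image.1 (hs' ⟨c, hc, rfl⟩)
  refine ⟨(b ∪ b').toFinite.toFinset, ⟨?_, ?_, ?_⟩, ?_, ?_, ?_, ?_⟩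
  · intro c hc
    rw [Set.Finite.mem_toFinset] at hc
    exact hc.elim (fun h => (hb h).1) (fun h => (hb' h).1)
  -- `b'` is independent modulo the span of `b`, because this span is all of `triSpan H`.
  · rw [hf]
    refine hi.union_of_quotient ?_
    rwa [hspan]
  · intro d hd
    rw [Spans, hf, Set.image_union, Submodule.span_union, hspan]
    refine sup_le le_sup_left (Submodule.span_le.2 hsq) (triSpan_sup_span_squares hγ hd)
  · rw [hf]; exact h3b.trans Set.subset_union_left
  · rw [hf]; exact h4b.trans Set.subset_union_right
  · intro c hc
    rw [Set.Finite.mem_toFinset] at hc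
    exact hc.imp (fun h => (hb h).2) (fun h => (hb' h).2)
  · have : (((b ∪ b').toFinite.toFinset.filter fun c => weight c = 3 :
        Finset (SimpleGraph V)) : Set (SimpleGraph V)) = b := by
      ext c
      simp only [Finset.coe_filter, Set.Finite.mem_toFinset, Set.mem_union, Set.mem_ofPred_eq]
      refine ⟨fun h => h.1.resolve_right fun h' => ?_, fun h => ⟨Or.inl h, (hb h).2⟩⟩
      have := (hb' h').2
      omega
    rw [← this] at hi hspan
    rw [← hspan, finrank_span_image_eq_card hi]

open Classical in
-- Minimum bases are those with the largest number of triangles, namely the dimension of `triSpan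
-- H`. Modulo triangles that span `triSpan H`, the remaining squares of a basis stay independent;
-- conversely the extension of `exists_isCycleBasis_extension` attains the maximum.
theorem extends_isMinCycleBasis_iff
    (hγ : ∀ B, IsMinCycleBasis H B → ∀ c ∈ B, weight c ≤ 4) (B : Finset (SimpleGraph V)) :
    (∃ B', IsMinCycleBasis H B' ∧ B ⊆ B') ↔
      (∀ c ∈ B, IsCycleOf H c ∧ (weight c = 3 ∨ weight c = 4)) ∧
      LinearIndepOn (ZMod 2) edgeVec
        ((B.filter fun c => weight c = 3 : Finset (SimpleGraph V)) : Set (SimpleGraph V)) ∧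
      LinearIndepOn (ZMod 2) ((triSpan H).mkQ ∘ edgeVec)
        ((B.filter fun c => weight c = 4 : Finset (SimpleGraph V)) : Set (SimpleGraph V)) := by
  have htri : ∀ B', IsCycleBasis H B' → (B'.filter fun c => weight c = 3).card ≤
      Module.finrank (ZMod 2) (triSpan H) := fun B' hB' =>
    card_le_finrank (v := edgeVec) (hB'.2.1.mono fun c hc => (Finset.mem_filter.1 hc).1) fun d hd => by
      rw [Finset.mem_filter] at hd
      exact Submodule.subset_span ⟨d, ⟨hB'.1 d hd.1, hd.2⟩, rfl⟩
  constructor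
  · rintro ⟨B', hB', hsub⟩
    have hw : ∀ c ∈ B', weight c = 3 ∨ weight c = 4 := fun c hc => by
      have h3 := hB'.1.three_le_weight hc
      have h4 := hγ B' hB' c hc
      omega
    refine ⟨fun c hc => ⟨hB'.1.1 c (hsub hc), hw c (hsub hc)⟩,
      hB'.1.2.1.mono fun c hc => hsub (Finset.mem_filter.1 hc).1, ?_⟩
    obtain ⟨B₀, hB₀, -, -, hw₀, hc₀⟩ := exists_isCycleBasis_extension hγ
      (Set.empty_subset _) (linearIndepOn_empty _ _) (Set.empty_subset _)
      (linearIndepOn_empty _ _)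
    -- `B₀` has as many triangles as the dimension of `triSpan H`. Since `B'` is no heavier and of
    -- the same size, it has at least as many, so its triangles span `triSpan H`.
    have hle := hB'.2 B₀ hB₀
    have e1 := sum_weight_add B₀ hw₀
    have e2 := sum_weight_add B' hw
    have e3 := hB₀.card_eq hB'.1
    set T' := B'.filter fun c => weight c = 3 with hT'
    have hi : LinearIndepOn (ZMod 2) edgeVec (T' : Set (SimpleGraph V)) :=
      hB'.1.2.1.mono fun c hc => (Finset.mem_filter.1 hc).1
    have hspan : Submodule.span (ZMod 2) (edgeVec '' (T' : Set (SimpleGraph V))) = triSpan H := by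
      refine Submodule.eq_of_le_of_finrank_le (Submodule.span_mono (Set.image_mono ?_)) ?_
      · intro c hc
        have := Finset.mem_filter.1 hc
        exact ⟨hB'.1.1 c this.1, this.2⟩
      · rw [finrank_span_image_eq_card hi]
        omega
    rw [← hspan, hi.quotient_iff_union]
    · refine hB'.1.2.1.mono ?_
      rintro c (hc | hc)
      · exact (Finset.mem_filter.1 hc).1
      · exact hsub (Finset.mem_filter.1 hc).1
    · rw [Finset.disjoint_coe, Finset.disjoint_left]
      intro c hc hc'
      have h1 := (Finset.mem_filter.1 hc).2
      have h2 := (Finset.mem_filter.1 hc').2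
      omega
  · rintro ⟨hw, hi₃, hi₄⟩
    obtain ⟨B', hB', h3, h4, hw', hc'⟩ := exists_isCycleBasis_extension hγ
      (fun c hc => by
        have := Finset.mem_filter.1 hc
        exact ⟨(hw c this.1).1, this.2⟩) hi₃
      (fun c hc => by
        have := Finset.mem_filter.1 hc
        exact ⟨(hw c this.1).1, this.2⟩) hi₄
    refine ⟨B', ⟨hB', fun B₁ hB₁ => ?_⟩, fun c hc => ?_⟩
    -- Any other basis `B₁` has at most as many triangles as `B'`, hence at least its weight.
    · have e1 := sum_weight_add B' hw'
      have e2 := four_mul_card_le B₁ fun c hc => hB₁.three_le_weight hc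
      have e3 := hB'.card_eq hB₁
      have e4 := htri B₁ hB₁
      omega
    · rcases (hw c hc).2 with h | h
      · exact h3 (Finset.mem_coe.2 (Finset.mem_filter.2 ⟨hc, h⟩))
      · exact h4 (Finset.mem_coe.2 (Finset.mem_filter.2 ⟨hc, h⟩))

end MinCycleBasis

/-! ## Triangles and squares given by their vertices -/

section Squares

variable {V : Type*}

/-- The square with vertices `p`, `q`, `r`, `s` in cyclic order. -/
def sq (p q r s : V) : SimpleGraph V :=
  SimpleGraph.fromEdgeSet {s(p, q), s(q, r), s(r, s), s(s, p)}

/-- The triangle with vertices `p`, `q`, `r`. -/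
def tri (p q r : V) : SimpleGraph V :=
  SimpleGraph.fromEdgeSet {s(p, q), s(q, r), s(r, p)}

/-- The vertices `p`, `q`, `r`, `s` form a square of `G` in this cyclic order. -/
def IsSq (G : SimpleGraph V) (p q r s : V) : Prop :=
  G.Adj p q ∧ G.Adj q r ∧ G.Adj r s ∧ G.Adj s p ∧ p ≠ r ∧ q ≠ s

theorem sq_adj {p q r s x y : V} : (sq p q r s).Adj x y ↔
    (s(x, y) = s(p, q) ∨ s(x, y) = s(q, r) ∨ s(x, y) = s(r, s) ∨ s(x, y) = s(s, p)) ∧ x ≠ y := by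
  rw [sq, SimpleGraph.fromEdgeSet_adj]
  simp only [Set.mem_insert_iff, Set.mem_singleton_iff]

theorem tri_adj {p q r x y : V} : (tri p q r).Adj x y ↔
    (s(x, y) = s(p, q) ∨ s(x, y) = s(q, r) ∨ s(x, y) = s(r, p)) ∧ x ≠ y := by
  rw [tri, SimpleGraph.fromEdgeSet_adj]
  simp only [Set.mem_insert_iff, Set.mem_singleton_iff]

theorem sq_rotate (p q r s : V) : sq q r s p = sq p q r s := by
  ext x y; simp only [sq_adj]; tauto

theorem sq_reflect (p q r s : V) : sq p s r q = sq p q r s := by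
  ext x y; simp only [sq_adj, Sym2.eq_swap (a := p) (b := s), Sym2.eq_swap (a := s) (b := r),
    Sym2.eq_swap (a := r) (b := q), Sym2.eq_swap (a := q) (b := p)]; tauto

theorem IsSq.mono {G H : SimpleGraph V} {p q r s : V} (h : IsSq G p q r s) (hGH : G ≤ H) :
    IsSq H p q r s :=
  ⟨hGH h.1, hGH h.2.1, hGH h.2.2.1, hGH h.2.2.2.1, h.2.2.2.2⟩

theorem even_ncard_pair {a b : V} (h : a ≠ b) : Even ({a, b} : Set V).ncard := by
  rw [Set.ncard_pair h]; exact even_two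

theorem IsSq.mem_squares {G : SimpleGraph V} {p q r s : V} (h : IsSq G p q r s) :
    sq p q r s ∈ squares G := by
  classical
  obtain ⟨h1, h2, h3, h4, h5, h6⟩ := h
  have n1 := h1.ne
  have n2 := h2.ne
  have n3 := h3.ne
  have n4 := h4.ne
  refine ⟨⟨?_, ?_⟩, ?_⟩
  · intro x y hxy
    rw [sq_adj] at hxy
    simp only [Sym2.eq_iff] at hxy
    rcases hxy.1 with h | h | h | h <;> obtain ⟨rfl, rfl⟩ | ⟨rfl, rfl⟩ := h <;>
      first | assumption | (apply SimpleGraph.Adj.symm; assumption)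
  · intro v
    by_cases hp : v = p
    · have : (sq p q r s).neighborSet v = {q, s} := by
        ext w; simp only [SimpleGraph.mem_neighborSet, sq_adj, Sym2.eq_iff, Set.mem_insert_iff,
          Set.mem_singleton_iff]; grind
      rw [this]; exact even_ncard_pair h6
    by_cases hq : v = q
    · have : (sq p q r s).neighborSet v = {p, r} := by
        ext w; simp only [SimpleGraph.mem_neighborSet, sq_adj, Sym2.eq_iff, Set.mem_insert_iff,
          Set.mem_singleton_iff]; grind
      rw [this]; exact even_ncard_pair h5
    by_cases hr : v = r
    · have : (sq p q r s).neighborSet v = {q, s} := by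
        ext w; simp only [SimpleGraph.mem_neighborSet, sq_adj, Sym2.eq_iff, Set.mem_insert_iff,
          Set.mem_singleton_iff]; grind
      rw [this]; exact even_ncard_pair h6
    by_cases hs : v = s
    · have : (sq p q r s).neighborSet v = {p, r} := by
        ext w; simp only [SimpleGraph.mem_neighborSet, sq_adj, Sym2.eq_iff, Set.mem_insert_iff,
          Set.mem_singleton_iff]; grind
      rw [this]; exact even_ncard_pair h5
    have : (sq p q r s).neighborSet v = ∅ := by
      ext w; simp only [SimpleGraph.mem_neighborSet, sq_adj, Sym2.eq_iff,
        Set.mem_empty_iff_false]; grind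
    rw [this]; simp
  · have : (sq p q r s).edgeSet =
        (({s(p, q), s(q, r), s(r, s), s(s, p)} : Finset (Sym2 V)) : Set (Sym2 V)) := by
      ext e
      induction e using Sym2.ind with
      | _ x y =>
      simp only [SimpleGraph.mem_edgeSet, sq_adj, Finset.coe_insert, Finset.coe_singleton,
        Set.mem_insert_iff, Set.mem_singleton_iff, Sym2.eq_iff]
      grind
    rw [weight, this, Set.ncard_coe_finset]
    repeat rw [Finset.card_insert_of_notMem]
    · simp
    all_goals simp only [Finset.mem_insert, Finset.mem_singleton, Sym2.eq_iff]; grind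

theorem tri_mem_triangles {G : SimpleGraph V} {p q r : V} (h1 : G.Adj p q) (h2 : G.Adj q r)
    (h3 : G.Adj r p) : tri p q r ∈ triangles G := by
  classical
  have n1 := h1.ne
  have n2 := h2.ne
  have n3 := h3.ne
  refine ⟨⟨?_, ?_⟩, ?_⟩
  · intro x y hxy
    rw [tri_adj] at hxy
    simp only [Sym2.eq_iff] at hxy
    rcases hxy.1 with h | h | h <;> obtain ⟨rfl, rfl⟩ | ⟨rfl, rfl⟩ := h <;>
      first | assumption | (apply SimpleGraph.Adj.symm; assumption)
  · intro v
    by_cases hp : v = p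
    · have : (tri p q r).neighborSet v = {q, r} := by
        ext w; simp only [SimpleGraph.mem_neighborSet, tri_adj, Sym2.eq_iff, Set.mem_insert_iff,
          Set.mem_singleton_iff]; grind
      rw [this]; exact even_ncard_pair n2
    by_cases hq : v = q
    · have : (tri p q r).neighborSet v = {p, r} := by
        ext w; simp only [SimpleGraph.mem_neighborSet, tri_adj, Sym2.eq_iff, Set.mem_insert_iff,
          Set.mem_singleton_iff]; grind
      rw [this]; exact even_ncard_pair n3.symm
    by_cases hr : v = r
    · have : (tri p q r).neighborSet v = {p, q} := by
        ext w; simp only [SimpleGraph.mem_neighborSet, tri_adj, Sym2.eq_iff, Set.mem_insert_iff,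
          Set.mem_singleton_iff]; grind
      rw [this]; exact even_ncard_pair n1
    have : (tri p q r).neighborSet v = ∅ := by
      ext w; simp only [SimpleGraph.mem_neighborSet, tri_adj, Sym2.eq_iff,
        Set.mem_empty_iff_false]; grind
    rw [this]; simp
  · have : (tri p q r).edgeSet =
        (({s(p, q), s(q, r), s(r, p)} : Finset (Sym2 V)) : Set (Sym2 V)) := by
      ext e
      induction e using Sym2.ind with
      | _ x y =>
      simp only [SimpleGraph.mem_edgeSet, tri_adj, Finset.coe_insert, Finset.coe_singleton,
        Set.mem_insert_iff, Set.mem_singleton_iff, Sym2.eq_iff]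
      grind
    rw [weight, this, Set.ncard_coe_finset]
    repeat rw [Finset.card_insert_of_notMem]
    · simp
    all_goals simp only [Finset.mem_insert, Finset.mem_singleton, Sym2.eq_iff]; grind

variable [Finite V]

theorem edgeSet_eq_of_subset {c : SimpleGraph V} {A : Finset (Sym2 V)}
    (hA : (A : Set (Sym2 V)) ⊆ c.edgeSet) (hc : weight c ≤ A.card) :
    c.edgeSet = A :=
  (Set.eq_of_subset_of_ncard_le hA (by rwa [Set.ncard_coe_finset]) (Set.toFinite _)).symm

/-- The first edge is prescribed, so that the vertices can be labelled starting from any edge of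
interest; likewise in `exists_eq_sq`. -/
theorem exists_eq_tri {G c : SimpleGraph V} (hc : c ∈ triangles G) {p q : V} (hpq : c.Adj p q) :
    ∃ r, G.Adj p q ∧ G.Adj q r ∧ G.Adj r p ∧ c = tri p q r := by
  classical
  obtain ⟨s, hsq, hps⟩ := hc.1.exists_adj_ne hpq
  obtain ⟨r, hrp, hqr⟩ := hc.1.exists_adj_ne hpq.symm
  have n1 := hpq.ne
  have n2 := hps.ne
  have n3 := hqr.ne
  have hset : c.edgeSet = ({s(p, q), s(q, r), s(p, s)} : Finset (Sym2 V)) := by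
    refine edgeSet_eq_of_subset ?_ ?_
    · intro e he
      simp only [Finset.coe_insert, Finset.coe_singleton, Set.mem_insert_iff,
        Set.mem_singleton_iff] at he
      rcases he with rfl | rfl | rfl <;> simpa
    · rw [hc.2]
      repeat rw [Finset.card_insert_of_notMem]
      · simp
      all_goals simp only [Finset.mem_insert, Finset.mem_singleton, Sym2.eq_iff]; grind
  have hadj : ∀ x y, c.Adj x y ↔ s(x, y) = s(p, q) ∨ s(x, y) = s(q, r) ∨ s(x, y) = s(p, s) := by
    intro x y
    rw [← SimpleGraph.mem_edgeSet, hset]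
    simp
  obtain ⟨x, hxp, hsx⟩ := hc.1.exists_adj_ne hps.symm
  -- The edges are `p q`, `q r`, `p s`, so the second edge at `s` can only be `q r`.
  have hrs : s = r := by
    have := (hadj s x).1 hsx
    simp only [Sym2.eq_iff] at this
    grind
  subst hrs
  refine ⟨s, hc.1.1 hpq, hc.1.1 hqr, hc.1.1 hps.symm, ?_⟩
  ext x y
  rw [hadj, tri_adj, Sym2.eq_swap (a := p) (b := s)]
  refine ⟨fun h => ⟨h, ?_⟩, fun h => h.1⟩
  simp only [Sym2.eq_iff] at h
  grind

theorem exists_eq_sq {G c : SimpleGraph V} (hc : c ∈ squares G) {p q : V} (hpq : c.Adj p q) :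
    ∃ r s, IsSq G p q r s ∧ c = sq p q r s := by
  classical
  obtain ⟨s, hsq, hps⟩ := hc.1.exists_adj_ne hpq
  obtain ⟨r, hrp, hqr⟩ := hc.1.exists_adj_ne hpq.symm
  have n1 := hpq.ne
  have n2 := hps.ne
  have n3 := hqr.ne
  by_cases hrs : s = r
  -- A triangle and one further edge `x y`: by evenness `x` and `y` have other edges, which belong
  -- to the triangle, so `x y` joins two vertices of the triangle and is no further edge.
  · subst hrs
    exfalso
    have hsub : (({s(p, q), s(q, s), s(s, p)} : Finset (Sym2 V)) : Set (Sym2 V)) ⊆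
        c.edgeSet := by
      intro e he
      simp only [Finset.coe_insert, Finset.coe_singleton, Set.mem_insert_iff,
        Set.mem_singleton_iff] at he
      rcases he with rfl | rfl | rfl
      · simpa
      · simpa
      · simpa using hps.symm
    have hcard : ({s(p, q), s(q, s), s(s, p)} : Finset (Sym2 V)).card = 3 := by
      repeat rw [Finset.card_insert_of_notMem]
      · simp
      all_goals simp only [Finset.mem_insert, Finset.mem_singleton, Sym2.eq_iff]; grind
    obtain ⟨e, he, hne⟩ := Set.exists_mem_notMem_of_ncard_lt_ncard
      (s := (({s(p, q), s(q, s), s(s, p)} : Finset (Sym2 V)) : Set (Sym2 V)))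
      (t := c.edgeSet) (by
        rw [Set.ncard_coe_finset, hcard, show c.edgeSet.ncard = 4 from hc.2]; norm_num)
    induction e using Sym2.ind with
    | _ x y =>
    have hset : c.edgeSet =
        ((insert s(x, y) {s(p, q), s(q, s), s(s, p)} : Finset (Sym2 V)) : Set (Sym2 V)) := by
      refine edgeSet_eq_of_subset ?_ ?_
      · rw [Finset.coe_insert]
        exact Set.insert_subset he hsub
      · rw [hc.2, Finset.card_insert_of_notMem (by simpa using hne), hcard]
    have hadj : ∀ a b, c.Adj a b ↔ s(a, b) = s(x, y) ∨ s(a, b) = s(p, q) ∨ s(a, b) = s(q, s) ∨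
        s(a, b) = s(s, p) := by
      intro a b
      rw [← SimpleGraph.mem_edgeSet, hset]
      simp
    have hxy : c.Adj x y := he
    have n4 := hxy.ne
    obtain ⟨z, hz, hxz⟩ := hc.1.exists_adj_ne hxy
    obtain ⟨w, hw, hyw⟩ := hc.1.exists_adj_ne hxy.symm
    simp only [Finset.coe_insert, Finset.coe_singleton, Set.mem_insert_iff,
      Set.mem_singleton_iff, Sym2.eq_iff] at hne
    rw [hadj] at hxz hyw
    simp only [Sym2.eq_iff] at hxz hyw
    grind
  -- The edges `p q`, `q r`, `s x`, `p s` are all edges of `c`. The second edge at `r` must then be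
  -- `s x`, which forces `x = r`.
  · have hcard : ∀ x, c.Adj s x → x ≠ p → c.edgeSet =
        (({s(p, q), s(q, r), s(s, x), s(p, s)} : Finset (Sym2 V)) : Set (Sym2 V)) := by
      intro x hsx hxp
      have := hsx.ne
      refine edgeSet_eq_of_subset ?_ ?_
      · intro e he
        simp only [Finset.coe_insert, Finset.coe_singleton, Set.mem_insert_iff,
          Set.mem_singleton_iff] at he
        rcases he with rfl | rfl | rfl | rfl <;> simpa
      · rw [hc.2]
        repeat rw [Finset.card_insert_of_notMem]
        · simp
        all_goals simp only [Finset.mem_insert, Finset.mem_singleton, Sym2.eq_iff]; grind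
    obtain ⟨x, hxp, hsx⟩ := hc.1.exists_adj_ne hps.symm
    have hset := hcard x hsx hxp
    have hadj : ∀ x', ∀ y', c.Adj x' y' ↔ s(x', y') = s(p, q) ∨ s(x', y') = s(q, r) ∨
        s(x', y') = s(s, x) ∨ s(x', y') = s(p, s) := by
      intro a b
      rw [← SimpleGraph.mem_edgeSet, hset]
      simp
    obtain ⟨y, hyq, hry⟩ := hc.1.exists_adj_ne hqr.symm
    have hxr : x = r := by
      have := (hadj r y).1 hry
      simp only [Sym2.eq_iff] at this
      grind
    subst hxr
    refine ⟨x, s, ⟨hc.1.1 hpq, hc.1.1 hqr, hc.1.1 hsx.symm, hc.1.1 hps.symm, hrp.symm,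
      hsq.symm⟩, ?_⟩
    ext a b
    rw [hadj, sq_adj, Sym2.eq_swap (a := p) (b := s), Sym2.eq_swap (a := x) (b := s)]
    refine ⟨fun h => ⟨h, ?_⟩, fun h => h.1⟩
    simp only [Sym2.eq_iff] at h
    have := hsx.ne
    grind

end Squares

/-! ## The span of the triangles of a graph of maximum degree three -/

section Subcubic

variable {V : Type*}

theorem edgeVec_sq_add_chord {p q r s : V} (h1 : p ≠ q) (h2 : q ≠ r) (h3 : r ≠ s) (h4 : s ≠ p)
    (h5 : p ≠ r) (h6 : q ≠ s) :
    edgeVec (tri p q r) + edgeVec (tri p r s) = edgeVec (sq p q r s) := by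
  classical
  have h11 : (1 : ZMod 2) + 1 = 0 := by decide
  ext e
  induction e using Sym2.ind with
  | _ x y =>
  simp only [Pi.add_apply, edgeVec_apply, SimpleGraph.mem_edgeSet, sq_adj, tri_adj, Sym2.eq_iff]
  grind

/-- The two squares share the path from `p` over `q` to `r`, which cancels. -/
theorem edgeVec_sq_add_sq {p q r s t : V} (h1 : p ≠ q) (h2 : q ≠ r) (h3 : r ≠ s) (h4 : s ≠ p)
    (h5 : p ≠ r) (h6 : q ≠ s) (h7 : t ≠ p) (h8 : t ≠ r) (h9 : t ≠ q) (h10 : s ≠ t) :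
    edgeVec (sq p s r q) + edgeVec (sq p t r q) = edgeVec (sq p s r t) := by
  classical
  have h11 : (1 : ZMod 2) + 1 = 0 := by decide
  ext e
  induction e using Sym2.ind with
  | _ x y =>
  simp only [Pi.add_apply, edgeVec_apply, SimpleGraph.mem_edgeSet, sq_adj, Sym2.eq_iff]
  grind

theorem sq_mem_triSpan {H : SimpleGraph V} {p q r s : V} (h : IsSq H p q r s)
    (hpr : H.Adj p r) : edgeVec (sq p q r s) ∈ triSpan H := by
  obtain ⟨h1, h2, h3, h4, h5, h6⟩ := h
  rw [← edgeVec_sq_add_chord h1.ne h2.ne h3.ne h4.ne h5 h6]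
  exact add_mem (Submodule.subset_span ⟨_, tri_mem_triangles h1 h2 hpr.symm, rfl⟩)
    (Submodule.subset_span ⟨_, tri_mem_triangles hpr h3 h4, rfl⟩)

theorem sq_mem_triSpan' {H : SimpleGraph V} {p q r s : V} (h : IsSq H p q r s)
    (hqs : H.Adj q s) : edgeVec (sq p q r s) ∈ triSpan H := by
  rw [← sq_rotate]
  exact sq_mem_triSpan ⟨h.2.1, h.2.2.1, h.2.2.2.1, h.1, h.2.2.2.2.2, h.2.2.2.2.1.symm⟩ hqs

variable [Finite V] {H : SimpleGraph V}

theorem eq_of_adj_of_ncard_le_three (hΔ : ∀ v, (H.neighborSet v).ncard ≤ 3) {v a b c d : V}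
    (ha : H.Adj v a) (hb : H.Adj v b) (hc : H.Adj v c) (hab : a ≠ b) (hac : a ≠ c) (hbc : b ≠ c)
    (hd : H.Adj v d) : d = a ∨ d = b ∨ d = c := by
  classical
  by_contra! hne
  have hsub : (({a, b, c, d} : Finset V) : Set V) ⊆ H.neighborSet v := by
    intro x hx
    simp only [Finset.coe_insert, Finset.coe_singleton, Set.mem_insert_iff,
      Set.mem_singleton_iff] at hx
    rcases hx with rfl | rfl | rfl | rfl <;> simpa
  have h1 := Set.ncard_le_ncard hsub (Set.toFinite _)
  have h2 := hΔ v
  have h3 : ({a, b, c, d} : Finset V).card = 4 := by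
    repeat rw [Finset.card_insert_of_notMem]
    · simp
    all_goals simp only [Finset.mem_insert, Finset.mem_singleton]; grind
  rw [Set.ncard_coe_finset] at h1
  omega

/-- As in the next two lemmas, a linear functional that vanishes on every triangle vanishes on
`triSpan H`. Here it is the coordinate of an edge that lies in no triangle. -/
theorem adj_of_mem_triSpan {z : Sym2 V → ZMod 2} (hz : z ∈ triSpan H) {a b : V}
    (hab : z s(a, b) ≠ 0) : H.Adj a b ∧ ∃ c, H.Adj a c ∧ H.Adj b c := by
  by_contra hn
  refine hab ?_
  have : triSpan H ≤ LinearMap.ker (LinearMap.proj s(a, b)) := by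
    refine Submodule.span_le.2 ?_
    rintro _ ⟨t, ht, rfl⟩
    by_contra hne
    have hadj : t.Adj a b := edgeVec_ne_zero_iff.1 hne
    obtain ⟨c, h1, h2, h3, -⟩ := exists_eq_tri ht hadj
    exact hn ⟨h1, c, h3.symm, h2⟩
  exact this hz

/-- The functional is the sum of the coordinates at all edges incident to `a`, which is zero by
evenness; so it cannot have exactly one nonzero term. -/
theorem exists_ne_of_mem_triSpan {z : Sym2 V → ZMod 2} (hz : z ∈ triSpan H) {a b : V}
    (hab : z s(a, b) ≠ 0) : ∃ c, c ≠ b ∧ z s(a, c) ≠ 0 := by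
  classical
  have := Fintype.ofFinite V
  by_contra! hn
  refine hab ?_
  have h0 : triSpan H ≤ LinearMap.ker (∑ w : V, LinearMap.proj (R := ZMod 2)
      (φ := fun _ : Sym2 V => ZMod 2) s(a, w)) := by
    refine Submodule.span_le.2 ?_
    rintro _ ⟨t, ht, rfl⟩
    have h2 : (((t.neighborSet a).ncard : ℕ) : ZMod 2) = 0 :=
      (ZMod.natCast_eq_zero_iff _ _).2 (even_iff_two_dvd.1 (ht.1.2 a))
    rw [Set.ncard_eq_toFinset_card'] at h2
    simp only [SetLike.mem_coe, LinearMap.mem_ker, LinearMap.sum_apply, LinearMap.proj_apply,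
      edgeVec_apply, SimpleGraph.mem_edgeSet]
    rw [Finset.sum_boole, ← h2]
    congr 2
    ext; simp
  have h1 := h0 hz
  simp only [LinearMap.mem_ker, LinearMap.sum_apply, LinearMap.proj_apply] at h1
  rwa [Finset.sum_eq_single b (fun c _ hc => hn c hc) (by simp)] at h1

/-- The only triangle that can contain `a b` or `a c` is `a b c`, which contains both, so the two
coordinates agree on every triangle. -/
theorem eq_of_mem_triSpan {z : Sym2 V → ZMod 2} (hz : z ∈ triSpan H) {a b c : V}
    (hab : ∀ d, H.Adj a d → H.Adj b d → d = c) (hac : ∀ d, H.Adj a d → H.Adj c d → d = b) :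
    z s(a, b) = z s(a, c) := by
  classical
  have : triSpan H ≤ LinearMap.ker (LinearMap.proj (R := ZMod 2)
      (φ := fun _ : Sym2 V => ZMod 2) s(a, b) - LinearMap.proj s(a, c)) := by
    refine Submodule.span_le.2 ?_
    rintro _ ⟨t, ht, rfl⟩
    have hiff : t.Adj a b ↔ t.Adj a c := by
      constructor
      · intro h
        obtain ⟨d, h1, h2, h3, rfl⟩ := exists_eq_tri ht h
        obtain rfl := hab d h3.symm h2
        rw [tri_adj]
        exact ⟨Or.inr (Or.inr Sym2.eq_swap), h3.ne'⟩
      · intro h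
        obtain ⟨d, h1, h2, h3, rfl⟩ := exists_eq_tri ht h
        obtain rfl := hac d h3.symm h2
        rw [tri_adj]
        exact ⟨Or.inr (Or.inr Sym2.eq_swap), h3.ne'⟩
    simp [edgeVec_apply, hiff]
  have h1 := this hz
  simpa [sub_eq_zero] using h1

/-- Through every edge of an element of the span of the triangles, there is a triangle or a
square with a chord all of whose edges belong to this element. -/
theorem exists_le_of_mem_triSpan (hΔ : ∀ v, (H.neighborSet v).ncard ≤ 3)
    {z : Sym2 V → ZMod 2} (hz : z ∈ triSpan H) {u v : V} (huv : z s(u, v) ≠ 0) :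
    ∃ t : SimpleGraph V, (t ∈ triangles H ∨
      ∃ p q r s, IsSq H p q r s ∧ H.Adj p r ∧ t = sq p q r s) ∧
      (∀ x y, t.Adj x y → z s(x, y) ≠ 0) ∧ t.Adj u v := by
  have htri : ∀ u v w, z s(u, v) ≠ 0 → z s(u, w) ≠ 0 → z s(v, w) ≠ 0 →
      (∀ x y, (tri u v w).Adj x y → z s(x, y) ≠ 0) := by
    intro u v w h1 h2 h3 x y hxy
    rw [tri_adj] at hxy
    rcases hxy.1 with h | h | h <;> rw [h]
    · exact h1
    · exact h3
    · rwa [Sym2.eq_swap]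
  have hsq : ∀ p q r s, z s(p, q) ≠ 0 → z s(q, r) ≠ 0 → z s(r, s) ≠ 0 → z s(s, p) ≠ 0 →
      (∀ x y, (sq p q r s).Adj x y → z s(x, y) ≠ 0) := by
    intro p q r s h1 h2 h3 h4 x y hxy
    rw [sq_adj] at hxy
    rcases hxy.1 with h | h | h | h <;> rwa [h]
  -- the case where one of the other two edges of a triangle through `u v` is missing
  have key : ∀ u v w, z s(u, v) ≠ 0 → H.Adj u w → H.Adj v w → z s(u, w) = 0 →
      ∃ t : SimpleGraph V, (t ∈ triangles H ∨
        ∃ p q r s, IsSq H p q r s ∧ H.Adj p r ∧ t = sq p q r s) ∧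
        (∀ x y, t.Adj x y → z s(x, y) ≠ 0) ∧ t.Adj u v := by
    intro u v w huv huw hvw h0
    have auv := (adj_of_mem_triSpan hz huv).1
    -- Evenness at `u` gives a second edge `u x` in the support. Then `v`, `w`, `x` are all
    -- neighbours of `u`, and a triangle on `u x` has `v` or `w` as its third vertex.
    obtain ⟨x, hxv, hux⟩ := exists_ne_of_mem_triSpan hz huv
    have hxw : x ≠ w := by rintro rfl; exact hux h0
    obtain ⟨aux, y, huy, hxy⟩ := adj_of_mem_triSpan hz hux
    have hNu : ∀ d, H.Adj u d → d = v ∨ d = w ∨ d = x := fun d =>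
      eq_of_adj_of_ncard_le_three hΔ auv huw aux hvw.ne hxv.symm hxw.symm
    have hcase : H.Adj x v ∨ (H.Adj x w ∧ ¬ H.Adj x v) := by
      by_cases hx : H.Adj x v
      · exact Or.inl hx
      · rcases hNu y huy with rfl | rfl | rfl
        · exact Or.inl hxy
        · exact Or.inr ⟨hxy, hx⟩
        · exact absurd hxy (H.irrefl)
    rcases hcase with axv | ⟨axw, nxv⟩
    · have hNv : ∀ d, H.Adj v d → d = u ∨ d = w ∨ d = x := fun d =>
        eq_of_adj_of_ncard_le_three hΔ auv.symm hvw axv.symm huw.ne aux.ne hxw.symm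
      by_cases hvx : z s(v, x) = 0
      -- The neighbours of `v` are `u`, `w`, `x` and `v x` is not in the support, so evenness at `v`
      -- leaves only `v w`.
      · have hzvw : z s(v, w) ≠ 0 := by
          obtain ⟨c, hcu, hc⟩ := exists_ne_of_mem_triSpan hz (Sym2.eq_swap (a := u) (b := v) ▸ huv)
          rcases hNv c (adj_of_mem_triSpan hz hc).1 with rfl | rfl | rfl
          · exact absurd rfl hcu
          · exact hc
          · exact absurd hvx hc
        -- If `x w` is an edge, the four vertices form a complete graph, and evenness at `x` puts `x
        -- w` into the support: the square `u v w x` lies in it.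
        by_cases axw : H.Adj x w
        · have hNx : ∀ d, H.Adj x d → d = u ∨ d = v ∨ d = w := fun d =>
            eq_of_adj_of_ncard_le_three hΔ aux.symm axv axw auv.ne huw.ne hvw.ne
          have hzxw : z s(x, w) ≠ 0 := by
            obtain ⟨c, hcu, hc⟩ :=
              exists_ne_of_mem_triSpan hz (Sym2.eq_swap (a := u) (b := x) ▸ hux)
            rcases hNx c (adj_of_mem_triSpan hz hc).1 with rfl | rfl | rfl
            · exact absurd rfl hcu
            · exact absurd (Sym2.eq_swap (a := x) (b := c) ▸ hvx) hc
            · exact hc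
          refine ⟨sq u v w x, Or.inr ⟨u, v, w, x, ⟨auv, hvw, axw.symm, aux.symm, huw.ne,
            hxv.symm⟩, huw, rfl⟩, hsq _ _ _ _ huv hzvw ?_ ?_, ?_⟩
          · rwa [Sym2.eq_swap]
          · rwa [Sym2.eq_swap]
          · rw [sq_adj]; exact ⟨Or.inl rfl, auv.ne⟩
        -- Otherwise `u v x` is the only triangle on `x u` and on `x v`, so the two coordinates
        -- agree, but only one of them is zero.
        · exfalso
          have h1 : z s(x, u) = z s(x, v) := by
            refine eq_of_mem_triSpan hz (fun d h1 h2 => ?_) (fun d h1 h2 => ?_)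
            · rcases hNu d h2 with rfl | rfl | rfl
              · rfl
              · exact absurd h1 axw
              · exact absurd h1 H.irrefl
            · rcases hNv d h2 with rfl | rfl | rfl
              · rfl
              · exact absurd h1 axw
              · exact absurd h1 H.irrefl
          rw [Sym2.eq_swap, Sym2.eq_swap (a := x) (b := v), hvx] at h1
          exact hux h1
      · refine ⟨tri u v x, Or.inl (tri_mem_triangles auv axv.symm aux.symm),
          htri _ _ _ huv hux hvx, ?_⟩
        rw [tri_adj]; exact ⟨Or.inl rfl, auv.ne⟩
    -- Two triangles glued along `u w`, with `v` and `x` not adjacent. The edges `v u`, `v w` lie in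
    -- only one triangle, and so do `x u`, `x w`; hence the outer square is in the support.
    · have hNw : ∀ d, H.Adj w d → d = u ∨ d = v ∨ d = x := fun d =>
        eq_of_adj_of_ncard_le_three hΔ huw.symm hvw.symm axw.symm auv.ne aux.ne hxv.symm
      have h1 : z s(v, u) = z s(v, w) := by
        refine eq_of_mem_triSpan hz (fun d h1 h2 => ?_) (fun d h1 h2 => ?_)
        · rcases hNu d h2 with rfl | rfl | rfl
          · exact absurd h1 H.irrefl
          · rfl
          · exact absurd h1.symm nxv
        · rcases hNw d h2 with rfl | rfl | rfl
          · rfl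
          · exact absurd h1 H.irrefl
          · exact absurd h1.symm nxv
      have h2 : z s(x, u) = z s(x, w) := by
        refine eq_of_mem_triSpan hz (fun d k1 k2 => ?_) (fun d k1 k2 => ?_)
        · rcases hNu d k2 with rfl | rfl | rfl
          · exact absurd k1 nxv
          · rfl
          · exact absurd k1 H.irrefl
        · rcases hNw d k2 with rfl | rfl | rfl
          · rfl
          · exact absurd k1 nxv
          · exact absurd k1 H.irrefl
      refine ⟨sq u v w x, Or.inr ⟨u, v, w, x, ⟨auv, hvw, axw.symm, aux.symm, huw.ne,
        hxv.symm⟩, huw, rfl⟩, hsq _ _ _ _ huv ?_ ?_ ?_, ?_⟩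
      · rw [← h1, Sym2.eq_swap]; exact huv
      · rw [Sym2.eq_swap, ← h2, Sym2.eq_swap]; exact hux
      · rwa [Sym2.eq_swap]
      · rw [sq_adj]; exact ⟨Or.inl rfl, auv.ne⟩
  obtain ⟨auv, w, huw, hvw⟩ := adj_of_mem_triSpan hz huv
  by_cases h1 : z s(u, w) = 0
  · exact key u v w huv huw hvw h1
  by_cases h2 : z s(v, w) = 0
  · obtain ⟨t, ht, hle, hadj⟩ := key v u w (Sym2.eq_swap (a := u) (b := v) ▸ huv) hvw huw h2
    exact ⟨t, ht, hle, hadj.symm⟩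
  · refine ⟨tri u v w, Or.inl (tri_mem_triangles auv hvw huw.symm), htri _ _ _ huv h1 h2, ?_⟩
    rw [tri_adj]; exact ⟨Or.inl rfl, auv.ne⟩

/-- An element of the span of the triangles is a sum of triangles and squares with a chord that
lie inside of it. -/
theorem mem_of_mem_triSpan (hΔ : ∀ v, (H.neighborSet v).ncard ≤ 3)
    {W : Submodule (ZMod 2) (Sym2 V → ZMod 2)} {z : Sym2 V → ZMod 2} (hz : z ∈ triSpan H)
    (h₃ : ∀ t ∈ triangles H, (∀ x y, t.Adj x y → z s(x, y) ≠ 0) → edgeVec t ∈ W)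
    (h₄ : ∀ p q r s, IsSq H p q r s → H.Adj p r →
      (∀ x y, (sq p q r s).Adj x y → z s(x, y) ≠ 0) → edgeVec (sq p q r s) ∈ W) : z ∈ W := by
  -- Subtracting a piece contained in the support removes its edges from the support and adds none,
  -- so the support shrinks and later pieces still lie in the original support.
  induction hn : {e | z e ≠ 0}.ncard using Nat.strong_induction_on generalizing z with
  | _ n ih =>
  by_cases h0 : z = 0
  · rw [h0]; exact zero_mem _
  obtain ⟨e, he⟩ := Function.ne_iff.1 h0
  induction e using Sym2.ind with
  | _ u v =>
  obtain ⟨t, ht, hle, huv⟩ := exists_le_of_mem_triSpan hΔ hz he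
  have htW : edgeVec t ∈ W := by
    rcases ht with ht | ⟨p, q, r, s, hs, hpr, rfl⟩
    · exact h₃ t ht hle
    · exact h₄ p q r s hs hpr hle
  have htH : edgeVec t ∈ triSpan H := by
    rcases ht with ht | ⟨p, q, r, s, hs, hpr, rfl⟩
    · exact Submodule.subset_span ⟨t, ht, rfl⟩
    · exact sq_mem_triSpan hs hpr
  have hone : ∀ a : ZMod 2, a ≠ 0 → a = 1 := by decide
  have hsub : ∀ x y, (z - edgeVec t) s(x, y) ≠ 0 → z s(x, y) ≠ 0 := by
    intro x y hxy
    by_cases hadj : t.Adj x y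
    · exact hle x y hadj
    · have : edgeVec t s(x, y) = 0 := by
        by_contra h; exact hadj (edgeVec_ne_zero_iff.1 h)
      simpa [this] using hxy
  have hlt : {e | (z - edgeVec t) e ≠ 0}.ncard < n := by
    rw [← hn]
    refine Set.ncard_lt_ncard ⟨?_, fun hss => ?_⟩ (Set.toFinite _)
    · intro e
      induction e using Sym2.ind with
      | _ x y => exact hsub x y
    · refine hss (a := s(u, v)) he ?_
      have h1 := edgeVec_ne_zero_iff.2 huv
      rw [Pi.sub_apply, hone _ he, hone _ h1, sub_self]
  have := ih _ hlt (sub_mem hz htH) (fun t' ht' h => h₃ t' ht' fun x y hxy => hsub x y (h x y hxy))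
    (fun p q r s hs hpr h => h₄ p q r s hs hpr fun x y hxy => hsub x y (h x y hxy)) rfl
  simpa using add_mem this htW

/-- Inside a square there is no triangle, so a piece inside it is the square itself up to labelling,
and the chord of the piece is a diagonal of the given square. -/
theorem sq_mem_triSpan_iff (hΔ : ∀ v, (H.neighborSet v).ncard ≤ 3) {p q r s : V}
    (h : IsSq H p q r s) :
    edgeVec (sq p q r s) ∈ triSpan H ↔ H.Adj p r ∨ H.Adj q s := by
  refine ⟨fun hz => ?_, fun hc => hc.elim (sq_mem_triSpan h) (sq_mem_triSpan' h)⟩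
  obtain ⟨h1, h2, h3, h4, h5, h6⟩ := h
  have hpq : edgeVec (sq p q r s) s(p, q) ≠ 0 :=
    edgeVec_ne_zero_iff.2 (by rw [sq_adj]; exact ⟨Or.inl rfl, h1.ne⟩)
  have n1 := h1.ne
  have n2 := h2.ne
  have n3 := h3.ne
  have n4 := h4.ne
  obtain ⟨t, ht, hle, hadj⟩ := exists_le_of_mem_triSpan hΔ hz hpq
  simp only [edgeVec_ne_zero_iff] at hle
  rcases ht with ht | ⟨a, b, c, d, hs, hac, rfl⟩
  · exfalso
    obtain ⟨x, -, hqx, hxp, rfl⟩ := exists_eq_tri ht hadj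
    have e1 := hle q x (by rw [tri_adj]; exact ⟨Or.inr (Or.inl rfl), hqx.ne⟩)
    have e2 := hle x p (by rw [tri_adj]; exact ⟨Or.inr (Or.inr rfl), hxp.ne⟩)
    simp only [sq_adj, Sym2.eq_iff] at e1 e2
    grind
  · obtain ⟨g1, g2, g3, g4, g5, g6⟩ := hs
    have e1 := hle a b (by rw [sq_adj]; exact ⟨Or.inl rfl, g1.ne⟩)
    have e2 := hle b c (by rw [sq_adj]; exact ⟨Or.inr (Or.inl rfl), g2.ne⟩)
    have : (a = p ∧ c = r) ∨ (a = r ∧ c = p) ∨ (a = q ∧ c = s) ∨ (a = s ∧ c = q) := by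
      simp only [sq_adj, Sym2.eq_iff] at e1 e2
      grind
    rcases this with ⟨rfl, rfl⟩ | ⟨rfl, rfl⟩ | ⟨rfl, rfl⟩ | ⟨rfl, rfl⟩
    · exact Or.inl hac
    · exact Or.inl hac.symm
    · exact Or.inr hac
    · exact Or.inr hac.symm

end Subcubic

/-! ## Squares of the common graph modulo the triangles of all graphs -/

section Common

variable {V : Type*} (Gs : List (SimpleGraph V))

/-- The pairs of opposite vertices of the square `p q r s` are not adjacent in any graph. -/
def ChordFree (p q r s : V) : Prop := ∀ H ∈ Gs, ¬ H.Adj p r ∧ ¬ H.Adj q s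

/-- The squares of the common graph that are not spanned by the triangles of any of the graphs. -/
def freeSquares : Set (SimpleGraph V) :=
  {c | c ∈ squares (common Gs) ∧ ∀ H ∈ Gs, edgeVec c ∉ triSpan H}

/-- The vertices `p`, `r` have the common neighbours `q`, `s`, `t`, where `s` and `t` are adjacent
in one of the graphs but not in the common graph, and this is the only kind of chord. -/
def ChordPair (p q r s t : V) : Prop :=
  IsSq (common Gs) p s r q ∧ IsSq (common Gs) p t r q ∧ s ≠ t ∧ (∃ H ∈ Gs, H.Adj s t) ∧
    ¬ (common Gs).Adj s t ∧ ChordFree Gs p s r q ∧ ChordFree Gs p t r q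

/-- The squares that are sums of two free squares and have a chord in one of the graphs only. -/
def chordSquares : Set (SimpleGraph V) :=
  {c | ∃ p q r s t, ChordPair Gs p q r s t ∧ c = sq p s r t}

/-- A set of free squares is independent modulo this subspace if and only if it is independent
modulo the triangles of each of the graphs. -/
def commonSpan : Submodule (ZMod 2) (Sym2 V → ZMod 2) :=
  triSpan (common Gs) ⊔ Submodule.span (ZMod 2) (edgeVec '' chordSquares Gs)

variable {Gs}

theorem common_le {H : SimpleGraph V} (hH : H ∈ Gs) : common Gs ≤ H := iInf₂_le H hH

/-- Together with `swap_ends`, this symmetry carries any edge of the square `p s r t` to the edge `p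
s`, so the local analysis below is needed for that edge only. -/
theorem ChordPair.swap_hubs {p q r s t : V} (h : ChordPair Gs p q r s t) :
    ChordPair Gs r q p s t := by
  obtain ⟨⟨a1, a2, a3, a4, a5, a6⟩, ⟨b1, b2, b3, b4, b5, b6⟩, h3, h4, h5, h6, h7⟩ := h
  exact ⟨⟨a2.symm, a1.symm, a4.symm, a3.symm, a5.symm, a6⟩,
    ⟨b2.symm, b1.symm, b4.symm, b3.symm, b5.symm, b6⟩, h3, h4, h5,
    fun H hH => ⟨fun h => (h6 H hH).1 h.symm, (h6 H hH).2⟩,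
    fun H hH => ⟨fun h => (h7 H hH).1 h.symm, (h7 H hH).2⟩⟩

theorem ChordPair.swap_ends {p q r s t : V} (h : ChordPair Gs p q r s t) :
    ChordPair Gs p q r t s := by
  obtain ⟨h1, h2, h3, ⟨H, hH, h4⟩, h5, h6, h7⟩ := h
  exact ⟨h2, h1, h3.symm, ⟨H, hH, h4.symm⟩, fun h => h5 h.symm, h7, h6⟩

theorem ChordPair.isSq {p q r s t : V} (h : ChordPair Gs p q r s t) :
    IsSq (common Gs) p s r t :=
  ⟨h.1.1, h.1.2.1, h.2.1.2.1.symm, h.2.1.1.symm, h.1.2.2.2.2.1, h.2.2.1⟩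

theorem exists_adj_of_sum_ne_zero {Y : Finset (SimpleGraph V)} {x y : V}
    (h : (∑ c ∈ Y, edgeVec c) s(x, y) ≠ 0) : ∃ c ∈ Y, c.Adj x y := by
  rw [Finset.sum_apply] at h
  obtain ⟨c, hc, hne⟩ := Finset.exists_ne_zero_of_sum_ne_zero h
  exact ⟨c, hc, edgeVec_ne_zero_iff.1 hne⟩

theorem ChordPair.exists_mem_triSpan {p q r s t : V}
    (h : ChordPair Gs p q r s t) : ∃ H ∈ Gs, edgeVec (sq p s r t) ∈ triSpan H := by
  obtain ⟨H, hH, h4⟩ := h.2.2.2.1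
  exact ⟨H, hH, sq_mem_triSpan' (h.isSq.mono (common_le hH)) h4⟩

theorem exists_chordPair_of_apply_ne_zero {u : Sym2 V → ZMod 2}
    (hu : u ∈ Submodule.span (ZMod 2) (edgeVec '' chordSquares Gs)) {x y : V}
    (hxy : u s(x, y) ≠ 0) : ∃ p q r s t, ChordPair Gs p q r s t ∧ s(x, y) = s(p, s) := by
  by_contra hn
  refine hxy ?_
  have : Submodule.span (ZMod 2) (edgeVec '' chordSquares Gs) ≤
      LinearMap.ker (LinearMap.proj s(x, y)) := by
    refine Submodule.span_le.2 ?_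
    rintro _ ⟨c, ⟨p, q, r, s, t, h, rfl⟩, rfl⟩
    by_contra hne
    have hadj : (sq p s r t).Adj x y := edgeVec_ne_zero_iff.1 hne
    refine hn ?_
    rcases (sq_adj.1 hadj).1 with e | e | e | e
    · exact ⟨p, q, r, s, t, h, e⟩
    · exact ⟨r, q, p, s, t, h.swap_hubs, e.trans Sym2.eq_swap⟩
    · exact ⟨r, q, p, t, s, h.swap_hubs.swap_ends, e⟩
    · exact ⟨p, q, r, t, s, h.swap_ends, e.trans Sym2.eq_swap⟩
  exact this hu

variable [Finite V]

theorem sq_mem_freeSquares_iff (hΔ : DeltaLE Gs 3) {p q r s : V}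
    (h : IsSq (common Gs) p q r s) : sq p q r s ∈ freeSquares Gs ↔ ChordFree Gs p q r s := by
  constructor
  · intro hc H hH
    have := hc.2 H hH
    rw [sq_mem_triSpan_iff (hΔ H hH) (h.mono (common_le hH))] at this
    tauto
  · intro hc
    refine ⟨h.mem_squares, fun H hH => ?_⟩
    rw [sq_mem_triSpan_iff (hΔ H hH) (h.mono (common_le hH))]
    have := hc H hH
    tauto

/-- Sums of free squares that are spanned by the triangles of one of the graphs. -/
theorem sum_mem_commonSpan (hΔ : DeltaLE Gs 3) {X : Finset (SimpleGraph V)}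
    (hX : ∀ c ∈ X, c ∈ freeSquares Gs) {H : SimpleGraph V} (hH : H ∈ Gs)
    (hz : ∑ c ∈ X, edgeVec c ∈ triSpan H) : ∑ c ∈ X, edgeVec c ∈ commonSpan Gs := by
  have hadj : ∀ x y, (∑ c ∈ X, edgeVec c) s(x, y) ≠ 0 → (common Gs).Adj x y := by
    intro x y hxy
    obtain ⟨c, hc, hcxy⟩ := exists_adj_of_sum_ne_zero hxy
    exact (hX c hc).1.1.1 hcxy
  -- The pieces lie in the support of a sum of common squares, so their edges are edges of the
  -- common graph; only the chord `p r` may belong to `H` alone.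
  refine mem_of_mem_triSpan (hΔ H hH) hz (fun t ht hle => ?_) (fun p q r s hs hpr hle => ?_)
  · exact Submodule.mem_sup_left (Submodule.subset_span
      ⟨t, ⟨⟨fun x y hxy => hadj x y (hle x y hxy), ht.1.2⟩, ht.2⟩, rfl⟩)
  · obtain ⟨h1, h2, h3, h4, h5, h6⟩ := hs
    have z1 := hle p q (by rw [sq_adj]; exact ⟨Or.inl rfl, h1.ne⟩)
    have z2 := hle q r (by rw [sq_adj]; exact ⟨Or.inr (Or.inl rfl), h2.ne⟩)
    have z3 := hle r s (by rw [sq_adj]; exact ⟨Or.inr (Or.inr (Or.inl rfl)), h3.ne⟩)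
    have z4 := hle s p (by rw [sq_adj]; exact ⟨Or.inr (Or.inr (Or.inr rfl)), h4.ne⟩)
    have hG : IsSq (common Gs) p q r s :=
      ⟨hadj _ _ z1, hadj _ _ z2, hadj _ _ z3, hadj _ _ z4, h5, h6⟩
    by_cases hc : (common Gs).Adj p r
    · exact Submodule.mem_sup_left (sq_mem_triSpan hG hc)
    -- The chord is not common. Some free squares of the sum contain `q p` and `q r`; the degree
    -- bound will determine both up to one vertex.
    obtain ⟨x, hx, hxqp⟩ := exists_adj_of_sum_ne_zero (Sym2.eq_swap (a := p) (b := q) ▸ z1)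
    obtain ⟨x', hx', hxqr⟩ := exists_adj_of_sum_ne_zero z2
    obtain ⟨y, w, hsx, rfl⟩ := exists_eq_sq (hX x hx).1 hxqp
    obtain ⟨y', w', hsx', rfl⟩ := exists_eq_sq (hX x' hx').1 hxqr
    have cf := (sq_mem_freeSquares_iff hΔ hsx).1 (hX _ hx)
    have cf' := (sq_mem_freeSquares_iff hΔ hsx').1 (hX _ hx')
    have le := common_le hH
    -- In `H` the neighbours of `p` are `q`, `s`, `r`, and `p r` is not common, so the free square
    -- continues from `p` to `s`.
    have hy : y = s := by
      rcases eq_of_adj_of_ncard_le_three (hΔ H hH) h1 h4.symm hpr h6 h2.ne h3.ne'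
        (le hsx.2.1) with rfl | rfl | rfl
      · exact absurd rfl hsx.2.2.2.2.1
      · rfl
      · exact absurd hsx.2.1 hc
    have hy' : y' = s := by
      rcases eq_of_adj_of_ncard_le_three (hΔ H hH) h2.symm h3 hpr.symm h6 h1.ne' h4.ne
        (le hsx'.2.1) with rfl | rfl | rfl
      · exact absurd rfl hsx'.2.2.2.2.1
      · rfl
      · exact absurd hsx'.2.1.symm hc
    subst hy hy'
    have hwr : w ≠ r := by
      rintro rfl
      exact (cf H hH).2 hpr
    -- In `H` the neighbours of `q` are `p`, `r`, `w`, so both free squares have the same fourth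
    -- vertex. They form a chord pair with hubs `q`, `s` and ends `p`, `r`.
    have hw : w' = w := by
      rcases eq_of_adj_of_ncard_le_three (hΔ H hH) h1.symm h2 (le hsx.2.2.2.1.symm) h5
        hsx.2.2.2.2.2 hwr.symm (le hsx'.2.2.2.1.symm) with rfl | rfl | rfl
      · exact absurd hpr.symm (cf' H hH).2
      · exact absurd rfl hsx'.2.2.2.2.2
      · rfl
    subst hw
    refine Submodule.mem_sup_right (Submodule.subset_span ⟨_, ⟨q, w', y', p, r,
      ⟨hsx, hsx', h5, ⟨H, hH, hpr⟩, hc, cf, cf'⟩, ?_⟩, rfl⟩)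
    rw [← sq_rotate q p, sq_reflect]

/-! ### Cycles through an edge of a chord pair -/

/-- In the graph with the chord, the neighbours of `s` are `p`, `r`, `t`. Neither `r` nor `t`
completes a common triangle on `p s`: `p r` is an edge of no graph and `s t` is not common. -/
theorem ChordPair.apply_eq_zero (hΔ : DeltaLE Gs 3) {p q r s t : V}
    (h : ChordPair Gs p q r s t) {z : Sym2 V → ZMod 2} (hz : z ∈ triSpan (common Gs)) :
    z s(p, s) = 0 := by
  by_contra hne
  obtain ⟨-, d, hpd, hsd⟩ := adj_of_mem_triSpan hz hne
  obtain ⟨⟨a1, a2, a3, a4, a5, a6⟩, ⟨b1, b2, b3, b4, b5, b6⟩, h3, ⟨H, hH, h4⟩, h5, h6, h7⟩ := h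
  have le := common_le hH
  rcases eq_of_adj_of_ncard_le_three (hΔ H hH) (le a1).symm (le a2) h4 a5 b1.ne b2.ne'
    (le hsd) with rfl | rfl | rfl
  · exact hpd.ne rfl
  · exact (h6 H hH).1 (le hpd)
  · exact h5 hsd

/-- The only way to continue from `s` in the common graph is to `r`, and the other neighbours of `p`
are `q` and `t`. -/
theorem ChordPair.eq_sq_of_adj (hΔ : DeltaLE Gs 3) {p q r s t : V}
    (h : ChordPair Gs p q r s t) {c : SimpleGraph V} (hc : c ∈ squares (common Gs))
    (hps : c.Adj p s) : c = sq p s r q ∨ c = sq p s r t := by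
  obtain ⟨y, w, hsq, rfl⟩ := exists_eq_sq hc hps
  obtain ⟨⟨a1, a2, a3, a4, a5, a6⟩, ⟨b1, b2, b3, b4, b5, b6⟩, h3, ⟨H, hH, h4⟩, h5, h6, h7⟩ := h
  have le := common_le hH
  obtain rfl : y = r := by
    rcases eq_of_adj_of_ncard_le_three (hΔ H hH) (le a1).symm (le a2) h4 a5 b1.ne b2.ne'
      (le hsq.2.1) with rfl | rfl | rfl
    · exact absurd rfl hsq.2.2.2.2.1
    · rfl
    · exact absurd hsq.2.1 h5
  rcases eq_of_adj_of_ncard_le_three (hΔ H hH) (le a1) (le a4).symm (le b1) a6 h3 b6.symm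
    (le hsq.2.2.2.1.symm) with rfl | rfl | rfl
  · exact absurd rfl hsq.2.2.2.2.2
  · exact Or.inl rfl
  · exact Or.inr rfl

theorem ChordPair.mem_freeSquares (hΔ : DeltaLE Gs 3) {p q r s t : V}
    (h : ChordPair Gs p q r s t) : sq p s r q ∈ freeSquares Gs :=
  (sq_mem_freeSquares_iff hΔ h.1).2 h.2.2.2.2.2.1

theorem ChordPair.eq_of_mem_freeSquares (hΔ : DeltaLE Gs 3) {p q r s t : V}
    (h : ChordPair Gs p q r s t) {c : SimpleGraph V} (hc : c ∈ freeSquares Gs)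
    (hps : c.Adj p s) : c = sq p s r q := by
  refine (h.eq_sq_of_adj hΔ hc.1 hps).resolve_right ?_
  rintro rfl
  obtain ⟨H, hH, h4⟩ := h.exists_mem_triSpan
  exact hc.2 H hH h4

/-- A chord square through `p s` is `sq p s r q` or `sq p s r t`. The first is free, hence no chord
square, and the second contains `p t`. So every chord square contains both edges or neither. -/
theorem ChordPair.apply_eq_apply (hΔ : DeltaLE Gs 3) {p q r s t : V}
    (h : ChordPair Gs p q r s t) {u : Sym2 V → ZMod 2}
    (hu : u ∈ Submodule.span (ZMod 2) (edgeVec '' chordSquares Gs)) :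
    u s(p, s) = u s(p, t) := by
  have aux : ∀ {p q r s t : V}, ChordPair Gs p q r s t → ∀ c ∈ chordSquares Gs, c.Adj p s →
      c.Adj p t := by
    rintro p q r s t h c ⟨p', q', r', s', t', h', rfl⟩ hps
    rcases h.eq_sq_of_adj hΔ h'.isSq.mem_squares hps with hc | hc
    · exfalso
      obtain ⟨H, hH, h4⟩ := h'.exists_mem_triSpan
      rw [hc] at h4
      exact (h.mem_freeSquares hΔ).2 H hH h4
    · rw [hc, sq_adj]
      exact ⟨Or.inr (Or.inr (Or.inr Sym2.eq_swap)), h.2.1.1.ne⟩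
  have : Submodule.span (ZMod 2) (edgeVec '' chordSquares Gs) ≤
      LinearMap.ker (LinearMap.proj (R := ZMod 2)
      (φ := fun _ : Sym2 V => ZMod 2) s(p, s) - LinearMap.proj s(p, t)) := by
    classical
    refine Submodule.span_le.2 ?_
    rintro _ ⟨c, hc, rfl⟩
    have : c.Adj p s ↔ c.Adj p t := ⟨aux h c hc, aux h.swap_ends c hc⟩
    simp [edgeVec_apply, this]
  have h1 := this hu
  simpa [sub_eq_zero] using h1

/-- Free squares that are independent modulo the triangles of each graph are independent modulo
the common subspace. -/
theorem linearIndepOn_commonSpan (hne : Gs ≠ []) (hΔ : DeltaLE Gs 3) {D : Finset (SimpleGraph V)}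
    (hD : ∀ c ∈ D, c ∈ freeSquares Gs)
    (hi : ∀ H ∈ Gs, LinearIndepOn (ZMod 2) ((triSpan H).mkQ ∘ edgeVec) (D : Set (SimpleGraph V))) :
    LinearIndepOn (ZMod 2) ((commonSpan Gs).mkQ ∘ edgeVec) (D : Set (SimpleGraph V)) := by
  classical
  simp only [linearIndepOn_mkQ_zmod_two] at hi ⊢
  intro Y hY hsum
  obtain ⟨τ, hτ, u, hu, hs⟩ := Submodule.mem_sup.1 hsum
  -- If `u` is nonzero at an edge `p s` of a chord pair, then so is the sum over `Y`, since `τ`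
  -- vanishes there; thus the only free square on `p s` is in `Y`. The same holds at `p t`. The two
  -- squares add up to a square spanned by the triangles of one graph, contrary to independence
  -- there.
  have hu0 : u = 0 := by
    by_contra h0
    obtain ⟨e, he⟩ := Function.ne_iff.1 h0
    induction e using Sym2.ind with
    | _ x y =>
    obtain ⟨p, q, r, s, t, h, hxy⟩ := exists_chordPair_of_apply_ne_zero hu he
    have hmem : ∀ {s t}, ChordPair Gs p q r s t → u s(p, s) ≠ 0 → sq p s r q ∈ Y := by
      intro s t h hne
      have : (∑ c ∈ Y, edgeVec c) s(p, s) ≠ 0 := by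
        rw [← hs, Pi.add_apply, h.apply_eq_zero hΔ hτ, zero_add]
        exact hne
      obtain ⟨c, hc, hps⟩ := exists_adj_of_sum_ne_zero this
      rwa [← h.eq_of_mem_freeSquares hΔ (hD c (hY hc)) hps]
    rw [hxy] at he
    have ha := hmem h he
    have hb := hmem h.swap_ends (by rwa [← h.apply_eq_apply hΔ hu])
    obtain ⟨⟨a1, a2, a3, a4, a5, a6⟩, ⟨b1, b2, b3, b4, b5, b6⟩, h3, -⟩ := id h
    have hab : sq p s r q ≠ sq p t r q := by
      intro hab
      have : (sq p t r q).Adj p s := by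
        rw [← hab, sq_adj]; exact ⟨Or.inl rfl, a1.ne⟩
      simp only [sq_adj, Sym2.eq_iff] at this
      have := a1.ne
      have := b1.ne
      have := a4.ne
      grind
    obtain ⟨H, hH, h4⟩ := h.exists_mem_triSpan
    have := hi H hH {sq p s r q, sq p t r q} (by
      intro c hc
      simp only [Finset.mem_insert, Finset.mem_singleton] at hc
      rcases hc with rfl | rfl
      · exact hY ha
      · exact hY hb) (by
      rw [Finset.sum_pair hab, edgeVec_sq_add_sq a4.ne' a3.ne' a2.ne' a1.ne' a5 a6.symm b1.ne'
        b2.ne b6 h3]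
      exact h4)
    simp at this
  obtain ⟨H, hH⟩ := List.exists_mem_of_ne_nil Gs hne
  refine hi H hH Y hY (triSpan_mono (common_le hH) ?_)
  rw [← hs, hu0, add_zero]
  exact hτ

/-- The conditions of all graphs become one condition in a single quotient space: a linear matroid
in place of an intersection of matroids. -/
theorem linearIndepOn_commonSpan_iff (hne : Gs ≠ []) (hΔ : DeltaLE Gs 3)
    {D : Finset (SimpleGraph V)} (hD : ∀ c ∈ D, c ∈ freeSquares Gs) :
    LinearIndepOn (ZMod 2) ((commonSpan Gs).mkQ ∘ edgeVec) (D : Set (SimpleGraph V)) ↔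
    ∀ H ∈ Gs, LinearIndepOn (ZMod 2) ((triSpan H).mkQ ∘ edgeVec) (D : Set (SimpleGraph V)) := by
  refine ⟨fun h H hH => ?_, linearIndepOn_commonSpan hne hΔ hD⟩
  rw [linearIndepOn_mkQ_zmod_two] at h ⊢
  exact fun Y hY hs => h Y hY (sum_mem_commonSpan hΔ (fun c hc => hD c (hY hc)) hH hs)

end Common

/-! ## Feasible solutions and the greedy algorithm -/

section Greedy

variable {V : Type*} {Gs : List (SimpleGraph V)}

theorem exists_eq_cons_nil {G : SimpleGraph V} {a b : V} (w : G.Walk a b) (hw : w.length = 1) :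
    ∃ h : G.Adj a b, w = .cons h .nil := by
  cases w with
  | nil => simp at hw
  | cons h w' =>
    cases w' with
    | nil => exact ⟨h, rfl⟩
    | cons h' w'' => simp at hw

/-- Take two opposite edges; the other two are the shortest paths between adjacent vertices, for
which there is no choice. So the candidate squares do not depend on `P`. -/
theorem isCandidate_sq {G : SimpleGraph V} (P : ShortestPaths G) {p q r s : V}
    (h : IsSq G p q r s) : IsCandidate G P (sq p q r s) := by
  obtain ⟨h1, h2, h3, h4, h5, h6⟩ := h
  refine Or.inr ⟨p, q, s, r, h1, h3.symm, h4.symm.reachable, ?_⟩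
  obtain ⟨k1, e1⟩ := exists_eq_cons_nil (P.path q r h2.reachable)
    (by rw [P.length_path]; exact SimpleGraph.dist_eq_one_iff_adj.2 h2)
  obtain ⟨k2, e2⟩ := exists_eq_cons_nil (P.path p s h4.symm.reachable)
    (by rw [P.length_path]; exact SimpleGraph.dist_eq_one_iff_adj.2 h4.symm)
  rw [e1, e2]
  have n1 := h1.ne
  have n2 := h2.ne
  have n3 := h3.ne
  have n4 := h4.ne
  constructor
  · rw [SimpleGraph.Walk.cons_isCycle_iff]
    simp [SimpleGraph.Walk.cons_isPath_iff]
    grind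
  · ext e
    induction e using Sym2.ind with
    | _ x y =>
    simp [sq_adj]
    grind

theorem IsCandidate.isCycleOf [Finite V] {G : SimpleGraph V} {P : ShortestPaths G}
    {c : SimpleGraph V} (h : IsCandidate G P c) : IsCycleOf G c := by
  have key : ∀ (u : V) (W : G.Walk u u), W.IsCycle → c.edgeSet = {e | e ∈ W.edges} →
      IsCycleOf G c := by
    intro u W hW hc
    have hadj : ∀ x y, c.Adj x y ↔ s(x, y) ∈ W.edges := fun x y => by
      rw [← SimpleGraph.mem_edgeSet, hc]; rfl
    refine ⟨fun x y hxy => W.adj_of_mem_edges ((hadj x y).1 hxy), fun v => ?_⟩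
    have hn : c.neighborSet v = W.toSubgraph.neighborSet v := by
      ext w
      rw [SimpleGraph.mem_neighborSet, hadj, SimpleGraph.Subgraph.mem_neighborSet,
        ← SimpleGraph.Walk.mem_edges_toSubgraph, SimpleGraph.Subgraph.mem_edgeSet]
    by_cases hv : v ∈ W.support
    · rw [hn, hW.ncard_neighborSet_toSubgraph_eq_two hv]
      exact even_two
    · have : c.neighborSet v = ∅ := by
        ext w
        simp only [SimpleGraph.mem_neighborSet, Set.mem_empty_iff_false, iff_false, hadj]
        exact fun h => hv (W.fst_mem_support_of_mem_edges h)
      rw [this]; simp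
  rcases h with ⟨u, v, w, _, _, h1, h2⟩ | ⟨u, v, w, x, _, _, _, h1, h2⟩
  · exact key _ _ h1 h2
  · exact key _ _ h1 h2

theorem exists_adj_of_weight_ne_zero {c : SimpleGraph V} (h : weight c ≠ 0) :
    ∃ p q, c.Adj p q := by
  obtain ⟨e, he⟩ := Set.nonempty_of_ncard_ne_zero h
  induction e using Sym2.ind with
  | _ p q => exact ⟨p, q, he⟩

variable [Finite V]

theorem candidateSquares_eq (P : ShortestPaths (common Gs)) :
    candidateSquares Gs P = freeSquares Gs := by
  ext c
  constructor
  · rintro ⟨h1, h2, h3⟩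
    exact ⟨⟨h1.isCycleOf, h2⟩, h3⟩
  · rintro ⟨h1, h3⟩
    obtain ⟨p, q, hpq⟩ := exists_adj_of_weight_ne_zero (c := c) (by rw [h1.2]; norm_num)
    obtain ⟨r, s, hsq, rfl⟩ := exists_eq_sq h1 hpq
    exact ⟨isCandidate_sq P hsq, h1.2, h3⟩

/-- The squares of a feasible solution are nonzero modulo the triangles of each graph, hence free,
and `linearIndepOn_commonSpan_iff` applies to them. The conditions on triangles and on squares are
unrelated. -/
theorem isFeasible_iff [DecidableEq (SimpleGraph V)] (hne : Gs ≠ []) (hγ : GammaLE Gs 4)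
    (hΔ : DeltaLE Gs 3) (B : Finset (SimpleGraph V)) :
    IsFeasible Gs B ↔ (∀ c ∈ B, c ∈ triangles (common Gs) ∨ c ∈ freeSquares Gs) ∧
      LinearIndepOn (ZMod 2) edgeVec
        ((B.filter fun c => weight c = 3 : Finset (SimpleGraph V)) : Set (SimpleGraph V)) ∧
      LinearIndepOn (ZMod 2) ((commonSpan Gs).mkQ ∘ edgeVec)
        ((B.filter fun c => weight c = 4 : Finset (SimpleGraph V)) : Set (SimpleGraph V)) := by
  constructor
  · rintro ⟨hc, hB⟩
    have hB' := fun H hH => (extends_isMinCycleBasis_iff (hγ H hH) B).1 (hB H hH)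
    have hfree : ∀ c ∈ B, weight c = 4 → c ∈ freeSquares Gs := by
      intro c hcB hw
      refine ⟨⟨hc c hcB, hw⟩, fun H hH hmem => ?_⟩
      refine (hB' H hH).2.2.ne_zero (i := c) ?_ ?_
      · simpa using ⟨hcB, hw⟩
      · exact (Submodule.Quotient.mk_eq_zero _).2 hmem
    obtain ⟨H₀, hH₀⟩ := List.exists_mem_of_ne_nil Gs hne
    refine ⟨fun c hcB => ?_, ?_, ?_⟩
    · exact ((hB' H₀ hH₀).1 c hcB).2.imp (fun h => ⟨hc c hcB, h⟩) (hfree c hcB)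
    · convert! (hB' H₀ hH₀).2.1
    · refine linearIndepOn_commonSpan hne hΔ ?_ fun H hH => ?_
      · intro c hc
        rw [Finset.mem_filter] at hc
        exact hfree c hc.1 hc.2
      · convert! (hB' H hH).2.2
  · rintro ⟨hc, h3, h4⟩
    refine ⟨fun c hcB => (hc c hcB).elim (fun h => h.1) (fun h => h.1.1), fun H hH => ?_⟩
    refine (extends_isMinCycleBasis_iff (hγ H hH) B).2 ⟨fun c hcB => ?_, ?_, ?_⟩
    · exact (hc c hcB).elim (fun h => ⟨h.1.mono (common_le hH), Or.inl h.2⟩)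
        (fun h => ⟨h.1.1.mono (common_le hH), Or.inr h.1.2⟩)
    · convert! h3
    · have := (linearIndepOn_commonSpan_iff hne hΔ (D := B.filter fun c => weight c = 4) (by
        intro c hcB
        rw [Finset.mem_filter] at hcB
        refine (hc c hcB.1).resolve_left fun h => ?_
        have := h.2
        omega)).1 h4 H hH
      convert! this

theorem isFeasible_three_iff (hne : Gs ≠ []) (hγ : GammaLE Gs 4)
    (hΔ : DeltaLE Gs 3) {D : Finset (SimpleGraph V)} (hD : ∀ c ∈ D, weight c = 3) :
    IsFeasible Gs D ↔ (∀ c ∈ D, c ∈ triangles (common Gs)) ∧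
      LinearIndepOn (ZMod 2) edgeVec (D : Set (SimpleGraph V)) := by
  classical
  rw [isFeasible_iff hne hγ hΔ, Finset.filter_true_of_mem hD, Finset.filter_false_of_mem
    (fun c hc => by rw [hD c hc]; norm_num)]
  simp only [Finset.coe_empty, linearIndepOn_empty, and_true]
  refine and_congr_left fun _ => forall₂_congr fun c hc => ⟨fun h => h.resolve_right fun h => ?_,
    Or.inl⟩
  have h1 := h.1.2
  have h2 := hD c hc
  omega

theorem isFeasible_four_iff (hne : Gs ≠ []) (hγ : GammaLE Gs 4)
    (hΔ : DeltaLE Gs 3) {S : Finset (SimpleGraph V)} (hS : ∀ c ∈ S, weight c = 4) :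
    IsFeasible Gs S ↔ (∀ c ∈ S, c ∈ freeSquares Gs) ∧
      LinearIndepOn (ZMod 2) ((commonSpan Gs).mkQ ∘ edgeVec) (S : Set (SimpleGraph V)) := by
  classical
  rw [isFeasible_iff hne hγ hΔ, Finset.filter_true_of_mem hS, Finset.filter_false_of_mem
    (fun c hc => by rw [hS c hc]; norm_num)]
  simp only [Finset.coe_empty, linearIndepOn_empty, true_and]
  refine and_congr_left fun _ => forall₂_congr fun c hc => ⟨fun h => h.resolve_left fun h => ?_,
    Or.inr⟩
  have h1 := h.2
  have h2 := hS c hc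
  omega

/-- The two weights can be optimized separately. -/
theorem IsOptimalOfWeight.isOptimal_union [DecidableEq (SimpleGraph V)] (hne : Gs ≠ [])
    (hγ : GammaLE Gs 4) (hΔ : DeltaLE Gs 3) {D S : Finset (SimpleGraph V)}
    (hD : IsOptimalOfWeight Gs 3 D) (hS : IsOptimalOfWeight Gs 4 S) :
    IsOptimal Gs (D ∪ S) := by
  obtain ⟨⟨hDf, hDw⟩, hDm⟩ := hD
  obtain ⟨⟨hSf, hSw⟩, hSm⟩ := hS
  have hdisj : Disjoint D S := by
    rw [Finset.disjoint_left]
    intro c h1 h2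
    have := hDw c h1
    have := hSw c h2
    omega
  have hD' := (isFeasible_three_iff hne hγ hΔ hDw).1 hDf
  have hS' := (isFeasible_four_iff hne hγ hΔ hSw).1 hSf
  have f3 : (D ∪ S).filter (fun c => weight c = 3) = D := by
    rw [Finset.filter_union, Finset.filter_true_of_mem hDw, Finset.filter_false_of_mem
      (fun c hc => by rw [hSw c hc]; norm_num), Finset.union_empty]
  have f4 : (D ∪ S).filter (fun c => weight c = 4) = S := by
    rw [Finset.filter_union, Finset.filter_true_of_mem hSw, Finset.filter_false_of_mem
      (fun c hc => by rw [hDw c hc]; norm_num), Finset.empty_union]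
  refine ⟨(isFeasible_iff hne hγ hΔ _).2 ⟨fun c hc => ?_, by rw [f3]; exact hD'.2,
    by rw [f4]; exact hS'.2⟩, fun B hB => ?_⟩
  · exact (Finset.mem_union.1 hc).imp (hD'.1 c) (hS'.1 c)
  · have hB' := (isFeasible_iff hne hγ hΔ _).1 hB
    have w3 : ∀ c ∈ B.filter (fun c => weight c = 3), weight c = 3 :=
      fun c hc => (Finset.mem_filter.1 hc).2
    have w4 : ∀ c ∈ B.filter (fun c => weight c = 4), weight c = 4 :=
      fun c hc => (Finset.mem_filter.1 hc).2
    have h3 := hDm (B.filter fun c => weight c = 3)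
      ((isFeasible_three_iff hne hγ hΔ w3).2 ⟨fun c hc => by
        have hc := Finset.mem_filter.1 hc
        refine (hB'.1 c hc.1).resolve_right fun h => ?_
        have := h.1.2
        omega, hB'.2.1⟩) w3
    have h4 := hSm (B.filter fun c => weight c = 4)
      ((isFeasible_four_iff hne hγ hΔ w4).2 ⟨fun c hc => by
        have hc := Finset.mem_filter.1 hc
        refine (hB'.1 c hc.1).resolve_left fun h => ?_
        have := h.2
        omega, hB'.2.2⟩) w4
    have hsum : B.card ≤ (B.filter fun c => weight c = 3).card +
        (B.filter fun c => weight c = 4).card := by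
      rw [← Finset.card_union_of_disjoint]
      · refine Finset.card_le_card fun c hc => ?_
        rw [Finset.mem_union, Finset.mem_filter, Finset.mem_filter]
        exact (hB'.1 c hc).imp (fun h => ⟨hc, h.2⟩) (fun h => ⟨hc, h.1.2⟩)
      · rw [Finset.disjoint_left]
        intro c h1 h2
        have := w3 c h1
        have := w4 c h2
        omega
    rw [Finset.card_union_of_disjoint hdisj]
    omega

theorem isOptimalOfWeight_three (hne : Gs ≠ []) (hγ : GammaLE Gs 4) (hΔ : DeltaLE Gs 3)
    {D : Finset (SimpleGraph V)} (hD : ∀ c ∈ D, c ∈ triangles (common Gs))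
    (hi : LinearIndepOn (ZMod 2) edgeVec (D : Set (SimpleGraph V)))
    (hs : ∀ c ∈ triangles (common Gs), Spans (D : Set (SimpleGraph V)) c) :
    IsOptimalOfWeight Gs 3 D := by
  have hw : ∀ c ∈ D, weight c = 3 := fun c hc => (hD c hc).2
  refine ⟨⟨(isFeasible_three_iff hne hγ hΔ hw).2 ⟨hD, hi⟩, hw⟩, fun B hB hBw => ?_⟩
  have hB' := (isFeasible_three_iff hne hγ hΔ hBw).1 hB
  exact card_le_card_of_linearIndepOn_mkQ (linearIndepOn_mkQ_bot.2 hB'.2)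
    fun c hc => Submodule.mem_sup_right (hs c (hB'.1 c hc))

theorem isOptimalOfWeight_four (hne : Gs ≠ []) (hγ : GammaLE Gs 4) (hΔ : DeltaLE Gs 3)
    {S : Finset (SimpleGraph V)} (hS : ∀ c ∈ S, c ∈ freeSquares Gs)
    (hi : LinearIndepOn (ZMod 2) ((commonSpan Gs).mkQ ∘ edgeVec) (S : Set (SimpleGraph V)))
    (hs : ∀ c ∈ freeSquares Gs, edgeVec c ∈
      commonSpan Gs ⊔ Submodule.span (ZMod 2) (edgeVec '' (S : Set (SimpleGraph V)))) :
    IsOptimalOfWeight Gs 4 S := by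
  have hw : ∀ c ∈ S, weight c = 4 := fun c hc => (hS c hc).1.2
  refine ⟨⟨(isFeasible_four_iff hne hγ hΔ hw).2 ⟨hS, hi⟩, hw⟩, fun B hB hBw => ?_⟩
  have hB' := (isFeasible_four_iff hne hγ hΔ hBw).1 hB
  exact card_le_card_of_linearIndepOn_mkQ hB'.2 fun c hc => hs c (hB'.1 c hc)

/-- The greedy test fails in some graph exactly when adding `c` destroys independence in that graph,
and by `linearIndepOn_commonSpan_iff` this is dependence modulo `commonSpan Gs`. -/
theorem exists_spans_union_triangles_iff (hne : Gs ≠ []) (hΔ : DeltaLE Gs 3)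
    {S : Finset (SimpleGraph V)} (hS : ∀ c ∈ S, c ∈ freeSquares Gs)
    (hi : LinearIndepOn (ZMod 2) ((commonSpan Gs).mkQ ∘ edgeVec) (S : Set (SimpleGraph V)))
    {c : SimpleGraph V} (hc : c ∈ freeSquares Gs) :
    (∃ H ∈ Gs, Spans ((S : Set (SimpleGraph V)) ∪ triangles H) c) ↔
      edgeVec c ∈
        commonSpan Gs ⊔ Submodule.span (ZMod 2) (edgeVec '' (S : Set (SimpleGraph V))) := by
  classical
  have hsp : ∀ H, Spans ((S : Set (SimpleGraph V)) ∪ triangles H) c ↔ edgeVec c ∈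
      triSpan H ⊔ Submodule.span (ZMod 2) (edgeVec '' (S : Set (SimpleGraph V))) := by
    intro H
    rw [Spans, Set.image_union, Submodule.span_union, sup_comm]
    rfl
  simp only [hsp]
  -- If `c` is already in `S`, insertion does not change the set and its independence says nothing;
  -- but then both sides hold.
  by_cases hcS : c ∈ S
  · have hmem : edgeVec c ∈ Submodule.span (ZMod 2) (edgeVec '' (S : Set (SimpleGraph V))) :=
      Submodule.subset_span ⟨c, hcS, rfl⟩
    obtain ⟨H, hH⟩ := List.exists_mem_of_ne_nil Gs hne
    exact ⟨fun _ => Submodule.mem_sup_right hmem, fun _ => ⟨H, hH, Submodule.mem_sup_right hmem⟩⟩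
  have hi' := (linearIndepOn_commonSpan_iff hne hΔ hS).1 hi
  have hins : ∀ d ∈ insert c S, d ∈ freeSquares Gs := by
    intro d hd
    rcases Finset.mem_insert.1 hd with rfl | hd
    · exact hc
    · exact hS d hd
  have hiff := linearIndepOn_commonSpan_iff hne hΔ hins
  rw [Finset.coe_insert] at hiff
  have hcS' : c ∉ (S : Set (SimpleGraph V)) := hcS
  constructor
  · rintro ⟨H, hH, hmem⟩
    by_contra hn
    exact notMem_of_linearIndepOn_mkQ_insert hcS'
      (hiff.1 (linearIndepOn_mkQ_insert hi hn) H hH) hmem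
  · intro hmem
    by_contra! hn
    exact notMem_of_linearIndepOn_mkQ_insert hcS'
      (hiff.2 fun H hH => linearIndepOn_mkQ_insert (hi' H hH) (hn H hH)) hmem

open Classical in
theorem isOptimalOfWeight_greedy (hne : Gs ≠ []) (hγ : GammaLE Gs 4) (hΔ : DeltaLE Gs 3)
    {l : List (SimpleGraph V)} (hl : ∀ c, c ∈ l ↔ c ∈ freeSquares Gs) :
    IsOptimalOfWeight Gs 4 (greedy Gs l) := by
  -- Invariant of the fold from an arbitrary start: the set stays independent modulo `commonSpan
  -- Gs`, and each square that has been processed is spanned by it modulo this subspace.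
  have key : ∀ (l : List (SimpleGraph V)) (S : Finset (SimpleGraph V)),
      (∀ c ∈ l, c ∈ freeSquares Gs) → (∀ c ∈ S, c ∈ freeSquares Gs) →
      LinearIndepOn (ZMod 2) ((commonSpan Gs).mkQ ∘ edgeVec) (S : Set (SimpleGraph V)) →
      ∀ S' : Finset (SimpleGraph V), S' = l.foldl (fun (B : Finset (SimpleGraph V)) c =>
        if ∃ G ∈ Gs, Spans ((B : Set (SimpleGraph V)) ∪ triangles G) c then B else insert c B) S →
      S ⊆ S' ∧ (∀ c ∈ S', c ∈ freeSquares Gs) ∧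
      LinearIndepOn (ZMod 2) ((commonSpan Gs).mkQ ∘ edgeVec) (S' : Set (SimpleGraph V)) ∧
      ∀ c ∈ l, edgeVec c ∈ commonSpan Gs ⊔
        Submodule.span (ZMod 2) (edgeVec '' (S' : Set (SimpleGraph V))) := by
    intro l
    induction l with
    | nil =>
      rintro S - hS hi S' rfl
      exact ⟨subset_rfl, hS, hi, by simp⟩
    | cons a l ih =>
      intro S hl hS hi S' hS'
      rw [List.foldl_cons] at hS'
      have ha := hl a List.mem_cons_self
      have hl' : ∀ c ∈ l, c ∈ freeSquares Gs := fun c hc => hl c (List.mem_cons_of_mem _ hc)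
      have hmono : ∀ {S₁ : Finset (SimpleGraph V)}, S₁ ⊆ S' →
          commonSpan Gs ⊔ Submodule.span (ZMod 2) (edgeVec '' (S₁ : Set (SimpleGraph V))) ≤
          commonSpan Gs ⊔ Submodule.span (ZMod 2) (edgeVec '' (S' : Set (SimpleGraph V))) :=
        fun h => sup_le_sup_left (Submodule.span_mono (Set.image_mono (by exact_mod_cast h))) _
      have hiff := exists_spans_union_triangles_iff hne hΔ hS hi ha
      split_ifs at hS' with hcond
      · obtain ⟨h1, h2, h3, h4⟩ := ih S hl' hS hi S' hS'
        refine ⟨h1, h2, h3, fun c hc => ?_⟩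
        rcases List.mem_cons.1 hc with rfl | hc
        · exact hmono h1 (hiff.1 hcond)
        · exact h4 c hc
      · obtain ⟨h1, h2, h3, h4⟩ := ih (insert a S) hl' (by
          intro d hd
          rcases Finset.mem_insert.1 hd with rfl | hd
          · exact ha
          · exact hS d hd) (by
          rw [Finset.coe_insert]
          exact linearIndepOn_mkQ_insert hi (fun h => hcond (hiff.2 h))) S' hS'
        refine ⟨(Finset.subset_insert _ _).trans h1, h2, h3, fun c hc => ?_⟩
        rcases List.mem_cons.1 hc with rfl | hc
        · exact Submodule.mem_sup_right (Submodule.subset_span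
            ⟨c, h1 (Finset.mem_insert_self _ _), rfl⟩)
        · exact h4 c hc
  obtain ⟨-, h2, h3, h4⟩ := key l ∅ (fun c hc => (hl c).1 hc) (by simp)
    (by simp [linearIndepOn_empty]) (greedy Gs l) rfl
  exact isOptimalOfWeight_four hne hγ hΔ h2 h3 fun c hc => h4 c ((hl c).2 hc)

end Greedy

/-! ## Reasoning about programs -/

section Programs

/-- Assignment to a register. -/
def Mem.setReg (s : Mem) (x v : ℕ) : Mem := ⟨Function.update s.reg x v, s.arr⟩

/-- Assignment to a cell of an array. -/
def Mem.setArr (s : Mem) (a i v : ℕ) : Mem :=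
  ⟨s.reg, Function.update s.arr a (Function.update (s.arr a) i v)⟩

@[simp] theorem Mem.setReg_reg (s : Mem) (x v y : ℕ) :
    (s.setReg x v).reg y = if y = x then v else s.reg y := Function.update_apply ..

@[simp] theorem Mem.setReg_arr (s : Mem) (x v : ℕ) : (s.setReg x v).arr = s.arr := rfl

@[simp] theorem Mem.setArr_reg (s : Mem) (a i v : ℕ) : (s.setArr a i v).reg = s.reg := rfl

@[simp] theorem Mem.setArr_arr_self (s : Mem) (a i v j : ℕ) :
    (s.setArr a i v).arr a j = if j = i then v else s.arr a j := by
  simp [Mem.setArr, Function.update_apply]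

theorem Mem.setArr_arr_of_ne (s : Mem) {a b : ℕ} (i v : ℕ) (h : b ≠ a) :
    (s.setArr a i v).arr b = s.arr b := by
  simp [Mem.setArr, h]

/-- The registers a program assigns to. -/
def Prog.regs : Prog → List ℕ
  | skip => []
  | assign x _ => [x]
  | store _ _ _ => []
  | seq p q => p.regs ++ q.regs
  | ite _ p q => p.regs ++ q.regs
  | loop _ p => p.regs

/-- The arrays a program writes to. -/
def Prog.arrs : Prog → List ℕ
  | skip => []
  | assign _ _ => []
  | store a _ _ => [a]
  | seq p q => p.arrs ++ q.arrs
  | ite _ p q => p.arrs ++ q.arrs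
  | loop _ p => p.arrs

theorem Exec.reg_eq {p : Prog} {s s' : Mem} {t : ℕ} (h : Exec p s s' t) {x : ℕ}
    (hx : x ∉ p.regs) : s'.reg x = s.reg x := by
  induction h with
  | skip => rfl
  | assign s y e =>
    simp only [Prog.regs, List.mem_singleton] at hx
    exact Function.update_of_ne hx _ _
  | store => rfl
  | seq _ _ ih1 ih2 =>
    simp only [Prog.regs, List.mem_append, not_or] at hx
    rw [ih2 hx.2, ih1 hx.1]
  | ite_pos _ _ ih =>
    simp only [Prog.regs, List.mem_append, not_or] at hx
    exact ih hx.1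
  | ite_neg _ _ ih =>
    simp only [Prog.regs, List.mem_append, not_or] at hx
    exact ih hx.2
  | loop_done => rfl
  | loop_step _ _ _ ih1 ih2 => rw [ih2 hx, ih1 hx]

theorem Exec.arr_eq {p : Prog} {s s' : Mem} {t : ℕ} (h : Exec p s s' t) {a : ℕ}
    (ha : a ∉ p.arrs) : s'.arr a = s.arr a := by
  induction h with
  | skip => rfl
  | assign => rfl
  | store s b i e =>
    simp only [Prog.arrs, List.mem_singleton] at ha
    exact Function.update_of_ne ha _ _
  | seq _ _ ih1 ih2 =>
    simp only [Prog.arrs, List.mem_append, not_or] at ha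
    rw [ih2 ha.2, ih1 ha.1]
  | ite_pos _ _ ih =>
    simp only [Prog.arrs, List.mem_append, not_or] at ha
    exact ih ha.1
  | ite_neg _ _ ih =>
    simp only [Prog.arrs, List.mem_append, not_or] at ha
    exact ih ha.2
  | loop_done => rfl
  | loop_step _ _ _ ih1 ih2 => rw [ih2 ha, ih1 ha]

/-- A bound for the number of steps if every loop makes at most `L` iterations. -/
def Prog.bound (L : ℕ) : Prog → ℕ
  | skip => 1
  | assign _ e => e.cost + 1
  | store _ i e => i.cost + e.cost + 1
  | seq p q => p.bound L + q.bound L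
  | ite e p q => e.cost + 1 + (p.bound L + q.bound L)
  | loop e p => L * (e.cost + 1 + p.bound L) + (e.cost + 1)

/-- `Prog.bound` as a polynomial. -/
noncomputable def Prog.boundPoly : Prog → Polynomial ℕ
  | skip => 1
  | assign _ e => Polynomial.C (e.cost + 1)
  | store _ i e => Polynomial.C (i.cost + e.cost + 1)
  | seq p q => p.boundPoly + q.boundPoly
  | ite e p q => Polynomial.C (e.cost + 1) + (p.boundPoly + q.boundPoly)
  | loop e p => Polynomial.X * (Polynomial.C (e.cost + 1) + p.boundPoly) +
      Polynomial.C (e.cost + 1)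

theorem Prog.eval_boundPoly (L : ℕ) (p : Prog) : p.boundPoly.eval L = p.bound L := by
  induction p with
  | skip => simp [Prog.boundPoly, Prog.bound]
  | assign => simp [Prog.boundPoly, Prog.bound]
  | store => simp [Prog.boundPoly, Prog.bound]
  | seq p q ihp ihq => simp [Prog.boundPoly, Prog.bound, ihp, ihq]
  | ite e p q ihp ihq => simp [Prog.boundPoly, Prog.bound, ihp, ihq]
  | loop e p ih => simp [Prog.boundPoly, Prog.bound, ih]

/-- The program `p`, started in `s`, halts within its bound in a memory that satisfies `Q`. -/
def Wp (L : ℕ) (p : Prog) (Q : Mem → Prop) (s : Mem) : Prop :=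
  ∃ s' t, Exec p s s' t ∧ t ≤ p.bound L ∧ Q s'

variable {L : ℕ} {p q : Prog} {Q R : Mem → Prop} {s : Mem}

theorem Wp.mono (h : Wp L p Q s) (hQ : ∀ s', Q s' → R s') : Wp L p R s := by
  obtain ⟨s', t, h1, h2, h3⟩ := h
  exact ⟨s', t, h1, h2, hQ s' h3⟩

/-- The parts of the memory that a program does not write to are unchanged. -/
theorem Wp.frame (h : Wp L p Q s) (hQ : ∀ s', Q s' → (∀ x, x ∉ p.regs → s'.reg x = s.reg x) →
    (∀ a, a ∉ p.arrs → s'.arr a = s.arr a) → R s') : Wp L p R s := by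
  obtain ⟨s', t, h1, h2, h3⟩ := h
  exact ⟨s', t, h1, h2, hQ s' h3 (fun x hx => h1.reg_eq hx) (fun a ha => h1.arr_eq ha)⟩

theorem Wp.skip (h : Q s) : Wp L .skip Q s := ⟨s, 1, .skip s, le_rfl, h⟩

theorem Wp.assign {x : ℕ} {e : Expr} (h : Q (s.setReg x (e.eval s))) : Wp L (.assign x e) Q s :=
  ⟨_, _, .assign s x e, le_rfl, h⟩

theorem Wp.store {a : ℕ} {i e : Expr} (h : Q (s.setArr a (i.eval s) (e.eval s))) :
    Wp L (.store a i e) Q s :=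
  ⟨_, _, .store s a i e, le_rfl, h⟩

theorem Wp.seq (h : Wp L p (Wp L q Q) s) : Wp L (.seq p q) Q s := by
  obtain ⟨s', t, h1, h2, s'', t', h3, h4, h5⟩ := h
  exact ⟨s'', t + t', .seq h1 h3, by simp only [Prog.bound]; omega, h5⟩

theorem Wp.ite {e : Expr} (hp : e.eval s ≠ 0 → Wp L p Q s) (hq : e.eval s = 0 → Wp L q Q s) :
    Wp L (.ite e p q) Q s := by
  by_cases he : e.eval s = 0
  · obtain ⟨s', t, h1, h2, h3⟩ := hq he
    exact ⟨s', _, .ite_neg he h1, by simp only [Prog.bound]; omega, h3⟩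
  · obtain ⟨s', t, h1, h2, h3⟩ := hp he
    exact ⟨s', _, .ite_pos he h1, by simp only [Prog.bound]; omega, h3⟩

/-- Execute `p` with register `x` running from `0` to the value of register `b`, exclusively. -/
def forLoop (x b : ℕ) (p : Prog) : Prog :=
  .seq (.assign x (.lit 0))
    (.loop (.sub (.reg b) (.reg x)) (.seq p (.assign x (.add (.reg x) (.lit 1)))))

/-- `I i` holds before iteration `i`. The body may also rely on everything it does not write being
as it was at the start of the loop. -/
theorem Wp.forLoop {x b N : ℕ} (I : ℕ → Mem → Prop) (hN : s.reg b = N) (hNL : N ≤ L)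
    (hxb : x ≠ b) (hx : x ∉ p.regs) (hb : b ∉ p.regs) (h0 : I 0 (s.setReg x 0))
    (hI : ∀ i < N, ∀ s', I i s' → s'.reg x = i → (∀ y, y ≠ x → y ∉ p.regs → s'.reg y = s.reg y) →
      (∀ a, a ∉ p.arrs → s'.arr a = s.arr a) →
      Wp L p (fun s'' => I (i + 1) (s''.setReg x (i + 1))) s') :
    Wp L (forLoop x b p) (I N) s := by
  -- Induction on the number `k` of remaining iterations. Each of the two constants 4 inside the
  -- product is for one test of the guard and one increment; the last 4 is the final test.
  have key : ∀ k i, i + k = N → ∀ s', I i s' → s'.reg x = i →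
      (∀ y, y ≠ x → y ∉ p.regs → s'.reg y = s.reg y) → (∀ a, a ∉ p.arrs → s'.arr a = s.arr a) →
      ∃ s'' t, Exec (.loop (.sub (.reg b) (.reg x)) (.seq p (.assign x (.add (.reg x) (.lit 1)))))
        s' s'' t ∧ t ≤ k * (4 + (p.bound L + 4)) + 4 ∧ I N s'' := by
    intro k
    induction k with
    | zero =>
      intro i hi s' hIs hxi hreg harr
      have hbN : s'.reg b = N := by rw [hreg b hxb.symm hb, hN]
      refine ⟨s', _, .loop_done ?_, ?_, ?_⟩
      · simp [Expr.eval, hbN, hxi]; omega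
      · simp [Expr.cost]
      · rwa [← hi]
    | succ k ih =>
      intro i hi s' hIs hxi hreg harr
      have hbN : s'.reg b = N := by rw [hreg b hxb.symm hb, hN]
      obtain ⟨s₁, t₁, e₁, ht₁, hQ₁⟩ := hI i (by omega) s' hIs hxi hreg harr
      have hx1 : s₁.reg x = i := by rw [e₁.reg_eq hx, hxi]
      obtain ⟨s₂, t₂, e₂, ht₂, hQ₂⟩ := ih (i + 1) (by omega) (s₁.setReg x (i + 1)) hQ₁
        (by simp) (fun y hy hyp => by rw [Mem.setReg_reg, if_neg hy, e₁.reg_eq hyp, hreg y hy hyp])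
        (fun a ha => by rw [Mem.setReg_arr, e₁.arr_eq ha, harr a ha])
      have hass := Exec.assign s₁ x (.add (.reg x) (.lit 1))
      have hval : (Expr.add (.reg x) (.lit 1)).eval s₁ = i + 1 := by simp [Expr.eval, hx1]
      rw [hval] at hass
      refine ⟨s₂, _, .loop_step ?_ (.seq e₁ hass) e₂, ?_, hQ₂⟩
      · simp [Expr.eval, hbN, hxi]; omega
      · simp only [Expr.cost]
        rw [add_mul]
        omega
  obtain ⟨s'', t, h1, h2, h3⟩ := key N 0 (by omega) (s.setReg x 0) h0 (by simp)
    (fun y hy _ => by simp [hy]) (fun a _ => rfl)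
  refine ⟨s'', _, .seq (.assign s x (.lit 0)) h1, ?_, h3⟩
  have e : 1 + 1 + 1 + 1 + (p.bound L + (1 + 1 + 1 + 1)) = 4 + (p.bound L + 4) := by omega
  simp only [MCBI.forLoop, Prog.bound, Expr.cost, e]
  have := Nat.mul_le_mul_right (4 + (p.bound L + 4)) hNL
  omega

/-- A loop whose body transforms an abstract state. -/
theorem Wp.forLoop_foldl {α : Type*} {x b N : ℕ} (Rep : α → Mem → Prop) (step : ℕ → α → α) {A : α}
    (hN : s.reg b = N) (hNL : N ≤ L) (hxb : x ≠ b) (hx : x ∉ p.regs) (hb : b ∉ p.regs)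
    (hset : ∀ A s i, Rep A s → Rep A (s.setReg x i)) (h0 : Rep A s)
    (hstep : ∀ i < N, ∀ A s', Rep A s' → s'.reg x = i →
      (∀ y, y ≠ x → y ∉ p.regs → s'.reg y = s.reg y) → Wp L p (Rep (step i A)) s') :
    Wp L (MCBI.forLoop x b p)
      (Rep ((List.range N).foldl (fun A i => step i A) A)) s := by
  refine Wp.forLoop (fun i s => Rep ((List.range i).foldl (fun A i => step i A) A) s) hN hNL hxb hx
    hb (hset _ _ _ h0) fun i hi s' hs' hxi hreg _ => ?_
  refine (hstep i hi _ s' hs' hxi hreg).mono fun s'' hs'' => ?_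
  rw [List.range_succ, List.foldl_append]
  exact hset _ _ _ hs''

/-- Execute `p` if the values of all expressions in the list are nonzero. -/
def guarded (es : List Expr) (p : Prog) : Prog := es.foldr (fun e p => .ite e p .skip) p

theorem Wp.guarded {es : List Expr} (hp : (∀ e ∈ es, e.eval s ≠ 0) → Wp L p Q s)
    (hs : ¬ (∀ e ∈ es, e.eval s ≠ 0) → Q s) : Wp L (guarded es p) Q s := by
  induction es with
  | nil => exact hp (by simp)
  | cons e es ih =>
    refine Wp.ite (fun he => ih (fun h => hp ?_) (fun h => hs ?_)) (fun he => Wp.skip (hs ?_))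
    · simpa using ⟨he, h⟩
    · exact fun h' => h fun e' he' => h' e' (List.mem_cons_of_mem _ he')
    · exact fun h' => h' e List.mem_cons_self he

end Programs

/-! ## Gaussian elimination over `ℤ/2ℤ` -/

section Gauss

/-- The row with index `p` has its first nonzero entry at `p`. -/
def Echelon (m : ℕ) (piv : Finset ℕ) (rows : ℕ → ℕ → ZMod 2) : Prop :=
  ∀ p ∈ piv, rows p p = 1 ∧ (∀ j < p, rows p j = 0) ∧ ∀ j, m ≤ j → rows p j = 0

/-- The span of the rows. -/
def rowSpan (piv : Finset ℕ) (rows : ℕ → ℕ → ZMod 2) : Submodule (ZMod 2) (ℕ → ZMod 2) :=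
  Submodule.span (ZMod 2) (rows '' (piv : Set ℕ))

/-- The leading entry of a sum of distinct rows is at their smallest index, because all other rows
vanish up to there. So leading positions in the span are pivots. -/
theorem Echelon.notMem_rowSpan {m : ℕ} {piv : Finset ℕ} {rows : ℕ → ℕ → ZMod 2}
    (h : Echelon m piv rows) {v : ℕ → ZMod 2} {i : ℕ} (hi : v i ≠ 0) (h0 : ∀ j < i, v j = 0)
    (hp : i ∉ piv) : v ∉ rowSpan piv rows := by
  intro hv
  obtain ⟨Y, hY, hs⟩ := sum_mem_of_mem_sup_span (Submodule.mem_sup_right (S := ⊥) hv)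
  rw [Submodule.mem_bot, sub_eq_zero] at hs
  have hne : Y.Nonempty := by
    rw [Finset.nonempty_iff_ne_empty]
    rintro rfl
    rw [hs] at hi
    simp at hi
  have hq := Y.min'_mem hne
  set q := Y.min' hne with hqdef
  have hval : ∀ j ≤ q, v j = rows q j := by
    intro j hj
    rw [hs, Finset.sum_apply, Finset.sum_eq_single q]
    · intro p hpY hpq
      have hlt : q < p := lt_of_le_of_ne (Y.min'_le p hpY) (Ne.symm hpq)
      exact (h p (hY hpY)).2.1 j (by omega)
    · exact fun h' => absurd hq h'
  have hvq : v q = 1 := by rw [hval q le_rfl, (h q (hY hq)).1]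
  rcases lt_trichotomy q i with hlt | heq | hgt
  · rw [h0 q hlt] at hvq
    exact zero_ne_one hvq
  · exact hp (heq ▸ hY hq)
  · rw [hval i hgt.le, (h q (hY hq)).2.1 i hgt] at hi
    exact hi rfl

/-- Array `5` holds the vector `v`. -/
def HoldsVec (m : ℕ) (v : ℕ → ZMod 2) (s : Mem) : Prop := ∀ j < m, s.arr 5 j = (v j).val

/-- Array `6` holds the rows one after the other and array `7` the set of their indices. -/
def HoldsRows (m : ℕ) (piv : Finset ℕ) (rows : ℕ → ℕ → ZMod 2) (s : Mem) : Prop :=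
  (∀ p < m, s.arr 7 p = if p ∈ piv then 1 else 0) ∧ (∀ p ∈ piv, p < m) ∧
    ∀ p ∈ piv, ∀ j < m, s.arr 6 (p * m + j) = (rows p j).val

/-- The memory holds rows in echelon form that span `W`. -/
def HoldsSpan (m : ℕ) (W : Submodule (ZMod 2) (ℕ → ZMod 2)) (s : Mem) : Prop :=
  ∃ piv rows, Echelon m piv rows ∧ HoldsRows m piv rows s ∧ rowSpan piv rows = W

theorem HoldsSpan.congr {m : ℕ} {W : Submodule (ZMod 2) (ℕ → ZMod 2)} {s s' : Mem}
    (h : HoldsSpan m W s) (h6 : s'.arr 6 = s.arr 6) (h7 : s'.arr 7 = s.arr 7) :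
    HoldsSpan m W s' := by
  obtain ⟨piv, rows, h1, h2, h3⟩ := h
  refine ⟨piv, rows, h1, ?_, h3⟩
  rw [HoldsRows, h6, h7]
  exact h2

/-- The sum modulo two of two bits. -/
def xorExpr (e₁ e₂ : Expr) : Expr := .add (.sub e₁ e₂) (.sub e₂ e₁)

theorem val_add_eq (a b : ZMod 2) : a.val - b.val + (b.val - a.val) = (a + b).val := by
  revert a b; decide

/-- Add the row with index in register `9` to the vector. -/
def addRow : Prog :=
  forLoop 10 2 (.store 5 (.reg 10)
    (xorExpr (.get 5 (.reg 10)) (.get 6 (.add (.get 4 (.reg 9)) (.reg 10)))))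

/-- Store the vector as the row with index in register `9`. -/
def copyRow : Prog :=
  forLoop 10 2 (.store 6 (.add (.get 4 (.reg 9)) (.reg 10)) (.get 5 (.reg 10)))

/-- Reduce the vector to zero; if it is not in the span of the rows, then add a row and set
register `11` to `1`. -/
def insertVec : Prog :=
  .seq (.assign 11 (.lit 0)) (forLoop 9 2 (.ite (.get 5 (.reg 9))
    (.seq (.ite (.get 7 (.reg 9)) .skip
      (.seq copyRow (.seq (.store 7 (.reg 9) (.lit 1)) (.assign 11 (.lit 1))))) addRow) .skip))

variable {L m : ℕ} {s : Mem}

theorem wp_addRow (hL : m ≤ L) {v r : ℕ → ZMod 2} {i : ℕ} (hm : s.reg 2 = m) (hi : s.reg 9 = i)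
    (h4 : s.arr 4 i = i * m) (hv : HoldsVec m v s)
    (hr : ∀ j < m, s.arr 6 (i * m + j) = (r j).val) :
    Wp L addRow (HoldsVec m (v + r)) s := by
  refine (Wp.forLoop (N := m) (fun k s => ∀ j < m, s.arr 5 j =
    if j < k then (v j + r j).val else (v j).val) hm hL (by decide) (by decide) (by decide)
    ?_ ?_).mono ?_
  · intro j hj
    simpa using hv j hj
  · intro k hk s' hs' hx hreg harr
    have e4 : s'.arr 4 = s.arr 4 := harr 4 (by decide)
    have e6 : s'.arr 6 = s.arr 6 := harr 6 (by decide)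
    have e9 : s'.reg 9 = i := by rw [hreg 9 (by decide) (by decide), hi]
    refine Wp.store ?_
    intro j hj
    simp only [Mem.setReg_arr, Mem.setArr_arr_self, Expr.eval, xorExpr, hx, e4, e6, e9, h4, hr k hk,
      hs' k hk, lt_irrefl, if_false, val_add_eq]
    by_cases hjk : j = k
    · simp [hjk]
    · rw [if_neg hjk, hs' j hj]
      have : j < k ↔ j < k + 1 := by omega
      simp only [this]
  · intro s' hs' j hj
    rw [hs' j hj, if_pos hj]
    rfl

theorem eq_of_mul_add_eq {p q m a b : ℕ} (ha : a < m) (hb : b < m) (h : p * m + a = q * m + b) :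
    p = q ∧ a = b := by
  have hm : 0 < m := by omega
  have h1 : (p * m + a) / m = p := by
    rw [mul_comm, Nat.mul_add_div hm, Nat.div_eq_of_lt ha, add_zero]
  have h2 : (q * m + b) / m = q := by
    rw [mul_comm, Nat.mul_add_div hm, Nat.div_eq_of_lt hb, add_zero]
  have : p = q := by rw [← h1, h, h2]
  subst this
  exact ⟨rfl, by omega⟩

theorem wp_copyRow (hL : m ≤ L) {v : ℕ → ZMod 2} {i : ℕ} (hm : s.reg 2 = m) (hi : s.reg 9 = i)
    (h4 : s.arr 4 i = i * m) (hv : HoldsVec m v s) :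
    Wp L copyRow (fun s' => ∀ p, ∀ j < m, s'.arr 6 (p * m + j) =
      if p = i then (v j).val else s.arr 6 (p * m + j)) s := by
  refine (Wp.forLoop (N := m) (fun k s' => ∀ p, ∀ j < m, s'.arr 6 (p * m + j) =
    if p = i ∧ j < k then (v j).val else s.arr 6 (p * m + j)) hm hL (by decide) (by decide)
    (by decide) ?_ ?_).mono ?_
  · intro p j hj
    simp
  · intro k hk s' hs' hx hreg harr
    have e4 : s'.arr 4 = s.arr 4 := harr 4 (by decide)
    have e5 : s'.arr 5 = s.arr 5 := harr 5 (by decide)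
    have e9 : s'.reg 9 = i := by rw [hreg 9 (by decide) (by decide), hi]
    refine Wp.store ?_
    intro p j hj
    simp only [Mem.setReg_arr, Mem.setArr_arr_self, Expr.eval, hx, e4, e5, e9, h4]
    by_cases hjk : p = i ∧ j = k
    · rw [if_pos (by rw [hjk.1, hjk.2]), if_pos ⟨hjk.1, by omega⟩, hjk.2]
      exact hv k hk
    · rw [if_neg (fun h => hjk (eq_of_mul_add_eq hj hk h)), hs' p j hj]
      have : (p = i ∧ j < k) ↔ (p = i ∧ j < k + 1) := by
        constructor
        · exact fun h => ⟨h.1, by omega⟩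
        · exact fun h => ⟨h.1, by have : j ≠ k := fun h' => hjk ⟨h.1, h'⟩; omega⟩
      simp only [this]
  · intro s' hs' p j hj
    rw [hs' p j hj]
    simp only [hj, and_true]

/-- Storing the reduced vector in place of the original one yields the same span. -/
theorem sup_span_singleton_eq {W : Submodule (ZMod 2) (ℕ → ZMod 2)} {v v' : ℕ → ZMod 2}
    (h : v - v' ∈ W) : W ⊔ Submodule.span (ZMod 2) {v'} = W ⊔ Submodule.span (ZMod 2) {v} := by
  refine le_antisymm (sup_le le_sup_left ?_) (sup_le le_sup_left ?_) <;>
    rw [Submodule.span_singleton_le_iff_mem]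
  · have := sub_mem (Submodule.mem_sup_right (S := W) (Submodule.mem_span_singleton_self v))
      (Submodule.mem_sup_left (T := Submodule.span (ZMod 2) {v}) h)
    simpa using this
  · have := add_mem (Submodule.mem_sup_right (S := W) (Submodule.mem_span_singleton_self v'))
      (Submodule.mem_sup_left (T := Submodule.span (ZMod 2) {v'}) h)
    simpa using this

open Classical in
theorem wp_insertVec (hL : m ≤ L) {v : ℕ → ZMod 2} {W : Submodule (ZMod 2) (ℕ → ZMod 2)}
    (hm : s.reg 2 = m) (h4 : ∀ p < m, s.arr 4 p = p * m) (hv : HoldsVec m v s)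
    (hv0 : ∀ j, m ≤ j → v j = 0) (hW : HoldsSpan m W s) :
    Wp L insertVec (fun s' => HoldsVec m 0 s' ∧ s'.reg 11 = (if v ∈ W then 0 else 1) ∧
      HoldsSpan m (W ⊔ Submodule.span (ZMod 2) {v}) s') s := by
  have h01 : ∀ a : ZMod 2, a.val ≠ 0 → a = 1 := by decide
  refine Wp.seq (Wp.assign ?_)
  -- `v'` is what is left of `v`. Either no row has been stored yet and `v'` is congruent to `v`
  -- modulo `W`; or a row has been stored and then added to itself, so that `v'` is zero and the
  -- remaining iterations do nothing.
  refine (Wp.forLoop (N := m) (fun i s => ∃ v', HoldsVec m v' s ∧ (∀ j < i, v' j = 0) ∧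
    (∀ j, m ≤ j → v' j = 0) ∧ ((s.reg 11 = 0 ∧ HoldsSpan m W s ∧ v - v' ∈ W) ∨
      (s.reg 11 = 1 ∧ v' = 0 ∧ v ∉ W ∧ HoldsSpan m (W ⊔ Submodule.span (ZMod 2) {v}) s)))
    (by simpa using hm) hL (by decide) (by decide) (by decide) ?_ ?_).mono ?_
  · exact ⟨v, hv, by simp, hv0, Or.inl ⟨by simp [Expr.eval], hW, by simp⟩⟩
  · rintro i hi s' ⟨v', hv', hlow, hhigh, hcase⟩ hx hreg harr
    have e4 : s'.arr 4 = s.arr 4 := harr 4 (by decide)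
    have e2 : s'.reg 2 = m := by rw [hreg 2 (by decide) (by decide)]; simpa using hm
    refine Wp.ite (fun hne => ?_) (fun he => Wp.skip ?_)
    · have hvi : v' i = 1 := h01 _ (by
        rw [← hv' i hi]
        simpa [Expr.eval, hx] using hne)
      refine Wp.seq ?_
      -- After this step there is a row with index `i` in either case, so the addition that follows
      -- clears entry `i`.
      have hmid : Wp L (.ite (.get 7 (.reg 9)) .skip
          (.seq copyRow (.seq (.store 7 (.reg 9) (.lit 1)) (.assign 11 (.lit 1)))))
          (fun s'' => ∃ piv rows, Echelon m piv rows ∧ HoldsRows m piv rows s'' ∧ i ∈ piv ∧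
            HoldsVec m v' s'' ∧ ((s''.reg 11 = 0 ∧ rowSpan piv rows = W ∧ v - v' ∈ W) ∨
            (s''.reg 11 = 1 ∧ rows i = v' ∧ v ∉ W ∧
              rowSpan piv rows = W ⊔ Submodule.span (ZMod 2) {v}))) s' := by
        have hcase' : s'.reg 11 = 0 ∧ HoldsSpan m W s' ∧ v - v' ∈ W := by
          refine hcase.resolve_right fun h => ?_
          rw [h.2.1] at hvi
          exact zero_ne_one hvi
        obtain ⟨h11, ⟨piv, rows, hE, hR, hS⟩, hvv⟩ := hcase'
        refine Wp.ite (fun hne => Wp.skip ?_) (fun he => Wp.seq ?_)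
        · have hip : i ∈ piv := by
            by_contra hip
            refine hne ?_
            simp [Expr.eval, hx, hR.1 i hi, hip]
          exact ⟨piv, rows, hE, hR, hip, hv', Or.inl ⟨h11, hS, hvv⟩⟩
        · have hip : i ∉ piv := by
            intro hip
            simp [Expr.eval, hx, hR.1 i hi, hip] at he
          refine (wp_copyRow hL e2 hx (by rw [e4]; exact h4 i hi) hv').frame
            fun s₂ h6 hreg₂ harr₂ => Wp.seq (Wp.store (Wp.assign ?_))
          have e9 : s₂.reg 9 = i := by rw [hreg₂ 9 (by decide), hx]
          have e7 : s₂.arr 7 = s'.arr 7 := harr₂ 7 (by decide)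
          have e5 : s₂.arr 5 = s'.arr 5 := harr₂ 5 (by decide)
          have hv'W : v' ∉ W := by
            rw [← hS]
            exact hE.notMem_rowSpan (by rw [hvi]; exact one_ne_zero) hlow hip
          have hother : ∀ p ∈ piv, Function.update rows i v' p = rows p := fun p hp =>
            Function.update_of_ne (ne_of_mem_of_not_mem hp hip) _ _
          refine ⟨insert i piv, Function.update rows i v', ?_, ⟨?_, ?_, ?_⟩,
            Finset.mem_insert_self _ _, ?_, Or.inr ⟨by simp [Expr.eval], by simp, ?_, ?_⟩⟩
          · intro p hp
            rcases Finset.mem_insert.1 hp with rfl | hp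
            · simpa using ⟨hvi, hlow, hhigh⟩
            · rw [hother p hp]; exact hE p hp
          · intro p hp
            simp only [Mem.setReg_arr, Mem.setArr_arr_self, Expr.eval, e9, e7, hR.1 p hp,
              Finset.mem_insert]
            by_cases h : p = i <;> simp [h]
          · intro p hp
            rcases Finset.mem_insert.1 hp with rfl | hp
            · exact hi
            · exact hR.2.1 p hp
          · intro p hp j hj
            rw [Mem.setReg_arr, Mem.setArr_arr_of_ne _ _ _ (by decide), h6 p j hj]
            by_cases h : p = i
            · simp [h]
            · have hp' := (Finset.mem_insert.1 hp).resolve_left h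
              rw [if_neg h, hother p hp', hR.2.2 p hp' j hj]
          · intro j hj
            rw [Mem.setReg_arr, Mem.setArr_arr_of_ne _ _ _ (by decide), e5]
            exact hv' j hj
          · intro hvW
            refine hv'W ?_
            simpa using sub_mem hvW hvv
          · rw [← sup_span_singleton_eq hvv, rowSpan, Finset.coe_insert, Set.image_insert_eq,
              Submodule.span_insert, sup_comm, Function.update_self, ← hS, rowSpan]
            congr 2
            exact Set.image_congr hother
      refine hmid.frame ?_
      rintro s₁ ⟨piv, rows, hE, hR, hip, hv₁, hc⟩ hreg₁ harr₁
      refine (wp_addRow hL (by rw [hreg₁ 2 (by decide), e2]) (by rw [hreg₁ 9 (by decide), hx])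
        (by rw [harr₁ 4 (by decide), e4]; exact h4 i hi) hv₁ (hR.2.2 i hip)).frame ?_
      intro s₂ hs₂ hreg₂ harr₂
      have hspan : ∀ W', rowSpan piv rows = W' → HoldsSpan m W' (s₂.setReg 9 (i + 1)) :=
        fun W' hW' => HoldsSpan.congr (s := s₁) ⟨piv, rows, hE, hR, hW'⟩
          (harr₂ 6 (by decide)) (harr₂ 7 (by decide))
      have e11 : (s₂.setReg 9 (i + 1)).reg 11 = s₁.reg 11 := by
        rw [Mem.setReg_reg, if_neg (by decide), hreg₂ 11 (by decide)]
      have h11 : (1 : ZMod 2) + 1 = 0 := by decide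
      refine ⟨v' + rows i, hs₂, ?_, ?_, ?_⟩
      · intro j hj
        rcases Nat.lt_succ_iff_lt_or_eq.1 hj with hj | rfl
        · simp [hlow j hj, (hE i hip).2.1 j hj]
        · rw [Pi.add_apply, hvi, (hE j hip).1, h11]
      · intro j hj
        simp [hhigh j hj, (hE i hip).2.2 j hj]
      · rw [e11]
        rcases hc with ⟨c1, c2, c3⟩ | ⟨c1, c2, c3, c4⟩
        · refine Or.inl ⟨c1, hspan _ c2, ?_⟩
          rw [← sub_sub]
          exact sub_mem c3 (c2 ▸ Submodule.subset_span ⟨i, hip, rfl⟩)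
        · refine Or.inr ⟨c1, ?_, c3, hspan _ c4⟩
          ext j
          rw [c2, Pi.add_apply, ← two_mul, show (2 : ZMod 2) = 0 by decide, zero_mul]
          rfl
    · have hvi : v' i = 0 := by
        rw [← ZMod.val_eq_zero, ← hv' i hi]
        simpa [Expr.eval, hx] using he
      refine ⟨v', hv', fun j hj => ?_, hhigh, ?_⟩
      · rcases Nat.lt_succ_iff_lt_or_eq.1 hj with hj | rfl
        · exact hlow j hj
        · exact hvi
      · exact hcase
  · rintro s' ⟨v', hv', hlow, hhigh, hcase⟩
    have h0 : v' = 0 := by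
      ext j
      rcases lt_or_ge j m with hj | hj
      · exact hlow j hj
      · exact hhigh j hj
    subst h0
    refine ⟨hv', ?_⟩
    rcases hcase with ⟨c1, c2, c3⟩ | ⟨c1, -, c3, c4⟩
    · rw [sub_zero] at c3
      rw [if_pos c3, sup_eq_left.2 ((Submodule.span_singleton_le_iff_mem _ _).2 c3)]
      exact ⟨c1, c2⟩
    · rw [if_neg c3]
      exact ⟨c1, c4⟩

end Gauss

/-! ## Enumeration of closed walks -/

section Walks

/-- The matrix of the edge between `a` and `b` as a vector; zero if `a = b`. -/
def pairVec (n a b : ℕ) : ℕ → ZMod 2 := Pi.single (a * n + b) 1 + Pi.single (b * n + a) 1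

/-- The sum of the edges of a closed walk. -/
def walkVec (n a b c d : ℕ) : ℕ → ZMod 2 :=
  pairVec n a b + pairVec n b c + pairVec n c d + pairVec n d a

/-- A vector as a word, in the format of `encodeGraph`. -/
def encodeVec (n : ℕ) (v : ℕ → ZMod 2) : List ℕ := n :: (List.range (n * n)).map fun j => (v j).val

/-- The entry of the matrix in array `a` whose row and column are in the registers `u`, `v`. -/
def entry (a u v : ℕ) : Expr := .get a (.add (.get 3 (.reg u)) (.reg v))

/-- Flip an entry of the vector. -/
def flip (u v : ℕ) : Prog :=
  .store 5 (.add (.get 3 (.reg u)) (.reg v)) (.sub (.lit 1) (entry 5 u v))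

/-- Add an edge to the vector. -/
def flipPair (u v : ℕ) : Prog := .seq (flip u v) (flip v u)

/-- Add the edges of a closed walk to the vector. -/
def flipWalk (a b c d : ℕ) : Prog :=
  .seq (flipPair a b) (.seq (flipPair b c) (.seq (flipPair c d) (flipPair d a)))

/-- Write the vector behind the end of the output. -/
def emit : Prog :=
  .seq (.store 1 (.add (.reg 12) (.lit 1)) (.reg 1))
    (forLoop 10 2 (.store 1 (.add (.add (.reg 12) (.reg 10)) (.lit 2)) (.get 5 (.reg 10))))

/-- Insert a closed walk into the rows; if `out` holds and it is not spanned by the previous rows,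
then it becomes part of the output. -/
def processWalk (out : Bool) (a b c d : ℕ) : Prog :=
  .seq (flipWalk a b c d) (.seq emit (.seq insertVec
    (.ite (if out then .reg 11 else .lit 0)
      (.seq (.assign 12 (.add (.reg 12) (.add (.reg 2) (.lit 1))))
        (.assign 13 (.add (.reg 13) (.lit 1)))) .skip)))

/-- The tables and matrices that the enumeration uses: numbers of vertices and of matrix entries,
multiples of these numbers, and two matrices whose nonzero entries are given by `g` and `h`. -/
structure Env (n : ℕ) (g h : ℕ → Prop) (s : Mem) : Prop where
  vertices : s.reg 1 = n
  entries : s.reg 2 = n * n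
  rowStart : ∀ u < n, s.arr 3 u = u * n
  vecStart : ∀ p < n * n, s.arr 4 p = p * (n * n)
  fst_matrix : ∀ j < n * n, s.arr 2 j ≠ 0 ↔ g j
  snd_matrix : ∀ j < n * n, s.arr 8 j ≠ 0 ↔ h j

/-- The output consists of the vectors `outs`. -/
def HoldsOut (n : ℕ) (outs : List (ℕ → ZMod 2)) (s : Mem) : Prop :=
  s.reg 13 = outs.length ∧
    (List.range (s.reg 12)).map (fun i => s.arr 1 (i + 1)) = outs.flatMap (encodeVec n)

/-- A span and a list of output vectors. -/
abbrev ElimState := Submodule (ZMod 2) (ℕ → ZMod 2) × List (ℕ → ZMod 2)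

/-- The memory represents the state `A`. -/
def Represents (n : ℕ) (g h : ℕ → Prop) (A : ElimState) (s : Mem) : Prop :=
  Env n g h s ∧ HoldsVec (n * n) 0 s ∧ HoldsSpan (n * n) A.1 s ∧ HoldsOut n A.2 s

open Classical in
/-- Insert a vector. -/
noncomputable def addVec (out : Bool) (v : ℕ → ZMod 2) (A : ElimState) : ElimState :=
  if v ∈ A.1 then A else
    (A.1 ⊔ Submodule.span (ZMod 2) {v}, if out then A.2 ++ [v] else A.2)

variable {L n : ℕ} {g h : ℕ → Prop} {s s' : Mem} {A : ElimState}

theorem Env.congr (hE : Env n g h s) (h1 : s'.reg 1 = s.reg 1) (h2 : s'.reg 2 = s.reg 2)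
    (a2 : s'.arr 2 = s.arr 2) (a3 : s'.arr 3 = s.arr 3) (a4 : s'.arr 4 = s.arr 4)
    (a8 : s'.arr 8 = s.arr 8) : Env n g h s' :=
  ⟨by rw [h1, hE.vertices], by rw [h2, hE.entries], by rw [a3]; exact hE.rowStart,
    by rw [a4]; exact hE.vecStart, by rw [a2]; exact hE.fst_matrix,
    by rw [a8]; exact hE.snd_matrix⟩

theorem Represents.setReg (hA : Represents n g h A s) {x : ℕ} (v : ℕ)
    (hx : x ∉ [1, 2, 12, 13]) : Represents n g h A (s.setReg x v) := by
  simp only [List.mem_cons, List.not_mem_nil, or_false, not_or] at hx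
  obtain ⟨x1, x2, x3, x4⟩ := hx
  obtain ⟨h1, h2, h3, h4⟩ := hA
  refine ⟨h1.congr ?_ ?_ rfl rfl rfl rfl, h2, h3.congr rfl rfl, ?_⟩
  · rw [Mem.setReg_reg, if_neg (Ne.symm x1)]
  · rw [Mem.setReg_reg, if_neg (Ne.symm x2)]
  · rw [HoldsOut, Mem.setReg_reg, Mem.setReg_reg, if_neg (Ne.symm x3), if_neg (Ne.symm x4)]
    exact h4

theorem mul_add_lt {n a b : ℕ} (ha : a < n) (hb : b < n) : a * n + b < n * n := by
  have := Nat.mul_le_mul_right n (Nat.succ_le_of_lt ha)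
  rw [Nat.succ_mul] at this
  omega

theorem eval_entry (hE : Env n g h s) (k : ℕ) {u v a b : ℕ} (hu : s.reg u = a) (hv : s.reg v = b)
    (ha : a < n) : (entry k u v).eval s = s.arr k (a * n + b) := by
  simp [entry, Expr.eval, hu, hv, hE.rowStart a ha]

theorem one_sub_val (a : ZMod 2) : 1 - a.val = (a + 1).val := by
  revert a; decide

/-- The memory holds a vector in addition to a state. -/
def RepresentsVec (n : ℕ) (g h : ℕ → Prop) (A : ElimState) (v : ℕ → ZMod 2) (r : ℕ → ℕ)
    (s : Mem) : Prop :=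
  Env n g h s ∧ HoldsVec (n * n) v s ∧ HoldsSpan (n * n) A.1 s ∧ HoldsOut n A.2 s ∧ s.reg = r

theorem wp_flip {u v a b : ℕ} {w : ℕ → ZMod 2} {r : ℕ → ℕ} (hu : r u = a) (hv : r v = b)
    (ha : a < n) (hA : RepresentsVec n g h A w r s) :
    Wp L (flip u v) (RepresentsVec n g h A (w + Pi.single (a * n + b) 1) r) s := by
  obtain ⟨h1, h2, h3, h4, h5⟩ := hA
  rw [← h5] at hu hv
  refine Wp.store ⟨h1.congr rfl rfl ?_ ?_ ?_ ?_, ?_, h3.congr ?_ ?_, ⟨h4.1, ?_⟩, h5⟩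
  all_goals try exact Mem.setArr_arr_of_ne _ _ _ (by decide)
  · intro j hj
    simp only [Mem.setArr_arr_self, Expr.eval, hu, hv, eval_entry h1 5 hu hv ha,
      h1.rowStart a ha]
    by_cases hjk : j = a * n + b
    · rw [if_pos hjk, ← hjk, h2 j hj, Pi.add_apply, Pi.single_eq_same, one_sub_val]
    · rw [if_neg hjk, h2 j hj, Pi.add_apply, Pi.single_eq_of_ne hjk, add_zero]
  · rw [Mem.setArr_arr_of_ne _ _ _ (by decide)]
    exact h4.2

theorem wp_flipPair {u v a b : ℕ} {w : ℕ → ZMod 2} {r : ℕ → ℕ} (hu : r u = a) (hv : r v = b)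
    (ha : a < n) (hb : b < n) (hA : RepresentsVec n g h A w r s) :
    Wp L (flipPair u v) (RepresentsVec n g h A (w + pairVec n a b) r) s := by
  refine Wp.seq ((wp_flip hu hv ha hA).mono fun s' hs' => ?_)
  rw [pairVec, ← add_assoc]
  exact wp_flip hv hu hb hs'

theorem wp_flipWalk {a b c d x y z t : ℕ} {r : ℕ → ℕ} (ha : r a = x) (hb : r b = y) (hc : r c = z)
    (hd : r d = t) (hx : x < n) (hy : y < n) (hz : z < n) (ht : t < n)
    (hA : RepresentsVec n g h A 0 r s) :
    Wp L (flipWalk a b c d) (RepresentsVec n g h A (walkVec n x y z t) r) s := by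
  refine Wp.seq ((wp_flipPair ha hb hx hy hA).mono fun s₁ h₁ => ?_)
  refine Wp.seq ((wp_flipPair hb hc hy hz h₁).mono fun s₂ h₂ => ?_)
  refine Wp.seq ((wp_flipPair hc hd hz ht h₂).mono fun s₃ h₃ => ?_)
  rw [zero_add] at h₃
  exact wp_flipPair hd ha ht hx h₃

theorem pairVec_apply_of_le {a b : ℕ} (ha : a < n) (hb : b < n) {j : ℕ} (hj : n * n ≤ j) :
    pairVec n a b j = 0 := by
  have h1 := mul_add_lt ha hb
  have h2 := mul_add_lt hb ha
  rw [pairVec, Pi.add_apply, Pi.single_eq_of_ne (by omega), Pi.single_eq_of_ne (by omega), add_zero]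

theorem walkVec_apply_of_le {a b c d : ℕ} (ha : a < n) (hb : b < n) (hc : c < n) (hd : d < n)
    {j : ℕ} (hj : n * n ≤ j) : walkVec n a b c d j = 0 := by
  simp [walkVec, pairVec_apply_of_le, *]

/-- Addresses are shifted by one since cell `0` of array `1` is reserved for the first letter of the
output. Register `12` is not advanced, so the vector is not yet part of the output. -/
theorem wp_emit (hL : n * n ≤ L) {v : ℕ → ZMod 2} (h1 : s.reg 1 = n) (h2 : s.reg 2 = n * n)
    (hv : HoldsVec (n * n) v s) :
    Wp L emit (fun s' => (∀ i < s.reg 12, s'.arr 1 (i + 1) = s.arr 1 (i + 1)) ∧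
      s'.arr 1 (s.reg 12 + 1) = n ∧
      ∀ j < n * n, s'.arr 1 (s.reg 12 + 1 + j + 1) = (v j).val) s := by
  refine Wp.seq (Wp.store ?_)
  refine (Wp.forLoop (N := n * n) (fun k s' =>
    (∀ i < s.reg 12, s'.arr 1 (i + 1) = s.arr 1 (i + 1)) ∧ s'.arr 1 (s.reg 12 + 1) = n ∧
      ∀ j < k, s'.arr 1 (s.reg 12 + 1 + j + 1) = (v j).val) h2 hL (by decide) (by decide)
      (by decide) ⟨?_, ?_, by simp⟩ ?_)
  · intro i hi
    simp only [Mem.setReg_arr, Mem.setArr_arr_self, Expr.eval]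
    rw [if_neg (by omega)]
  · simp [Expr.eval, h1]
  · rintro k hk s' ⟨k1, k2, k3⟩ hx hreg harr
    have e5 : s'.arr 5 = s.arr 5 := by
      rw [harr 5 (by decide), Mem.setArr_arr_of_ne _ _ _ (by decide)]
    have e12 : s'.reg 12 = s.reg 12 := hreg 12 (by decide) (by decide)
    refine Wp.store ?_
    simp only [Mem.setReg_arr, Mem.setArr_arr_self, Expr.eval, e5, e12, hx, hv k hk]
    refine ⟨fun i hi => ?_, ?_, fun j hj => ?_⟩
    · rw [if_neg (by omega), k1 i hi]
    · rw [if_neg (by omega), k2]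
    · by_cases hjk : j = k
      · rw [if_pos (by omega), hjk]
      · rw [if_neg (by omega), k3 j (by omega)]

open Classical in
theorem wp_processWalk (hL : n * n ≤ L) (out : Bool) {a b c d x y z t : ℕ} (ha : s.reg a = x)
    (hb : s.reg b = y) (hc : s.reg c = z) (hd : s.reg d = t) (hx : x < n) (hy : y < n)
    (hz : z < n) (ht : t < n) (hA : Represents n g h A s) :
    Wp L (processWalk out a b c d) (Represents n g h (addVec out (walkVec n x y z t) A)) s := by
  obtain ⟨h1, h2, h3, h4⟩ := hA
  refine Wp.seq ((wp_flipWalk ha hb hc hd hx hy hz ht ⟨h1, h2, h3, h4, rfl⟩).mono ?_)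
  rintro s₁ ⟨i1, i2, i3, i4, i5⟩
  set v := walkVec n x y z t with hvdef
  -- The vector has to be written before the insertion, which reduces it to zero.
  refine Wp.seq ((wp_emit hL i1.vertices i1.entries i2).frame ?_)
  rintro s₂ ⟨j1, j2, j3⟩ hreg₂ harr₂
  have E₂ : Env n g h s₂ := i1.congr (hreg₂ 1 (by decide)) (hreg₂ 2 (by decide))
    (harr₂ 2 (by decide)) (harr₂ 3 (by decide)) (harr₂ 4 (by decide)) (harr₂ 8 (by decide))
  have V₂ : HoldsVec (n * n) v s₂ := by
    rw [HoldsVec, harr₂ 5 (by decide)]; exact i2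
  have e12 : s₂.reg 12 = s₁.reg 12 := hreg₂ 12 (by decide)
  have e13 : s₂.reg 13 = s₁.reg 13 := hreg₂ 13 (by decide)
  refine Wp.seq ((wp_insertVec hL E₂.entries E₂.vecStart V₂
    (fun j hj => walkVec_apply_of_le hx hy hz ht hj)
    (i3.congr (harr₂ 6 (by decide)) (harr₂ 7 (by decide)))).frame ?_)
  rintro s₃ ⟨k1, k2, k3⟩ hreg₃ harr₃
  have E₃ : Env n g h s₃ := E₂.congr (hreg₃ 1 (by decide)) (hreg₃ 2 (by decide))
    (harr₃ 2 (by decide)) (harr₃ 3 (by decide)) (harr₃ 4 (by decide)) (harr₃ 8 (by decide))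
  have O₃ : HoldsOut n A.2 s₃ := by
    refine ⟨by rw [hreg₃ 13 (by decide), e13]; exact i4.1, ?_⟩
    rw [hreg₃ 12 (by decide), e12, harr₃ 1 (by decide), ← i4.2]
    exact List.map_congr_left fun i hi => j1 i (List.mem_range.1 hi)
  -- Advancing register `12` past the letter `n` and the `n * n` entries makes the vector part of
  -- the output.
  have O₃' : ∀ s₄ : Mem, s₄.arr 1 = s₃.arr 1 → s₄.reg 12 = s₃.reg 12 + (n * n + 1) →
      s₄.reg 13 = s₃.reg 13 + 1 → HoldsOut n (A.2 ++ [v]) s₄ := by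
    intro s₄ a1 r12 r13
    refine ⟨by rw [r13, O₃.1]; simp, ?_⟩
    rw [r12, a1, List.range_add, List.map_append, O₃.2, List.flatMap_append, List.flatMap_singleton,
      encodeVec, List.range_succ_eq_map]
    simp only [List.map_cons, List.map_map]
    rw [hreg₃ 12 (by decide), e12, harr₃ 1 (by decide), add_zero, j2]
    congr 2
    refine List.map_congr_left fun j hj => ?_
    rw [← j3 j (List.mem_range.1 hj)]
    simp only [Function.comp_apply]
    congr 1
    omega
  by_cases hv : v ∈ A.1
  · rw [if_pos hv] at k2
    have hadd : addVec out v A = A := if_pos hv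
    rw [hadd]
    rw [sup_eq_left.2 ((Submodule.span_singleton_le_iff_mem _ _).2 hv)] at k3
    refine Wp.ite (fun hne => absurd ?_ hne) (fun _ => Wp.skip ⟨E₃, k1, k3, O₃⟩)
    cases out <;> simp [Expr.eval, k2]
  · rw [if_neg hv] at k2
    have hadd : addVec out v A =
        (A.1 ⊔ Submodule.span (ZMod 2) {v}, if out then A.2 ++ [v] else A.2) := if_neg hv
    rw [hadd]
    cases out with
    | false =>
      exact Wp.ite (fun hne => absurd (by simp [Expr.eval]) hne)
        (fun _ => Wp.skip ⟨E₃, k1, k3, O₃⟩)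
    | true =>
      refine Wp.ite (fun _ => Wp.seq (Wp.assign (Wp.assign ?_)))
        (fun he => absurd he (by simp [Expr.eval, k2]))
      refine ⟨E₃.congr (by simp) (by simp) rfl rfl rfl rfl, k1, k3.congr rfl rfl,
        O₃' _ rfl ?_ ?_⟩
      · simp [Expr.eval, E₃.entries]
      · simp [Expr.eval]

/-- Execute `p` for all values of the registers `4`, …, `8` below the value of register `1`. -/
def forTuples (p : Prog) : Prog :=
  forLoop 4 1 (forLoop 5 1 (forLoop 6 1 (forLoop 7 1 (forLoop 8 1 p))))

/-- Transform a state for all tuples of numbers below `n`. -/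
def foldTuples {α : Type*} (n : ℕ) (step : ℕ → ℕ → ℕ → ℕ → ℕ → α → α) (A : α) : α :=
  (List.range n).foldl (fun A a => (List.range n).foldl (fun A b => (List.range n).foldl
    (fun A c => (List.range n).foldl (fun A d => (List.range n).foldl
      (fun A e => step a b c d e A) A) A) A) A) A

theorem wp_forTuples {p : Prog} {α : Type*} (Rep : α → Mem → Prop)
    (step : ℕ → ℕ → ℕ → ℕ → ℕ → α → α) {A : α} (hn : s.reg 1 = n) (hL : n ≤ L)
    (hp : ∀ x ∈ [1, 4, 5, 6, 7, 8], x ∉ p.regs)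
    (hset : ∀ A s i, ∀ x ∈ [4, 5, 6, 7, 8], Rep A s → Rep A (s.setReg x i)) (h0 : Rep A s)
    (hstep : ∀ a < n, ∀ b < n, ∀ c < n, ∀ d < n, ∀ e < n, ∀ A s, Rep A s → s.reg 4 = a →
      s.reg 5 = b → s.reg 6 = c → s.reg 7 = d → s.reg 8 = e →
      Wp L p (Rep (step a b c d e A)) s) :
    Wp L (forTuples p) (Rep (foldTuples n step A)) s := by
  have p1 := hp 1 (by simp)
  have p4 := hp 4 (by simp)
  have p5 := hp 5 (by simp)
  have p6 := hp 6 (by simp)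
  have p7 := hp 7 (by simp)
  have p8 := hp 8 (by simp)
  refine Wp.forLoop_foldl Rep _ hn hL (by decide) (by simp [forLoop, Prog.regs, p4])
    (by simp [forLoop, Prog.regs, p1]) (fun A s i => hset A s i 4 (by simp)) h0 ?_
  intro a ha A s₁ h₁ r4 f₁
  have n1 : s₁.reg 1 = n := by
    rw [f₁ 1 (by decide) (by simp [forLoop, Prog.regs, p1]), hn]
  refine Wp.forLoop_foldl Rep _ n1 hL (by decide) (by simp [forLoop, Prog.regs, p5])
    (by simp [forLoop, Prog.regs, p1]) (fun A s i => hset A s i 5 (by simp)) h₁ ?_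
  intro b hb A s₂ h₂ r5 f₂
  have n2 : s₂.reg 1 = n := by
    rw [f₂ 1 (by decide) (by simp [forLoop, Prog.regs, p1]), n1]
  have r4 : s₂.reg 4 = a := by
    rw [f₂ 4 (by decide) (by simp [forLoop, Prog.regs, p4]), r4]
  refine Wp.forLoop_foldl Rep _ n2 hL (by decide) (by simp [forLoop, Prog.regs, p6])
    (by simp [forLoop, Prog.regs, p1]) (fun A s i => hset A s i 6 (by simp)) h₂ ?_
  intro c hc A s₃ h₃ r6 f₃
  have n3 : s₃.reg 1 = n := by
    rw [f₃ 1 (by decide) (by simp [forLoop, Prog.regs, p1]), n2]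
  have r4 : s₃.reg 4 = a := by
    rw [f₃ 4 (by decide) (by simp [forLoop, Prog.regs, p4]), r4]
  have r5 : s₃.reg 5 = b := by
    rw [f₃ 5 (by decide) (by simp [forLoop, Prog.regs, p5]), r5]
  refine Wp.forLoop_foldl Rep _ n3 hL (by decide) (by simp [forLoop, Prog.regs, p7])
    (by simp [forLoop, Prog.regs, p1]) (fun A s i => hset A s i 7 (by simp)) h₃ ?_
  intro d hd A s₄ h₄ r7 f₄
  have n4 : s₄.reg 1 = n := by
    rw [f₄ 1 (by decide) (by simp [forLoop, Prog.regs, p1]), n3]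
  have r4 : s₄.reg 4 = a := by
    rw [f₄ 4 (by decide) (by simp [forLoop, Prog.regs, p4]), r4]
  have r5 : s₄.reg 5 = b := by
    rw [f₄ 5 (by decide) (by simp [forLoop, Prog.regs, p5]), r5]
  have r6 : s₄.reg 6 = c := by
    rw [f₄ 6 (by decide) (by simp [forLoop, Prog.regs, p6]), r6]
  refine Wp.forLoop_foldl Rep _ n4 hL (by decide) p8 p1
    (fun A s i => hset A s i 8 (by simp)) h₄ ?_
  intro e he A s₅ h₅ r8 f₅
  exact hstep a ha b hb c hc d hd e he A s₅ h₅ (by rw [f₅ 4 (by decide) p4, r4])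
    (by rw [f₅ 5 (by decide) p5, r5]) (by rw [f₅ 6 (by decide) p6, r6])
    (by rw [f₅ 7 (by decide) p7, r7]) r8

/-- A step that is made of insertions amounts to inserting all elements of a list. -/
theorem exists_foldl_range_eq {α β : Type*} (n : ℕ) {f : ℕ → α → α} {P : ℕ → β → Prop}
    {add : β → α → α}
    (h : ∀ a, ∃ l : List β, (∀ A, f a A = l.foldl (fun A v => add v A) A) ∧ ∀ v, v ∈ l ↔ P a v) :
    ∃ l : List β, (∀ A, (List.range n).foldl (fun A a => f a A) A =
      l.foldl (fun A v => add v A) A) ∧ ∀ v, v ∈ l ↔ ∃ a < n, P a v := by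
  choose l hl hP using h
  refine ⟨(List.range n).flatMap l, fun A => ?_, fun v => ?_⟩
  · rw [List.foldl_flatMap]
    simp only [hl]
  · simp only [List.mem_flatMap, List.mem_range, hP]

open Classical in
-- Order and repetitions of the list are left open: for a maximal independent selection only the set
-- of inserted vectors matters.
theorem exists_foldTuples_eq {α β : Type*} (n : ℕ) {cond : ℕ → ℕ → ℕ → ℕ → ℕ → Prop}
    {vec : ℕ → ℕ → ℕ → ℕ → ℕ → β} {add : β → α → α} :
    ∃ l : List β, (∀ A, foldTuples n (fun a b c d e A =>
        if cond a b c d e then add (vec a b c d e) A else A) A =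
      l.foldl (fun A v => add v A) A) ∧
      ∀ v, v ∈ l ↔ ∃ a < n, ∃ b < n, ∃ c < n, ∃ d < n, ∃ e < n,
        cond a b c d e ∧ v = vec a b c d e := by
  refine exists_foldl_range_eq n fun a => exists_foldl_range_eq n fun b =>
    exists_foldl_range_eq n fun c => exists_foldl_range_eq n fun d =>
    exists_foldl_range_eq n fun e => ?_
  by_cases hc : cond a b c d e
  · exact ⟨[vec a b c d e], fun A => by simp [hc], fun v => by simp [hc]⟩
  · exact ⟨[], fun A => by simp [hc], fun v => by simp [hc]⟩

end Walks

/-! ## The program -/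

section Program

/-- Logical negation. -/
def notExpr (e : Expr) : Expr := .sub (.lit 1) e

/-- Enumerate the triangles of the common graph. -/
def triangleLoop : Prog :=
  forTuples (guarded [entry 2 4 5, entry 2 5 6, entry 2 6 4] (processWalk true 4 5 6 4))

/-- Enumerate the squares that are sums of two free squares and have a chord in one of the graphs
only. -/
def chordSquareLoop : Prog :=
  forTuples (guarded [entry 2 4 7, entry 2 7 6, entry 2 6 5, entry 2 5 4, entry 2 4 8, entry 2 8 6,
    notExpr (entry 8 4 6), notExpr (entry 8 7 5), notExpr (entry 8 8 5), entry 8 7 8,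
    notExpr (entry 2 7 8)] (processWalk false 4 7 6 8))

/-- Enumerate the free squares. -/
def freeSquareLoop : Prog :=
  forTuples (guarded [entry 2 4 5, entry 2 5 6, entry 2 6 7, entry 2 7 4, notExpr (entry 8 4 6),
    notExpr (entry 8 5 7)] (processWalk true 4 5 6 7))

/-- Multiples of the number of vertices; the diagonal of the matrix in array `8`. -/
def initRows : Prog :=
  forLoop 9 1 (.seq (.store 3 (.reg 9) (.reg 14)) (.seq
    (.store 8 (.add (.reg 14) (.reg 9)) (.lit 1)) (.assign 14 (.add (.reg 14) (.reg 1)))))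

/-- Multiples of the number of matrix entries; the matrix in array `2` is filled with ones. -/
def initVecs : Prog :=
  forLoop 9 2 (.seq (.store 4 (.reg 9) (.reg 14)) (.seq (.store 2 (.reg 9) (.lit 1))
    (.assign 14 (.add (.reg 14) (.reg 2)))))

/-- Accumulate one graph, whose matrix starts at the address in register `14`. -/
def accumulate : Prog :=
  forLoop 10 2 (.ite (.get 0 (.add (.reg 14) (.reg 10))) (.store 8 (.reg 10) (.lit 1))
    (.store 2 (.reg 10) (.lit 0)))

/-- Compute the intersection and the union of the graphs. -/
def initMatrices : Prog :=
  forLoop 9 3 (.seq accumulate (.assign 14 (.add (.add (.reg 14) (.reg 2)) (.lit 1))))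

/-- Initialization; the list of graphs starts at address `o`. -/
def setup (o : ℕ) : Prog :=
  .seq (.assign 3 (.get 0 (.lit o))) (.seq (.assign 1 (.get 0 (.lit (o + 1)))) (.seq initRows
    (.seq (.assign 2 (.reg 14)) (.seq (.assign 14 (.lit 0)) (.seq initVecs
      (.seq (.assign 14 (.lit (o + 2))) initMatrices))))))

/-- `o` occurs only in expressions, so frame conditions can be decided for the closed program `setup
0`. -/
theorem setup_regs (o : ℕ) : (setup o).regs = (setup 0).regs := rfl

theorem setup_arrs (o : ℕ) : (setup o).arrs = (setup 0).arrs := rfl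

/-- Compute an optimal solution. -/
def solve (o : ℕ) : Prog :=
  .seq (setup o) (.seq triangleLoop (.seq chordSquareLoop freeSquareLoop))

/-- Output the solution. -/
def maxProg : Prog :=
  .seq (solve 0) (.seq (.store 1 (.lit 0) (.reg 13)) (.assign 0 (.add (.reg 12) (.lit 1))))

/-- Compare the size of the solution with the number at address `0`. -/
def decisionProg : Prog :=
  .seq (solve 1) (.seq (.store 1 (.lit 0) (.sub (.lit 1) (.sub (.get 0 (.lit 0)) (.reg 13))))
    (.assign 0 (.lit 1)))

variable {L n : ℕ} {g h : ℕ → Prop} {s : Mem} {A : ElimState}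

theorem eval_entry_fst (hE : Env n g h s) {u v a b : ℕ} (hu : s.reg u = a) (hv : s.reg v = b)
    (ha : a < n) (hb : b < n) : (entry 2 u v).eval s ≠ 0 ↔ g (a * n + b) := by
  rw [eval_entry hE 2 hu hv ha]
  exact hE.fst_matrix _ (mul_add_lt ha hb)

theorem eval_entry_snd (hE : Env n g h s) {u v a b : ℕ} (hu : s.reg u = a) (hv : s.reg v = b)
    (ha : a < n) (hb : b < n) : (entry 8 u v).eval s ≠ 0 ↔ h (a * n + b) := by
  rw [eval_entry hE 8 hu hv ha]
  exact hE.snd_matrix _ (mul_add_lt ha hb)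

theorem eval_notExpr {e : Expr} : (notExpr e).eval s ≠ 0 ↔ ¬ e.eval s ≠ 0 := by
  simp only [notExpr, Expr.eval]
  omega

/-- Condition for a triangle. -/
def TriangleCond (n : ℕ) (g : ℕ → Prop) (a b c : ℕ) : Prop :=
  g (a * n + b) ∧ g (b * n + c) ∧ g (c * n + a)

/-- Condition for a square with a chord in one of the graphs only. -/
def ChordSquareCond (n : ℕ) (g h : ℕ → Prop) (a b c d e : ℕ) : Prop :=
  g (a * n + d) ∧ g (d * n + c) ∧ g (c * n + b) ∧ g (b * n + a) ∧ g (a * n + e) ∧ g (e * n + c) ∧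
    ¬ h (a * n + c) ∧ ¬ h (d * n + b) ∧ ¬ h (e * n + b) ∧ h (d * n + e) ∧ ¬ g (d * n + e)

/-- Condition for a free square. -/
def FreeSquareCond (n : ℕ) (g h : ℕ → Prop) (a b c d : ℕ) : Prop :=
  g (a * n + b) ∧ g (b * n + c) ∧ g (c * n + d) ∧ g (d * n + a) ∧ ¬ h (a * n + c) ∧
    ¬ h (b * n + d)

open Classical in
/-- Insert the triangles. -/
noncomputable def triangleStep (n : ℕ) (g : ℕ → Prop) (a b c _d _e : ℕ) (A : ElimState) :
    ElimState :=
  if TriangleCond n g a b c then addVec true (walkVec n a b c a) A else A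

open Classical in
/-- Insert the sums of two free squares that have a chord. -/
noncomputable def chordSquareStep (n : ℕ) (g h : ℕ → Prop) (a b c d e : ℕ) (A : ElimState) :
    ElimState :=
  if ChordSquareCond n g h a b c d e then addVec false (walkVec n a d c e) A else A

open Classical in
/-- Insert the free squares. -/
noncomputable def freeSquareStep (n : ℕ) (g h : ℕ → Prop) (a b c d _e : ℕ) (A : ElimState) :
    ElimState :=
  if FreeSquareCond n g h a b c d then addVec true (walkVec n a b c d) A else A

theorem Represents.setReg_loop (hA : Represents n g h A s) (i : ℕ) {x : ℕ}
    (hx : x ∈ [4, 5, 6, 7, 8]) : Represents n g h A (s.setReg x i) := by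
  refine hA.setReg i ?_
  revert x
  decide

theorem wp_triangleLoop (hL : n * n ≤ L) (hA : Represents n g h A s) :
    Wp L triangleLoop (Represents n g h (foldTuples n (triangleStep n g) A)) s := by
  refine wp_forTuples _ _ hA.1.vertices ((Nat.le_mul_self n).trans hL) (by decide)
    (fun A s i x hx hA => hA.setReg_loop i hx) hA ?_
  intro a ha b hb c hc d hd e he A s hA r4 r5 r6 r7 r8
  have hcond : (∀ e ∈ [entry 2 4 5, entry 2 5 6, entry 2 6 4], e.eval s ≠ 0) ↔
      TriangleCond n g a b c := by
    simp only [List.forall_mem_cons, eval_entry_fst hA.1 r4 r5 ha hb,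
      eval_entry_fst hA.1 r5 r6 hb hc, eval_entry_fst hA.1 r6 r4 hc ha, TriangleCond]
    simp
  refine Wp.guarded (fun h => ?_) (fun h => ?_)
  · rw [triangleStep, if_pos (hcond.1 h)]
    exact wp_processWalk hL true r4 r5 r6 r4 ha hb hc ha hA
  · rwa [triangleStep, if_neg (fun h' => h (hcond.2 h'))]

theorem wp_chordSquareLoop (hL : n * n ≤ L) (hA : Represents n g h A s) :
    Wp L chordSquareLoop (Represents n g h (foldTuples n (chordSquareStep n g h) A)) s := by
  refine wp_forTuples _ _ hA.1.vertices ((Nat.le_mul_self n).trans hL) (by decide)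
    (fun A s i x hx hA => hA.setReg_loop i hx) hA ?_
  intro a ha b hb c hc d hd e he A s hA r4 r5 r6 r7 r8
  have hcond : (∀ e ∈ [entry 2 4 7, entry 2 7 6, entry 2 6 5, entry 2 5 4, entry 2 4 8,
      entry 2 8 6, notExpr (entry 8 4 6), notExpr (entry 8 7 5), notExpr (entry 8 8 5),
      entry 8 7 8, notExpr (entry 2 7 8)], e.eval s ≠ 0) ↔ ChordSquareCond n g h a b c d e := by
    simp only [List.forall_mem_cons, eval_notExpr, eval_entry_fst hA.1 r4 r7 ha hd,
      eval_entry_fst hA.1 r7 r6 hd hc, eval_entry_fst hA.1 r6 r5 hc hb,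
      eval_entry_fst hA.1 r5 r4 hb ha, eval_entry_fst hA.1 r4 r8 ha he,
      eval_entry_fst hA.1 r8 r6 he hc, eval_entry_snd hA.1 r4 r6 ha hc,
      eval_entry_snd hA.1 r7 r5 hd hb, eval_entry_snd hA.1 r8 r5 he hb,
      eval_entry_snd hA.1 r7 r8 hd he, eval_entry_fst hA.1 r7 r8 hd he, ChordSquareCond]
    simp
  refine Wp.guarded (fun h => ?_) (fun h => ?_)
  · rw [chordSquareStep, if_pos (hcond.1 h)]
    exact wp_processWalk hL false r4 r7 r6 r8 ha hd hc he hA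
  · rwa [chordSquareStep, if_neg (fun h' => h (hcond.2 h'))]

theorem wp_freeSquareLoop (hL : n * n ≤ L) (hA : Represents n g h A s) :
    Wp L freeSquareLoop (Represents n g h (foldTuples n (freeSquareStep n g h) A)) s := by
  refine wp_forTuples _ _ hA.1.vertices ((Nat.le_mul_self n).trans hL) (by decide)
    (fun A s i x hx hA => hA.setReg_loop i hx) hA ?_
  intro a ha b hb c hc d hd e he A s hA r4 r5 r6 r7 r8
  have hcond : (∀ e ∈ [entry 2 4 5, entry 2 5 6, entry 2 6 7, entry 2 7 4,
      notExpr (entry 8 4 6), notExpr (entry 8 5 7)], e.eval s ≠ 0) ↔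
      FreeSquareCond n g h a b c d := by
    simp only [List.forall_mem_cons, eval_notExpr, eval_entry_fst hA.1 r4 r5 ha hb,
      eval_entry_fst hA.1 r5 r6 hb hc, eval_entry_fst hA.1 r6 r7 hc hd,
      eval_entry_fst hA.1 r7 r4 hd ha, eval_entry_snd hA.1 r4 r6 ha hc,
      eval_entry_snd hA.1 r5 r7 hb hd, FreeSquareCond]
    simp
  refine Wp.guarded (fun h => ?_) (fun h => ?_)
  · rw [freeSquareStep, if_pos (hcond.1 h)]
    exact wp_processWalk hL true r4 r5 r6 r7 ha hb hc hd hA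
  · rwa [freeSquareStep, if_neg (fun h' => h (hcond.2 h'))]

/-! ### Initialization of the tables and matrices -/

/-- Register `14` runs through the multiples of `n` and ends at `n * n`, which replaces
multiplication. With the diagonal set in array `8`, a zero entry there means that two vertices are
distinct and adjacent in no graph. -/
theorem wp_initRows (hL : n ≤ L) (h1 : s.reg 1 = n) (h14 : s.reg 14 = 0)
    (h8 : ∀ j, s.arr 8 j = 0) :
    Wp L initRows (fun s' => s'.reg 14 = n * n ∧ (∀ u < n, s'.arr 3 u = u * n) ∧
      ∀ j, s'.arr 8 j ≠ 0 ↔ ∃ u < n, j = u * n + u) s := by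
  refine Wp.forLoop (N := n) (fun i s' => s'.reg 14 = i * n ∧ (∀ u < i, s'.arr 3 u = u * n) ∧
      ∀ j, s'.arr 8 j ≠ 0 ↔ ∃ u < i, j = u * n + u) h1 hL (by decide) (by decide) (by decide)
      ⟨by simpa using h14, by simp, by simp [h8]⟩ ?_
  rintro i hi s' ⟨k1, k2, k3⟩ hx hreg -
  have e1 : s'.reg 1 = n := by rw [hreg 1 (by decide) (by decide), h1]
  refine Wp.seq (Wp.store (Wp.seq (Wp.store (Wp.assign ⟨?_, fun u hu => ?_, fun j => ?_⟩))))
  · simp [Expr.eval, k1, e1]; ring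
  · simp only [Mem.setReg_arr, Expr.eval, Mem.setArr_arr_of_ne _ _ _ (show 3 ≠ 8 by decide),
      Mem.setArr_arr_self, hx, k1]
    by_cases h : u = i
    · rw [if_pos h, h]
    · rw [if_neg h, k2 u (by omega)]
  · simp only [Mem.setReg_arr, Mem.setArr_arr_self, Expr.eval, Mem.setArr_reg, hx, k1,
      Mem.setArr_arr_of_ne _ _ _ (show 8 ≠ 3 by decide)]
    by_cases h : j = i * n + i
    · simp only [if_pos h, ne_eq, one_ne_zero, not_false_eq_true, true_iff]
      exact ⟨i, by omega, h⟩
    · rw [if_neg h, k3]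
      refine exists_congr fun u => ⟨fun h' => ⟨by omega, h'.2⟩, fun h' => ⟨?_, h'.2⟩⟩
      have : u ≠ i := by
        rintro rfl; exact h h'.2
      omega

theorem wp_initVecs {m : ℕ} (hL : m ≤ L) (h2 : s.reg 2 = m) (h14 : s.reg 14 = 0) :
    Wp L initVecs (fun s' => (∀ p < m, s'.arr 4 p = p * m) ∧ ∀ p < m, s'.arr 2 p = 1) s := by
  refine (Wp.forLoop (N := m) (fun i s' => s'.reg 14 = i * m ∧ (∀ p < i, s'.arr 4 p = p * m) ∧
      ∀ p < i, s'.arr 2 p = 1) h2 hL (by decide) (by decide) (by decide)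
      ⟨by simpa using h14, by simp, by simp⟩ ?_).mono fun s' h => h.2
  rintro i hi s' ⟨k1, k2, k3⟩ hx hreg -
  have e2 : s'.reg 2 = m := by rw [hreg 2 (by decide) (by decide), h2]
  refine Wp.seq (Wp.store (Wp.seq (Wp.store (Wp.assign ⟨?_, fun u hu => ?_, fun u hu => ?_⟩))))
  · simp [Expr.eval, k1, e2]; ring
  · simp only [Mem.setReg_arr, Expr.eval, Mem.setArr_arr_of_ne _ _ _ (show 4 ≠ 2 by decide),
      Mem.setArr_arr_self, hx, k1]
    by_cases h : u = i
    · rw [if_pos h, h]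
    · rw [if_neg h, k2 u (by omega)]
  · simp only [Mem.setReg_arr, Mem.setArr_arr_self, Expr.eval, Mem.setArr_reg, hx,
      Mem.setArr_arr_of_ne _ _ _ (show 2 ≠ 4 by decide)]
    by_cases h : u = i
    · rw [if_pos h]
    · rw [if_neg h, k3 u (by omega)]

theorem wp_accumulate {m b : ℕ} (hL : m ≤ L) (h2 : s.reg 2 = m) (h14 : s.reg 14 = b) :
    Wp L accumulate (fun s' => ∀ j < m, (s'.arr 2 j ≠ 0 ↔ s.arr 2 j ≠ 0 ∧ s.arr 0 (b + j) ≠ 0) ∧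
      (s'.arr 8 j ≠ 0 ↔ s.arr 8 j ≠ 0 ∨ s.arr 0 (b + j) ≠ 0)) s := by
  refine (Wp.forLoop (N := m) (fun i s' => ∀ j < m,
    (s'.arr 2 j ≠ 0 ↔ s.arr 2 j ≠ 0 ∧ (j < i → s.arr 0 (b + j) ≠ 0)) ∧
      (s'.arr 8 j ≠ 0 ↔ s.arr 8 j ≠ 0 ∨ (j < i ∧ s.arr 0 (b + j) ≠ 0))) h2 hL (by decide)
      (by decide) (by decide) (by simp) ?_).mono ?_
  · intro i hi s' hs' hx hreg harr
    have e0 : s'.arr 0 = s.arr 0 := harr 0 (by decide)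
    have e14 : s'.reg 14 = b := by rw [hreg 14 (by decide) (by decide), h14]
    have hlt : ∀ j, j ≠ i → (j < i + 1 ↔ j < i) := fun j hj => by omega
    refine Wp.ite (fun hne => Wp.store fun j hj => ?_) (fun he => Wp.store fun j hj => ?_)
    · simp only [Expr.eval, e14, hx, e0] at hne
      obtain ⟨k1, k2⟩ := hs' j hj
      simp only [Mem.setReg_arr, Mem.setArr_arr_self, Expr.eval, hx,
        Mem.setArr_arr_of_ne _ _ _ (show 2 ≠ 8 by decide)]
      by_cases h : j = i
      · subst h
        rw [k1]
        simp [hne]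
      · rw [if_neg h, k1, k2, hlt j h]
        exact ⟨Iff.rfl, Iff.rfl⟩
    · simp only [Expr.eval, e14, hx, e0] at he
      obtain ⟨k1, k2⟩ := hs' j hj
      simp only [Mem.setReg_arr, Mem.setArr_arr_self, Expr.eval, hx,
        Mem.setArr_arr_of_ne _ _ _ (show 8 ≠ 2 by decide)]
      by_cases h : j = i
      · subst h
        rw [k2]
        simp [he]
      · rw [if_neg h, k1, k2, hlt j h]
        exact ⟨Iff.rfl, Iff.rfl⟩
  · intro s' hs' j hj
    simpa [hj] using hs' j hj

/-- Consecutive matrices are `m + 1` apart, because each graph starts with its number of vertices.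
-/
theorem wp_initMatrices {m b k : ℕ} (hL : m ≤ L) (hk : k ≤ L) (h2 : s.reg 2 = m)
    (h3 : s.reg 3 = k) (h14 : s.reg 14 = b) :
    Wp L initMatrices (fun s' => ∀ j < m,
      (s'.arr 2 j ≠ 0 ↔ s.arr 2 j ≠ 0 ∧ ∀ i < k, s.arr 0 (b + i * (m + 1) + j) ≠ 0) ∧
      (s'.arr 8 j ≠ 0 ↔ s.arr 8 j ≠ 0 ∨ ∃ i < k, s.arr 0 (b + i * (m + 1) + j) ≠ 0)) s := by
  refine (Wp.forLoop (N := k) (fun i s' => s'.reg 14 = b + i * (m + 1) ∧ ∀ j < m,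
    (s'.arr 2 j ≠ 0 ↔ s.arr 2 j ≠ 0 ∧ ∀ i' < i, s.arr 0 (b + i' * (m + 1) + j) ≠ 0) ∧
      (s'.arr 8 j ≠ 0 ↔ s.arr 8 j ≠ 0 ∨ ∃ i' < i, s.arr 0 (b + i' * (m + 1) + j) ≠ 0)) h3 hk
      (by decide) (by decide) (by decide) ?_ ?_).mono fun s' hs' => hs'.2
  · simpa using h14
  · rintro i hi s' ⟨k0, hs'⟩ hx hreg harr
    have e0 : s'.arr 0 = s.arr 0 := harr 0 (by decide)
    have e2 : s'.reg 2 = m := by rw [hreg 2 (by decide) (by decide), h2]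
    refine Wp.seq ((wp_accumulate hL e2 k0).frame fun s'' hs'' hreg' _ => Wp.assign ⟨?_, ?_⟩)
    · have e14 : s''.reg 14 = b + i * (m + 1) := by rw [hreg' 14 (by decide), k0]
      have e2' : s''.reg 2 = m := by rw [hreg' 2 (by decide), e2]
      simp [Expr.eval, e14, e2']; ring
    · intro j hj
      obtain ⟨k1, k2⟩ := hs' j hj
      obtain ⟨l1, l2⟩ := hs'' j hj
      simp only [Mem.setReg_arr, l1, l2, k1, k2, e0]
      constructor
      · rw [and_assoc, Nat.forall_lt_succ_right]
      · rw [or_assoc, Nat.exists_lt_succ_right]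

/-- The memory after the initialization, for a word that contains `k` matrices `M i` of `n` rows
and columns. -/
theorem wp_setup {o k : ℕ} {input : List ℕ} {M : ℕ → ℕ → ℕ} (hL : n * n ≤ L) (hk : k ≤ L)
    (h0 : input.getD o 0 = k) (h1 : input.getD (o + 1) 0 = n)
    (hM : ∀ i < k, ∀ j < n * n, input.getD (o + 2 + i * (n * n + 1) + j) 0 = M i j) :
    Wp L (setup o) (Represents n (fun j => ∀ i < k, M i j ≠ 0)
      (fun j => (∃ u < n, j = u * n + u) ∨ ∃ i < k, M i j ≠ 0) (⊥, []))
      (initMem input) := by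
  refine Wp.frame (Q := fun s => Env n (fun j => ∀ i < k, M i j ≠ 0)
      (fun j => (∃ u < n, j = u * n + u) ∨ ∃ i < k, M i j ≠ 0) s) ?_ ?_
  · refine Wp.seq (Wp.assign (Wp.seq (Wp.assign (Wp.seq ?_))))
    refine (wp_initRows (n := n) ((Nat.le_mul_self n).trans hL) ?_ ?_ ?_).frame ?_
    · simpa [Expr.eval, initMem] using h1
    · simp [initMem]
    · simp [initMem]
    rintro s₁ ⟨a1, a2, a3⟩ hreg₁ harr₁
    have r1 : s₁.reg 1 = n := by
      rw [hreg₁ 1 (by decide)]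
      simpa [Expr.eval, initMem] using h1
    have r3 : s₁.reg 3 = k := by
      rw [hreg₁ 3 (by decide)]
      simpa [Expr.eval, initMem] using h0
    have e0 : s₁.arr 0 = (initMem input).arr 0 := harr₁ 0 (by decide)
    refine Wp.seq (Wp.assign (Wp.seq (Wp.assign (Wp.seq ?_))))
    refine (wp_initVecs (m := n * n) hL (by simp [Expr.eval, a1]) (by simp [Expr.eval])).frame ?_
    rintro s₂ ⟨b1, b2⟩ hreg₂ harr₂
    refine Wp.seq (Wp.assign ?_)
    -- The first matrix comes after the number of graphs and the number of vertices.
    refine (wp_initMatrices (m := n * n) (b := o + 2) (k := k) hL hk ?_ ?_ ?_).frame ?_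
    · rw [Mem.setReg_reg, if_neg (by decide), hreg₂ 2 (by decide)]
      simp [Expr.eval, a1]
    · rw [Mem.setReg_reg, if_neg (by decide), hreg₂ 3 (by decide)]
      simp [r3]
    · simp [Expr.eval]
    intro s₃ hs₃ hreg₃ harr₃
    have e : ∀ i < k, ∀ j < n * n, s₂.arr 0 (o + 2 + i * (n * n + 1) + j) = M i j := by
      intro i hi j hj
      rw [harr₂ 0 (by decide), Mem.setReg_arr, Mem.setReg_arr, e0, ← hM i hi j hj]
      simp [initMem]
    refine ⟨?_, ?_, ?_, ?_, ?_, ?_⟩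
    · rw [hreg₃ 1 (by decide), Mem.setReg_reg, if_neg (by decide), hreg₂ 1 (by decide)]
      simp [r1]
    · rw [hreg₃ 2 (by decide), Mem.setReg_reg, if_neg (by decide), hreg₂ 2 (by decide)]
      simp [Expr.eval, a1]
    · intro u hu
      rw [harr₃ 3 (by decide), Mem.setReg_arr, harr₂ 3 (by decide)]
      exact a2 u hu
    · intro p hp
      rw [harr₃ 4 (by decide), Mem.setReg_arr]
      exact b1 p hp
    · intro j hj
      rw [(hs₃ j hj).1, Mem.setReg_arr, b2 j hj]
      simp only [ne_eq, one_ne_zero, not_false_eq_true, true_and]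
      exact forall₂_congr fun i hi => by rw [e i hi j hj]
    · intro j hj
      rw [(hs₃ j hj).2, Mem.setReg_arr, harr₂ 8 (by decide), Mem.setReg_arr, Mem.setReg_arr, a3]
      refine or_congr Iff.rfl (exists_congr fun i => and_congr_right fun hi => ?_)
      rw [e i hi j hj]
  · intro s hE hreg harr
    have ha : ∀ a, a ≠ 0 → ∀ j, (initMem input).arr a j = 0 := fun a h j => by simp [initMem, h]
    have h5 : s.arr 5 = (initMem input).arr 5 := harr 5 (by
      rw [setup_arrs]; decide)
    have h7 : s.arr 7 = (initMem input).arr 7 := harr 7 (by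
      rw [setup_arrs]; decide)
    have h12 : s.reg 12 = 0 := by
      rw [hreg 12 (by rw [setup_regs]; decide)]; simp [initMem]
    have h13 : s.reg 13 = 0 := by
      rw [hreg 13 (by rw [setup_regs]; decide)]; simp [initMem]
    -- Zero memory represents the zero vector, no rows and the empty output.
    refine ⟨hE, ?_, ⟨∅, 0, ?_, ⟨?_, ?_, ?_⟩, ?_⟩, ?_, ?_⟩
    · intro j _
      rw [h5, ha 5 (by decide)]
      rfl
    · simp [Echelon]
    · intro p _
      rw [h7, ha 7 (by decide)]
      simp
    · simp
    · simp
    · simp [rowSpan]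
    · simp [h13]
    · simp [h12]

end Program

/-! ## Graphs as matrices -/

section Matrices

variable {n : ℕ}

theorem div_lt_of_lt_mul_self {j : ℕ} (hj : j < n * n) : j / n < n := Nat.div_lt_of_lt_mul hj

theorem mod_lt_of_lt_mul_self {j : ℕ} (hj : j < n * n) : j % n < n :=
  Nat.mod_lt _ (Nat.pos_of_ne_zero fun h => by simp [h] at hj)

/-- A function on the edges as a symmetric matrix, row by row. -/
def toVec (n : ℕ) : (Sym2 (Fin n) → ZMod 2) →ₗ[ZMod 2] (ℕ → ZMod 2) where
  toFun z j := if hj : j < n * n then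
    z s(⟨j / n, div_lt_of_lt_mul_self hj⟩, ⟨j % n, mod_lt_of_lt_mul_self hj⟩) else 0
  map_add' z w := by
    ext j
    by_cases hj : j < n * n <;> simp [hj]
  map_smul' a z := by
    ext j
    by_cases hj : j < n * n <;> simp [hj]

theorem toVec_apply (z : Sym2 (Fin n) → ZMod 2) (a b : Fin n) :
    toVec n z (a * n + b) = z s(a, b) := by
  have hj := mul_add_lt a.2 b.2
  have hn : 0 < n := a.pos
  have h1 : (a * n + b : ℕ) / n = a := by
    rw [mul_comm, Nat.mul_add_div hn, Nat.div_eq_of_lt b.2, add_zero]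
  have h2 : (a * n + b : ℕ) % n = b := by
    rw [mul_comm, Nat.mul_add_mod, Nat.mod_eq_of_lt b.2]
  simp [toVec, hj, h1, h2]

theorem toVec_apply_of_le (z : Sym2 (Fin n) → ZMod 2) {j : ℕ} (hj : n * n ≤ j) :
    toVec n z j = 0 := by
  simp [toVec, hj.not_gt]

theorem exists_eq_mul_add {j : ℕ} (hj : j < n * n) : ∃ a b : Fin n, j = a * n + b :=
  ⟨⟨j / n, div_lt_of_lt_mul_self hj⟩, ⟨j % n, mod_lt_of_lt_mul_self hj⟩,
    (Nat.div_add_mod' j n).symm⟩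

theorem toVec_injective : Function.Injective (toVec n) := by
  intro z w h
  ext e
  induction e using Sym2.ind with
  | _ a b => rw [← toVec_apply z, h, toVec_apply]

/-- The adjacency matrix of a graph, row by row. -/
noncomputable def graphVec {n : ℕ} (c : SimpleGraph (Fin n)) : ℕ → ZMod 2 := toVec n (edgeVec c)

theorem graphVec_injective : Function.Injective (graphVec (n := n)) :=
  toVec_injective.comp edgeVec_injective

theorem flatMap_range_map_eq {α : Type*} (g : ℕ → ℕ → α) (a n : ℕ) :
    (List.range a).flatMap (fun i => (List.range n).map (g i)) =
      (List.range (a * n)).map fun j => g (j / n) (j % n) := by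
  induction a with
  | zero => simp
  | succ a ih =>
    rw [List.range_succ, List.flatMap_append, ih, Nat.succ_mul, List.range_add, List.map_append,
      List.flatMap_singleton, List.map_map]
    congr 1
    refine List.map_congr_left fun j hj => ?_
    have hj' := List.mem_range.1 hj
    have hn : 0 < n := by omega
    simp only [Function.comp_apply]
    rw [mul_comm a n, Nat.mul_add_div hn, Nat.div_eq_of_lt hj', add_zero, Nat.mul_add_mod,
      Nat.mod_eq_of_lt hj']

theorem encodeGraph_eq (c : SimpleGraph (Fin n)) : encodeGraph c = encodeVec n (graphVec c) := by
  classical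
  rw [encodeGraph, encodeVec]
  congr 1
  have h1 : ∀ i : Fin n, (List.finRange n).map (fun j => if c.Adj i j then 1 else 0) =
      (List.range n).map fun j => (graphVec c (i * n + j)).val := by
    intro i
    rw [← List.map_coe_finRange_eq_range, List.map_map]
    refine List.map_congr_left fun j _ => ?_
    rw [Function.comp_apply, graphVec, toVec_apply, edgeVec_apply]
    by_cases h : c.Adj i j
    · simp only [h, SimpleGraph.mem_edgeSet, if_true]; rfl
    · simp [h]
  simp only [h1]
  rw [← List.flatMap_map (fun i : Fin n => (i : ℕ))
    (fun i => (List.range n).map fun j => (graphVec c (i * n + j)).val),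
    List.map_coe_finRange_eq_range, flatMap_range_map_eq]
  exact List.map_congr_left fun j _ => by rw [Nat.div_add_mod']

theorem length_encodeGraph (c : SimpleGraph (Fin n)) : (encodeGraph c).length = n * n + 1 := by
  simp [encodeGraph_eq, encodeVec]

theorem getD_flatMap {α β : Type*} (f : α → List β) (x : β) (d : α) {m : ℕ} :
    ∀ (l : List α), (∀ a ∈ l, (f a).length = m) → ∀ i < l.length, ∀ j < m,
      (l.flatMap f).getD (i * m + j) x = (f (l.getD i d)).getD j x := by
  intro l
  induction l with
  | nil => intro _ i hi; simp at hi
  | cons a l ih =>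
    intro hl i hi j hj
    have ha := hl a List.mem_cons_self
    rw [List.flatMap_cons]
    cases i with
    | zero =>
      rw [zero_mul, zero_add, List.getD_append _ _ _ _ (by omega), List.getD_cons_zero]
    | succ i =>
      rw [List.getD_append_right _ _ _ _ (by rw [ha, Nat.succ_mul]; omega), ha,
        List.getD_cons_succ, ← ih (fun b hb => hl b (List.mem_cons_of_mem _ hb)) i
        (by simpa using hi) j hj]
      congr 1
      rw [Nat.succ_mul]
      omega

theorem length_encodeGraphs (Gs : List (SimpleGraph (Fin n))) :
    (encodeGraphs Gs).length = Gs.length * (n * n + 1) + 1 := by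
  simp [encodeGraphs, List.length_flatMap, length_encodeGraph]

theorem getD_encodeGraphs (Gs : List (SimpleGraph (Fin n))) {i j : ℕ} (hi : i < Gs.length)
    (hj : j < n * n + 1) : (encodeGraphs Gs).getD (i * (n * n + 1) + j + 1) 0 =
      (encodeVec n (graphVec (Gs.getD i ⊥))).getD j 0 := by
  rw [encodeGraphs, List.getD_cons_succ,
    getD_flatMap encodeGraph 0 ⊥ Gs (fun c _ => length_encodeGraph c) i hi j hj, encodeGraph_eq]

theorem getD_encodeVec_succ (v : ℕ → ZMod 2) {j : ℕ} (hj : j < n * n) :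
    (encodeVec n v).getD (j + 1) 0 = (v j).val := by
  rw [encodeVec, List.getD_cons_succ, List.getD_eq_getElem _ _ (by simpa using hj)]
  simp

/-! ### Closed walks -/

theorem add_self_vec {ι : Type*} (v : ι → ZMod 2) : v + v = 0 := by
  ext j
  have : ∀ a : ZMod 2, a + a = 0 := by decide
  exact this _

theorem pairVec_self (a : ℕ) : pairVec n a a = 0 := add_self_vec _

theorem pairVec_comm (a b : ℕ) : pairVec n a b = pairVec n b a := add_comm _ _

theorem pairVec_eq {a b : Fin n} (hab : a ≠ b) :
    pairVec n a b = toVec n (Pi.single s(a, b) 1) := by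
  ext j
  rcases lt_or_ge j (n * n) with hj | hj
  · obtain ⟨x, y, rfl⟩ := exists_eq_mul_add hj
    have key : ∀ a b : Fin n, ((x * n + y : ℕ) = a * n + b) ↔ (x = a ∧ y = b) := by
      intro a b
      constructor
      · intro h
        have := eq_of_mul_add_eq y.2 b.2 h
        exact ⟨Fin.ext this.1, Fin.ext this.2⟩
      · rintro ⟨rfl, rfl⟩; rfl
    rw [toVec_apply, pairVec, Pi.add_apply, Pi.single_apply, Pi.single_apply, Pi.single_apply]
    simp only [key, Sym2.eq_iff]
    grind
  · rw [toVec_apply_of_le _ hj, pairVec_apply_of_le a.2 b.2 hj]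

theorem walkVec_sq {G : SimpleGraph (Fin n)} {p q r s : Fin n} (h : IsSq G p q r s) :
    walkVec n p q r s = graphVec (sq p q r s) := by
  classical
  obtain ⟨h1, h2, h3, h4, h5, h6⟩ := h
  have n1 := h1.ne
  have n2 := h2.ne
  have n3 := h3.ne
  have n4 := h4.ne
  rw [walkVec, pairVec_eq n1, pairVec_eq n2, pairVec_eq n3, pairVec_eq n4, ← map_add, ← map_add,
    ← map_add, graphVec]
  congr 1
  ext e
  induction e using Sym2.ind with
  | _ x y =>
  simp only [Pi.add_apply, Pi.single_apply, edgeVec_apply, SimpleGraph.mem_edgeSet, sq_adj,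
    Sym2.eq_iff]
  grind

theorem walkVec_tri {G : SimpleGraph (Fin n)} {p q r : Fin n} (h1 : G.Adj p q) (h2 : G.Adj q r)
    (h3 : G.Adj r p) : walkVec n p q r p = graphVec (tri p q r) := by
  classical
  have n1 := h1.ne
  have n2 := h2.ne
  have n3 := h3.ne
  rw [walkVec, pairVec_eq n1, pairVec_eq n2, pairVec_eq n3, pairVec_self, add_zero, ← map_add,
    ← map_add, graphVec]
  congr 1
  ext e
  induction e using Sym2.ind with
  | _ x y =>
  simp only [Pi.add_apply, Pi.single_apply, edgeVec_apply, SimpleGraph.mem_edgeSet, tri_adj,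
    Sym2.eq_iff]
  grind

/-- The test for chord squares also accepts equal ends, since the diagonal is in the second matrix
and not in the first. The vector inserted then is zero, which changes nothing. -/
theorem walkVec_degenerate (p s r : ℕ) : walkVec n p s r s = 0 := by
  rw [walkVec, pairVec_comm r s, pairVec_comm s p, add_assoc (pairVec n p s), add_self_vec,
    add_zero, add_self_vec]

/-! ### Insertion of graphs -/

theorem mem_map_toVec {U : Submodule (ZMod 2) (Sym2 (Fin n) → ZMod 2)} {c : SimpleGraph (Fin n)} :
    graphVec c ∈ U.map (toVec n) ↔ edgeVec c ∈ U :=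
  ⟨fun ⟨_, hz, he⟩ => toVec_injective he ▸ hz, fun h => ⟨_, h, rfl⟩⟩

theorem exists_map_eq_of_forall_mem {α β : Type*} {f : α → β} {P : α → Prop} (l : List β)
    (h : ∀ v ∈ l, ∃ c, P c ∧ v = f c) : ∃ l' : List α, l = l'.map f ∧ ∀ c ∈ l', P c := by
  induction l with
  | nil => exact ⟨[], rfl, by simp⟩
  | cons v l ih =>
    obtain ⟨c, hc, rfl⟩ := h v List.mem_cons_self
    obtain ⟨l', rfl, hl'⟩ := ih fun v hv => h v (List.mem_cons_of_mem _ hv)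
    exact ⟨c :: l', rfl, by simpa using ⟨hc, hl'⟩⟩

/-- Inserting a list of graphs outputs a maximal independent sublist. -/
theorem foldl_addVec_true (U : Submodule (ZMod 2) (Sym2 (Fin n) → ZMod 2))
    (outs : List (ℕ → ZMod 2)) (l : List (SimpleGraph (Fin n))) :
    ∀ S : List (SimpleGraph (Fin n)), S.Nodup →
      LinearIndepOn (ZMod 2) (U.mkQ ∘ edgeVec) {c | c ∈ S} →
    ∃ S' : List (SimpleGraph (Fin n)), S'.Nodup ∧
      LinearIndepOn (ZMod 2) (U.mkQ ∘ edgeVec) {c | c ∈ S'} ∧ S ⊆ S' ∧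
      (∀ c ∈ S', c ∈ S ∨ c ∈ l) ∧
      (∀ c ∈ l, edgeVec c ∈ U ⊔ Submodule.span (ZMod 2) (edgeVec '' {c | c ∈ S'})) ∧
      (l.map graphVec).foldl (fun A v => addVec true v A)
        ((U ⊔ Submodule.span (ZMod 2) (edgeVec '' {c | c ∈ S})).map (toVec n),
          outs ++ S.map graphVec) =
        ((U ⊔ Submodule.span (ZMod 2) (edgeVec '' {c | c ∈ S'})).map (toVec n),
          outs ++ S'.map graphVec) := by
  induction l with
  | nil => exact fun S hS hi => ⟨S, hS, hi, List.Subset.refl S, fun c hc => Or.inl hc, by simp, rfl⟩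
  | cons a l ih =>
    intro S hS hi
    rw [List.map_cons, List.foldl_cons]
    have hmono : ∀ {S₁ S₂ : List (SimpleGraph (Fin n))}, S₁ ⊆ S₂ →
        U ⊔ Submodule.span (ZMod 2) (edgeVec '' {c | c ∈ S₁}) ≤
        U ⊔ Submodule.span (ZMod 2) (edgeVec '' {c | c ∈ S₂}) :=
      fun h => sup_le_sup_left (Submodule.span_mono (Set.image_mono h)) _
    by_cases ha : edgeVec a ∈ U ⊔ Submodule.span (ZMod 2) (edgeVec '' {c | c ∈ S})
    · obtain ⟨S', h1, h2, h3, h4, h5, h6⟩ := ih S hS hi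
      refine ⟨S', h1, h2, h3, fun c hc => (h4 c hc).imp_right (List.mem_cons_of_mem _), ?_, ?_⟩
      · intro c hc
        rcases List.mem_cons.1 hc with rfl | hc
        · exact hmono h3 ha
        · exact h5 c hc
      · rw [← h6]
        congr 1
        exact if_pos (mem_map_toVec.2 ha)
    · have haS : a ∉ S := fun h =>
        ha (Submodule.mem_sup_right (Submodule.subset_span ⟨a, h, rfl⟩))
      have hset : {c | c ∈ S ++ [a]} = insert a {c | c ∈ S} := by
        ext c; simp [or_comm]
      obtain ⟨S', h1, h2, h3, h4, h5, h6⟩ := ih (S ++ [a])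
        (List.nodup_append.2 ⟨hS, List.nodup_singleton a, by
          rintro x hx y hy rfl
          exact haS (List.mem_singleton.1 hy ▸ hx)⟩)
        (by rw [hset]; exact linearIndepOn_mkQ_insert hi ha)
      refine ⟨S', h1, h2, fun c hc => h3 (List.mem_append_left _ hc), fun c hc => ?_, ?_, ?_⟩
      · rcases h4 c hc with h | h
        · rcases List.mem_append.1 h with h | h
          · exact Or.inl h
          · exact Or.inr (List.mem_singleton.1 h ▸ List.mem_cons_self)
        · exact Or.inr (List.mem_cons_of_mem _ h)
      · intro c hc
        rcases List.mem_cons.1 hc with rfl | hc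
        · exact Submodule.mem_sup_right (Submodule.subset_span
            ⟨c, h3 (List.mem_append_right _ List.mem_cons_self), rfl⟩)
        · exact h5 c hc
      · rw [← h6]
        congr 1
        refine (if_neg (fun h => ha (mem_map_toVec.1 h))).trans ?_
        rw [hset, Set.image_insert_eq, Submodule.span_insert, sup_comm (Submodule.span _ _),
          ← sup_assoc, Submodule.map_sup _ (Submodule.span _ {_}), Submodule.map_span,
          Set.image_singleton]
        simp [graphVec]

theorem foldl_addVec_false (l : List (ℕ → ZMod 2)) (A : ElimState) :
    l.foldl (fun A v => addVec false v A) A =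
      (A.1 ⊔ Submodule.span (ZMod 2) {v | v ∈ l}, A.2) := by
  induction l generalizing A with
  | nil => simp
  | cons v l ih =>
    rw [List.foldl_cons, ih]
    have hset : {w | w ∈ v :: l} = insert v {w | w ∈ l} := by
      ext w; simp
    have h1 : (addVec false v A).1 = A.1 ⊔ Submodule.span (ZMod 2) {v} := by
      by_cases hv : v ∈ A.1
      · rw [addVec, if_pos hv, sup_eq_left.2 ((Submodule.span_singleton_le_iff_mem _ _).2 hv)]
      · rw [addVec, if_neg hv]
    have h2 : (addVec false v A).2 = A.2 := by
      by_cases hv : v ∈ A.1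
      · rw [addVec, if_pos hv]
      · rw [addVec, if_neg hv]; simp
    rw [h1, h2, hset, Submodule.span_insert, sup_assoc]

end Matrices

/-! ## Correctness of the program -/

section Correctness

variable {n : ℕ} {Gs : List (SimpleGraph (Fin n))} {g h : ℕ → Prop}

theorem common_adj_iff (hne : Gs ≠ []) {a b : Fin n} :
    (common Gs).Adj a b ↔ ∀ H ∈ Gs, H.Adj a b := by
  refine ⟨fun hab H hH => common_le hH hab, fun hab => ?_⟩
  obtain ⟨H, hH⟩ := List.exists_mem_of_ne_nil Gs hne
  simp only [common, SimpleGraph.iInf_adj]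
  exact ⟨fun H => ⟨fun hH => hab H hH, (hab _ hH).ne⟩, (hab H hH).ne⟩

theorem triangleCond_iff {G : SimpleGraph (Fin n)}
    (hg : ∀ a b : Fin n, g (a * n + b) ↔ G.Adj a b) (v : ℕ → ZMod 2) :
    (∃ a < n, ∃ b < n, ∃ c < n, ∃ d < n, ∃ e < n, TriangleCond n g a b c ∧
      v = walkVec n a b c a) ↔ ∃ c, c ∈ triangles G ∧ v = graphVec c := by
  constructor
  · rintro ⟨a, ha, b, hb, c, hc, -, -, -, -, ⟨h1, h2, h3⟩, rfl⟩
    lift a to Fin n using ha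
    lift b to Fin n using hb
    lift c to Fin n using hc
    rw [hg] at h1 h2 h3
    exact ⟨_, tri_mem_triangles h1 h2 h3, walkVec_tri h1 h2 h3⟩
  · rintro ⟨c, hc, rfl⟩
    obtain ⟨p, q, hpq⟩ := exists_adj_of_weight_ne_zero (c := c) (by rw [hc.2]; norm_num)
    obtain ⟨r, h1, h2, h3, rfl⟩ := exists_eq_tri hc hpq
    exact ⟨p, p.2, q, q.2, r, r.2, p, p.2, p, p.2, ⟨(hg _ _).2 h1, (hg _ _).2 h2, (hg _ _).2 h3⟩,
      (walkVec_tri h1 h2 h3).symm⟩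

/-- By `sq_mem_freeSquares_iff`, not being spanned by triangles of any graph is the absence of
chords, which the union matrix decides without linear algebra. -/
theorem freeSquareCond_iff (hΔ : DeltaLE Gs 3)
    (hg : ∀ a b : Fin n, g (a * n + b) ↔ (common Gs).Adj a b)
    (hh : ∀ a b : Fin n, h (a * n + b) ↔ a = b ∨ ∃ H ∈ Gs, H.Adj a b) (v : ℕ → ZMod 2) :
    (∃ a < n, ∃ b < n, ∃ c < n, ∃ d < n, ∃ e < n, FreeSquareCond n g h a b c d ∧
      v = walkVec n a b c d) ↔ ∃ c, c ∈ freeSquares Gs ∧ v = graphVec c := by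
  constructor
  · rintro ⟨a, ha, b, hb, c, hc, d, hd, -, -, ⟨h1, h2, h3, h4, h5, h6⟩, rfl⟩
    lift a to Fin n using ha
    lift b to Fin n using hb
    lift c to Fin n using hc
    lift d to Fin n using hd
    rw [hg] at h1 h2 h3 h4
    rw [hh] at h5 h6
    push Not at h5 h6
    have hs : IsSq (common Gs) a b c d := ⟨h1, h2, h3, h4, h5.1, h6.1⟩
    exact ⟨_, (sq_mem_freeSquares_iff hΔ hs).2 fun H hH => ⟨h5.2 H hH, h6.2 H hH⟩, walkVec_sq hs⟩
  · rintro ⟨c, hc, rfl⟩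
    obtain ⟨p, q, hpq⟩ := exists_adj_of_weight_ne_zero (c := c) (by rw [hc.1.2]; norm_num)
    obtain ⟨r, s, hs, rfl⟩ := exists_eq_sq hc.1 hpq
    have hf := (sq_mem_freeSquares_iff hΔ hs).1 hc
    refine ⟨p, p.2, q, q.2, r, r.2, s, s.2, p, p.2, ⟨(hg _ _).2 hs.1, (hg _ _).2 hs.2.1,
      (hg _ _).2 hs.2.2.1, (hg _ _).2 hs.2.2.2.1, ?_, ?_⟩, (walkVec_sq hs).symm⟩
    · rw [hh]
      push Not
      exact ⟨hs.2.2.2.2.1, fun H hH => (hf H hH).1⟩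
    · rw [hh]
      push Not
      exact ⟨hs.2.2.2.2.2, fun H hH => (hf H hH).2⟩

theorem chordSquareCond_imp
    (hg : ∀ a b : Fin n, g (a * n + b) ↔ (common Gs).Adj a b)
    (hh : ∀ a b : Fin n, h (a * n + b) ↔ a = b ∨ ∃ H ∈ Gs, H.Adj a b) {v : ℕ → ZMod 2}
    (hv : ∃ a < n, ∃ b < n, ∃ c < n, ∃ d < n, ∃ e < n, ChordSquareCond n g h a b c d e ∧
      v = walkVec n a d c e) : v = 0 ∨ ∃ c, c ∈ chordSquares Gs ∧ v = graphVec c := by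
  obtain ⟨a, ha, b, hb, c, hc, d, hd, e, he,
    ⟨h1, h2, h3, h4, h5, h6, h7, h8, h9, h10, h11⟩, rfl⟩ := hv
  lift a to Fin n using ha
  lift b to Fin n using hb
  lift c to Fin n using hc
  lift d to Fin n using hd
  lift e to Fin n using he
  rw [hg] at h1 h2 h3 h4 h5 h6 h11
  rw [hh] at h7 h8 h9 h10
  push Not at h7 h8 h9
  by_cases hde : d = e
  · left
    rw [hde]
    exact walkVec_degenerate _ _ _
  · have hp : ChordPair Gs a b c d e :=
      ⟨⟨h1, h2, h3, h4, h7.1, h8.1⟩, ⟨h5, h6, h3, h4, h7.1, h9.1⟩, hde, h10.resolve_left hde, h11,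
        fun H hH => ⟨h7.2 H hH, h8.2 H hH⟩, fun H hH => ⟨h7.2 H hH, h9.2 H hH⟩⟩
    exact Or.inr ⟨_, ⟨a, b, c, d, e, hp, rfl⟩, walkVec_sq hp.isSq⟩

theorem chordSquareCond_of_mem
    (hg : ∀ a b : Fin n, g (a * n + b) ↔ (common Gs).Adj a b)
    (hh : ∀ a b : Fin n, h (a * n + b) ↔ a = b ∨ ∃ H ∈ Gs, H.Adj a b) {c : SimpleGraph (Fin n)}
    (hc : c ∈ chordSquares Gs) :
    ∃ a < n, ∃ b < n, ∃ c' < n, ∃ d < n, ∃ e < n, ChordSquareCond n g h a b c' d e ∧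
      graphVec c = walkVec n a d c' e := by
  obtain ⟨p, q, r, s, t, hp, rfl⟩ := hc
  have hsq := hp.isSq
  obtain ⟨⟨a1, a2, a3, a4, a5, a6⟩, ⟨b1, b2, b3, b4, b5, b6⟩, k3, k4, k5, k6, k7⟩ := hp
  refine ⟨p, p.2, q, q.2, r, r.2, s, s.2, t, t.2, ⟨(hg _ _).2 a1, (hg _ _).2 a2, (hg _ _).2 a3,
    (hg _ _).2 a4, (hg _ _).2 b1, (hg _ _).2 b2, ?_, ?_, ?_, (hh _ _).2 (Or.inr k4),
    fun h' => k5 ((hg _ _).1 h')⟩, (walkVec_sq hsq).symm⟩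
  · rw [hh]
    push Not
    exact ⟨a5, fun H hH => (k6 H hH).1⟩
  · rw [hh]
    push Not
    exact ⟨a6, fun H hH => (k6 H hH).2⟩
  · rw [hh]
    push Not
    exact ⟨b6, fun H hH => (k7 H hH).2⟩

open Classical in
/-- The output of the enumeration is an optimal solution. -/
theorem exists_isOptimal_foldTuples (hne : Gs ≠ []) (hγ : GammaLE Gs 4) (hΔ : DeltaLE Gs 3)
    (hg : ∀ a b : Fin n, g (a * n + b) ↔ (common Gs).Adj a b)
    (hh : ∀ a b : Fin n, h (a * n + b) ↔ a = b ∨ ∃ H ∈ Gs, H.Adj a b) :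
    ∃ B : List (SimpleGraph (Fin n)), B.Nodup ∧ IsOptimal Gs B.toFinset ∧
      (foldTuples n (freeSquareStep n g h) (foldTuples n (chordSquareStep n g h)
        (foldTuples n (triangleStep n g) (⊥, [])))).2 = B.map graphVec := by
  obtain ⟨l₁, e₁, m₁⟩ := exists_foldTuples_eq n (cond := fun a b c _ _ => TriangleCond n g a b c)
    (vec := fun a b c _ _ => walkVec n a b c a) (add := addVec true)
  obtain ⟨l₂, e₂, m₂⟩ := exists_foldTuples_eq n (cond := ChordSquareCond n g h)
    (vec := fun a _ c d e => walkVec n a d c e) (add := addVec false)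
  obtain ⟨l₃, e₃, m₃⟩ := exists_foldTuples_eq n
    (cond := fun a b c d _ => FreeSquareCond n g h a b c d)
    (vec := fun a b c d _ => walkVec n a b c d) (add := addVec true)
  simp only [triangleCond_iff hg] at m₁
  simp only [freeSquareCond_iff hΔ hg hh] at m₃
  obtain ⟨c₁, rfl, hc₁⟩ := exists_map_eq_of_forall_mem l₁ fun v hv => (m₁ v).1 hv
  obtain ⟨c₃, rfl, hc₃⟩ := exists_map_eq_of_forall_mem l₃ fun v hv => (m₃ v).1 hv
  have hc₁' : ∀ c ∈ triangles (common Gs), c ∈ c₁ := fun c hc => by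
    simpa [graphVec_injective.eq_iff] using (m₁ (graphVec c)).2 ⟨c, hc, rfl⟩
  have hc₃' : ∀ c ∈ freeSquares Gs, c ∈ c₃ := fun c hc => by
    simpa [graphVec_injective.eq_iff] using (m₃ (graphVec c)).2 ⟨c, hc, rfl⟩
  obtain ⟨D, d1, d2, -, d4, d5, d6⟩ := foldl_addVec_true ⊥ [] c₁ [] List.nodup_nil
    (by simp [linearIndepOn_empty])
  have hDt : ∀ c ∈ D, c ∈ triangles (common Gs) := fun c hc =>
    hc₁ c ((d4 c hc).resolve_left List.not_mem_nil)
  -- The selected triangles are a basis of the span of all common triangles, so the elimination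
  -- state already holds the first summand of `commonSpan Gs`.
  have hspan : Submodule.span (ZMod 2) (edgeVec '' {c | c ∈ D}) = triSpan (common Gs) := by
    refine le_antisymm (Submodule.span_mono (Set.image_mono hDt)) (Submodule.span_le.2 ?_)
    rintro _ ⟨c, hc, rfl⟩
    simpa using d5 c (hc₁' c hc)
  obtain ⟨S, s1, s2, -, s4, s5, s6⟩ := foldl_addVec_true (commonSpan Gs) (D.map graphVec) c₃ []
    List.nodup_nil (by simp [linearIndepOn_empty])
  have hSf : ∀ c ∈ S, c ∈ freeSquares Gs := fun c hc =>
    hc₃ c ((s4 c hc).resolve_left List.not_mem_nil)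
  -- The vectors inserted without output are the chord squares and possibly zero, so they complete
  -- the span to `commonSpan Gs`.
  have hmid : (triSpan (common Gs)).map (toVec n) ⊔ Submodule.span (ZMod 2) {v | v ∈ l₂} =
      (commonSpan Gs).map (toVec n) := by
    rw [commonSpan, Submodule.map_sup, Submodule.map_span]
    congr 1
    refine le_antisymm (Submodule.span_le.2 fun v hv => ?_) (Submodule.span_le.2 ?_)
    · rcases chordSquareCond_imp hg hh ((m₂ v).1 hv) with rfl | ⟨c, hc, rfl⟩
      · exact zero_mem _
      · exact Submodule.subset_span ⟨_, ⟨c, hc, rfl⟩, rfl⟩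
    · rintro _ ⟨_, ⟨c, hc, rfl⟩, rfl⟩
      exact Submodule.subset_span ((m₂ _).2 (chordSquareCond_of_mem hg hh hc))
  have f₁ : foldTuples n (triangleStep n g) (⊥, []) =
      ((triSpan (common Gs)).map (toVec n), D.map graphVec) := by
    refine (e₁ _).trans ?_
    rw [hspan] at d6
    simpa using d6
  have f₂ : foldTuples n (chordSquareStep n g h)
      ((triSpan (common Gs)).map (toVec n), D.map graphVec) =
      ((commonSpan Gs).map (toVec n), D.map graphVec) := by
    refine (e₂ _).trans ?_
    rw [foldl_addVec_false, hmid]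
  have f₃ : (foldTuples n (freeSquareStep n g h)
      ((commonSpan Gs).map (toVec n), D.map graphVec)).2 = (D ++ S).map graphVec := by
    have := e₃ ((commonSpan Gs).map (toVec n), D.map graphVec)
    have h2 : (foldTuples n (freeSquareStep n g h)
      ((commonSpan Gs).map (toVec n), D.map graphVec)) = _ := this
    rw [h2, List.map_append]
    simp only [List.not_mem_nil, Set.ofPred_false, Set.image_empty, Submodule.span_empty,
      sup_bot_eq, List.map_nil, List.append_nil] at s6
    rw [s6]
  refine ⟨D ++ S, ?_, ?_, by rw [f₁, f₂, f₃]⟩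
  · refine List.nodup_append.2 ⟨d1, s1, ?_⟩
    rintro x hx y hy rfl
    have h1 := (hDt x hx).2
    have h2 := (hSf x hy).1.2
    omega
  · rw [List.toFinset_append]
    refine IsOptimalOfWeight.isOptimal_union hne hγ hΔ ?_ ?_
    · refine isOptimalOfWeight_three hne hγ hΔ (fun c hc => hDt c (List.mem_toFinset.1 hc)) ?_ ?_
      · rw [List.coe_toFinset]
        exact linearIndepOn_mkQ_bot.1 d2
      · intro c hc
        rw [Spans, List.coe_toFinset, hspan]
        exact Submodule.subset_span ⟨c, hc, rfl⟩
    · refine isOptimalOfWeight_four hne hγ hΔ (fun c hc => hSf c (List.mem_toFinset.1 hc)) ?_ ?_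
      · rw [List.coe_toFinset]
        exact s2
      · intro c hc
        rw [List.coe_toFinset]
        exact s5 c (hc₃' c hc)

/-! ### From the abstract computation to the machine -/

theorem length_le_wordSize (w : List ℕ) : w.length ≤ wordSize w := by
  induction w with
  | nil => simp
  | cons a w ih =>
    simp only [wordSize, List.map_cons, List.sum_cons, List.length_cons] at ih ⊢
    omega

theorem graphVec_val_ne_zero_iff (H : SimpleGraph (Fin n)) (a b : Fin n) :
    (graphVec H (a * n + b)).val ≠ 0 ↔ H.Adj a b := by
  rw [ne_eq, ZMod.val_eq_zero, graphVec, toVec_apply]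
  exact edgeVec_ne_zero_iff

open Classical in
/-- The list of graphs is preceded by other letters in the input. -/
theorem wp_solve (hne : Gs ≠ []) (hγ : GammaLE Gs 4) (hΔ : DeltaLE Gs 3) (pre : List ℕ) :
    ∃ B : List (SimpleGraph (Fin n)), B.Nodup ∧ IsOptimal Gs B.toFinset ∧
      Wp (wordSize (pre ++ encodeGraphs Gs)) (solve pre.length)
        (fun s => HoldsOut n (B.map graphVec) s) (initMem (pre ++ encodeGraphs Gs)) := by
  set L := wordSize (pre ++ encodeGraphs Gs) with hLdef
  have hlen : Gs.length * (n * n + 1) + 1 ≤ L := by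
    have := length_le_wordSize (pre ++ encodeGraphs Gs)
    rw [List.length_append, length_encodeGraphs] at this
    omega
  -- The input contains at least one full matrix, so its size bounds `n * n` and the number of
  -- graphs, and thereby every loop.
  have hpos : 0 < Gs.length := List.length_pos_iff.2 hne
  have hL : n * n ≤ L := by nlinarith
  have hk : Gs.length ≤ L := by nlinarith
  have hget : ∀ i, (pre ++ encodeGraphs Gs).getD (pre.length + i) 0 = (encodeGraphs Gs).getD i 0 :=
    fun i => by rw [List.getD_append_right _ _ _ _ (by omega), Nat.add_sub_cancel_left]
  have hset := wp_setup (L := L) (n := n) (o := pre.length) (k := Gs.length)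
    (input := pre ++ encodeGraphs Gs) (M := fun i j => (graphVec (Gs.getD i ⊥) j).val) hL hk
    (by rw [← add_zero pre.length, hget]; simp [encodeGraphs])
    (by
      have := getD_encodeGraphs Gs (i := 0) (j := 0) hpos (by omega)
      rw [zero_mul] at this
      rw [hget, ← zero_add 1, ← add_zero 0, add_assoc]
      simpa [encodeVec] using this)
    (fun i hi j hj => by
      rw [add_assoc, add_assoc, hget, ← getD_encodeVec_succ _ hj,
        ← getD_encodeGraphs Gs hi (by omega)]
      congr 1
      ring)
  have hmem : ∀ H, H ∈ Gs ↔ ∃ i < Gs.length, Gs.getD i ⊥ = H := by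
    intro H
    rw [List.mem_iff_getElem]
    exact exists_congr fun i => ⟨fun ⟨hi, he⟩ => ⟨hi, by rwa [List.getD_eq_getElem _ _ hi]⟩,
      fun ⟨hi, he⟩ => ⟨hi, by rwa [List.getD_eq_getElem _ _ hi] at he⟩⟩
  obtain ⟨B, hB, hopt, hout⟩ := exists_isOptimal_foldTuples
    (g := fun j => ∀ i < Gs.length, (graphVec (Gs.getD i ⊥) j).val ≠ 0)
    (h := fun j => (∃ u < n, j = u * n + u) ∨
      ∃ i < Gs.length, (graphVec (Gs.getD i ⊥) j).val ≠ 0) hne hγ hΔ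
    (by
      intro a b
      simp only [graphVec_val_ne_zero_iff, common_adj_iff hne, hmem]
      exact ⟨fun h H ⟨i, hi, he⟩ => he ▸ h i hi, fun h i hi => h _ ⟨i, hi, rfl⟩⟩)
    (by
      intro a b
      simp only [graphVec_val_ne_zero_iff, hmem]
      refine or_congr ⟨?_, ?_⟩ ⟨?_, ?_⟩
      · rintro ⟨u, hu, he⟩
        obtain ⟨h1, h2⟩ := eq_of_mul_add_eq b.2 hu he
        exact Fin.ext (h1.trans h2.symm)
      · rintro rfl
        exact ⟨a, a.2, rfl⟩
      · rintro ⟨i, hi, hadj⟩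
        exact ⟨_, ⟨i, hi, rfl⟩, hadj⟩
      · rintro ⟨_, ⟨i, hi, rfl⟩, hadj⟩
        exact ⟨i, hi, hadj⟩)
  refine ⟨B, hB, hopt, Wp.seq (hset.mono fun s₁ h₁ => ?_)⟩
  refine Wp.seq ((wp_triangleLoop hL h₁).mono fun s₂ h₂ => ?_)
  refine Wp.seq ((wp_chordSquareLoop hL h₂).mono fun s₃ h₃ => ?_)
  refine (wp_freeSquareLoop hL h₃).mono fun s₄ h₄ => ?_
  rw [← hout]
  exact h₄.2.2.2

theorem maxMCBIPoly : MaxMCBIPoly fun I => GammaLE I.graphs 4 ∧ DeltaLE I.graphs 3 := by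
  classical
  refine ⟨maxProg, maxProg.boundPoly, fun I hI => ?_⟩
  obtain ⟨B, hB, hopt, hwp⟩ := wp_solve I.graphs_ne_nil hI.1 hI.2 []
  have hwp' : Wp (wordSize (encodeGraphs I.graphs)) maxProg
      (fun s => output s = encodeGraphs B) (initMem (encodeGraphs I.graphs)) := by
    -- The number of cycles goes into the reserved cell `0`, which makes the output one letter
    -- longer than the value of register `12`.
    refine Wp.seq (hwp.mono fun s hs => Wp.seq (Wp.store (Wp.assign ?_)))
    rw [output, Mem.setReg_reg, if_pos rfl]
    simp only [Expr.eval, Mem.setArr_reg, Mem.setReg_arr, hs.1]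
    rw [List.range_succ_eq_map, List.map_cons, List.map_map, encodeGraphs, Mem.setArr_arr_self,
      if_pos rfl, List.length_map]
    congr 1
    have : (List.flatMap encodeGraph B) = (B.map graphVec).flatMap (encodeVec I.n) := by
      rw [List.flatMap_map]
      congr 1
      funext c
      exact encodeGraph_eq c
    rw [this, ← hs.2]
    refine List.map_congr_left fun i _ => ?_
    simp
  obtain ⟨s, t, h1, h2, h3⟩ := hwp'
  refine ⟨_, t, ⟨s, h1, h3⟩, by rwa [Prog.eval_boundPoly], B, hB, ?_, rfl⟩
  convert! hopt

theorem mcbiPoly : MCBIPoly fun I => GammaLE I.graphs 4 ∧ DeltaLE I.graphs 3 := by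
  classical
  refine ⟨decisionProg, decisionProg.boundPoly, fun x hx => ?_⟩
  obtain ⟨B, hB, hopt, hwp⟩ := wp_solve x.1.graphs_ne_nil hx.1 hx.2 [x.2]
  have hiff : (∃ B, IsFeasible x.1.graphs B ∧ x.2 ≤ B.card) ↔ x.2 ≤ B.length := by
    rw [← List.toFinset_card_of_nodup hB]
    exact ⟨fun ⟨B', h1, h2⟩ => h2.trans (hopt.2 B' h1), fun h => ⟨_, hopt.1, h⟩⟩
  have hwp' : Wp (wordSize (x.2 :: encodeGraphs x.1.graphs)) decisionProg
      (fun s => output s = [if ∃ B, IsFeasible x.1.graphs B ∧ x.2 ≤ B.card then 1 else 0])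
      (initMem (x.2 :: encodeGraphs x.1.graphs)) := by
    refine Wp.seq (hwp.frame fun s hs _ harr => Wp.seq (Wp.store (Wp.assign ?_)))
    -- The input array is never written to, so `K` can still be read after the computation.
    have h0 : s.arr 0 0 = x.2 := by
      rw [harr 0 (by simp only [List.length_singleton]; decide)]
      simp [initMem]
    rw [output, Mem.setReg_reg, if_pos rfl]
    simp only [Expr.eval, Mem.setReg_arr, hs.1, h0, List.length_map, List.range_one, List.map_cons,
      List.map_nil, Mem.setArr_arr_self, if_true, hiff]
    congr 1
    -- With truncated subtraction, `1 - (K - |B|)` is `1` if `K ≤ |B|` and `0` otherwise.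
    split_ifs <;> omega
  obtain ⟨s, t, h1, h2, h3⟩ := hwp'
  refine ⟨_, t, ⟨s, h1, h3⟩, by rwa [Prog.eval_boundPoly], ?_⟩
  congr!

end Correctness

end MCBI

open Classical in
theorem mainTheorem4 :
    MCBI.MCBIPoly (fun I => MCBI.GammaLE I.graphs 4 ∧ MCBI.DeltaLE I.graphs 3) ∧
    MCBI.MaxMCBIPoly (fun I => MCBI.GammaLE I.graphs 4 ∧ MCBI.DeltaLE I.graphs 3) ∧
    ∀ I : MCBI.Instance, MCBI.GammaLE I.graphs 4 → MCBI.DeltaLE I.graphs 3 →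
      ∀ (P : MCBI.ShortestPaths (MCBI.common I.graphs)) (l : List (SimpleGraph (Fin I.n))),
        l.Nodup → (∀ c, c ∈ l ↔ c ∈ MCBI.candidateSquares I.graphs P) →
        MCBI.IsOptimalOfWeight I.graphs 4 (MCBI.greedy I.graphs l) ∧
        ∀ D, MCBI.IsOptimalOfWeight I.graphs 3 D →
          MCBI.IsOptimal I.graphs (D ∪ MCBI.greedy I.graphs l) := by
  refine ⟨MCBI.mcbiPoly, MCBI.maxMCBIPoly, fun I hγ hΔ P l _ hl => ?_⟩
  rw [MCBI.candidateSquares_eq] at hl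
  have hS := MCBI.isOptimalOfWeight_greedy I.graphs_ne_nil hγ hΔ hl
  exact ⟨hS, fun D hD => hD.isOptimal_union I.graphs_ne_nil hγ hΔ hS⟩
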